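/- Let $T,L,v_{\min}>0$, let $v\colon[0,T]\to[v_{\min},+\infty)$ be Lipschitz continuous and let $g\in C^1(\mathbb R;\mathbb R)$. Write $s^+=\max\{s,0\}$, $s^-=\max\{-s,0\}$, $\operatorname{sgn}^+(s)=1$ if $s>0$ and $0$ otherwise, $\operatorname{sgn}^-(s)=-1$ if $s<0$ and $0$ otherwise. For $w_\ell\in L^\infty(I_\ell;\mathbb R)$, $\ell=1,\dots,m$, on real intervals $I_\ell$, let $\mathcal U(w_1,\dots,w_m)=[\min_\ell \operatorname{ess\,inf}_{I_\ell}w_\ell,\ \max_\ell\operatorname{ess\,sup}_{I_\ell}w_\ell]$. Given $u_o\in(L^1\cap BV)([0,L];\mathbb R)$ and $\mathbf u_b=(u_{b,1},u_{b,2})\in(L^1\cap BV)([0,T];\mathbb R^2)$, put $f(t,w)=v(t)g(w)$ and $\mathcal U_0=\mathcal U(u_o,u_{b,1},u_{b,2})$. A solution of $$\partial_tu+\partial_x(v(t)g(u))=0 \text{ on } [0,T]\times[0,L],\qquad u(0,\cdot)=u_o,\qquad (u(\cdot,0),u(\cdot,L))=\mathbf u_b$$ is a map $u\in L^\infty([0,T]\times[0,L];\mathbb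 R)$ with an integrable final value $u(T,\cdot)$ such that for both signs $\pm$, for every $k\in\mathcal U_0$ and every $\phi\in C^1_c(\mathbb R\times\mathbb R;[0,+\infty))$, $$\begin{aligned}&\int_0^T\!\!\int_0^L\bigl\{(u-k)^\pm\partial_t\phi+\operatorname{sgn}^\pm(u-k)\,(f(t,u)-f(t,k))\,\partial_x\phi\bigr\}\,dx\,dt+\int_0^L(u_o(x)-k)^\pm\phi(0,x)\,dx-\int_0^L(u(T,x)-k)^\pm\phi(T,x)\,dx\\&\quad+\|\partial_uf\|_{L^\infty([0,T]\times\mathcal U_0)}\int_0^T\bigl\{(u_{b,1}(t)-k)^\pm\phi(t,0)+(u_{b,2}(t)-k)^\pm\phi(t,L)\bigr\}\,dt\ \ge\ 0.\end{aligned}$$ Say that $u$ has traces at $0$ and $L$ if for a.e. $t\in[0,T]$ there are reals $w_0,w_L$ with $\frac1r\int_0^r|u(t,x)-w_0|\,dx\to0$ and $\frac1r\int_{L-r}^L|u(t,x)-w_L|\,dx\to0$ as $r\to0+$. Let $u_o,\tilde u_o\in(L^1\cap BV)([0,L];\mathbb R)$, $\mathbf u_b,\tilde{\mathbf u}_b\in(L^1\cap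 BV)([0,T];\mathbb R^2)$, and let $u,\tilde u$ be solutions (with the same $v$ and $g$) for the data $(u_o,\mathbf u_b)$ and $(\tilde u_o,\tilde{\mathbf u}_b)$, both having traces at $0$ and $L$. Then $u$ and $\tilde u$ have representatives in $C([0,T];L^1([0,L];\mathbb R))$, which take the values $u_o$, $\tilde u_o$ at time $0$ and the given final values at time $T$, and, for these representatives, for all $t\in[0,T]$, $$\|u(t)-\tilde u(t)\|_{L^1([0,L])}\le\|u_o-\tilde u_o\|_{L^1([0,L])}+\|v\|_{L^\infty([0,t])}\,\|g'\|_{L^\infty(\mathcal U)}\sum_{i=1}^2\|u_{b,i}-\tilde u_{b,i}\|_{L^1([0,t])},$$ where $\mathcal U=\mathcal U(u_{b,1}|_{[0,t]},u_{b,2}|_{[0,t]},\tilde u_{b,1}|_{[0,t]},\tilde u_{b,2}|_{[0,t]})$. -/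

import Mathlib

open MeasureTheory Filter Topology Set

noncomputable section

namespace SegmentIBVP

/-- `sgn⁺ s`: equal to `1` if `s > 0` and to `0` otherwise. -/
def sgnPos (s : ℝ) : ℝ := if 0 < s then 1 else 0

/-- `sgn⁻ s`: equal to `-1` if `s < 0` and to `0` otherwise. -/
def sgnNeg (s : ℝ) : ℝ := if s < 0 then -1 else 0

/-- `s⁺ = max {s, 0}`. -/
def partPos (s : ℝ) : ℝ := max s 0

/-- `s⁻ = max {-s, 0}`. -/
def partNeg (s : ℝ) : ℝ := max (-s) 0

/-- `𝓤(u₁, …, uₘ) = [min essinf uₗ, max esssup uₗ]`, where `uₗ` is considered on `Iₗ`. -/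
def essHull {m : ℕ} (u : Fin m → ℝ → ℝ) (I : Fin m → Set ℝ) : Set ℝ :=
  Icc (⨅ l, essInf (u l) (volume.restrict (I l))) (⨆ l, essSup (u l) (volume.restrict (I l)))

/-- The norm of `h` in `L^∞(A; ℝ)`, with respect to Lebesgue measure. -/
def supNormOn {α : Type*} [MeasureSpace α] (h : α → ℝ) (A : Set α) : ℝ :=
  (eLpNorm h ⊤ (volume.restrict A)).toReal

/-- `w ∈ (L¹ ∩ BV)([a,b]; ℝ)`: `w` is integrable on `[a,b]` and coincides almost everywhere on
`[a,b]` with a function of bounded variation (finite essential variation). -/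
def MemL1BV (w : ℝ → ℝ) (a b : ℝ) : Prop :=
  IntegrableOn w (Icc a b) ∧
    ∃ z : ℝ → ℝ, w =ᵐ[volume.restrict (Icc a b)] z ∧ BoundedVariationOn z (Icc a b)

/-- The left-hand side of the entropy inequality on `[0,T] × [0,L]` for the flux `f`, the initial
datum `uo`, the boundary data `ub 0` at `x = 0` and `ub 1` at `x = L`. The pair `(part, sgn)` is
`(s ↦ s⁺, sgn⁺)` or `(s ↦ s⁻, sgn⁻)`, and `M` is the coefficient of the boundary term. -/
def entropyBalance (T L M : ℝ) (f : ℝ → ℝ → ℝ) (uo : ℝ → ℝ) (ub : Fin 2 → ℝ → ℝ)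
    (u : ℝ → ℝ → ℝ) (part sgn : ℝ → ℝ) (k : ℝ) (φ : ℝ → ℝ → ℝ) : ℝ :=
  (∫ t in (0 : ℝ)..T, ∫ x in (0 : ℝ)..L,
      (part (u t x - k) * deriv (fun s => φ s x) t
        + sgn (u t x - k) * (f t (u t x) - f t k) * deriv (fun y => φ t y) x))
    + (∫ x in (0 : ℝ)..L, part (uo x - k) * φ 0 x)
    - (∫ x in (0 : ℝ)..L, part (u T x - k) * φ T x)
    + M * ∫ t in (0 : ℝ)..T, (part (ub 0 t - k) * φ t 0 + part (ub 1 t - k) * φ t L)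

/-- The interval `𝓤(uo, ub)` of the data of the problem on `[0,T] × [0,L]`. -/
def dataHull (T L : ℝ) (uo : ℝ → ℝ) (ub : Fin 2 → ℝ → ℝ) : Set ℝ :=
  essHull ![uo, ub 0, ub 1] ![Icc 0 L, Icc 0 T, Icc 0 T]

/-- `u` is a solution of `∂ₜu + ∂ₓ f(t,u) = 0` on `[0,T] × [0,L]`, `u(0,·) = uo`,
`(u(·,0), u(·,L)) = ub`: `u` is in `L^∞([0,T] × [0,L])`, it comes with an integrable final value
`u T`, and both semi-entropy inequalities hold for all levels `k ∈ 𝓤(uo, ub)` and all nonnegative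
`C¹` test functions with compact support in `ℝ × ℝ`.

The coefficient `‖∂ᵤf‖_{L^∞([0,T] × 𝓤)}` of the boundary term controls the flux only between
values in `𝓤`; accordingly the levels `k` range over `𝓤`. Requiring the inequalities for every
real `k` would select a subset of the functions that are solutions here (and no function at all
for strictly concave or convex quadratic `f`), so that any property of the solutions in the sense
below holds for those functions too. -/
structure IsSolution (T L : ℝ) (f : ℝ → ℝ → ℝ) (uo : ℝ → ℝ) (ub : Fin 2 → ℝ → ℝ)
    (u : ℝ → ℝ → ℝ) : Prop where
  memLp : MemLp (Function.uncurry u) ⊤ (volume.restrict (Icc (0 : ℝ) T ×ˢ Icc (0 : ℝ) L))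
  integrable_final : IntegrableOn (u T) (Icc 0 L)
  entropy : ∀ k ∈ dataHull T L uo ub, ∀ φ : ℝ → ℝ → ℝ,
    ContDiff ℝ 1 (Function.uncurry φ) → HasCompactSupport (Function.uncurry φ) →
    (∀ t x, 0 ≤ φ t x) →
      0 ≤ entropyBalance T L
          (supNormOn (fun p : ℝ × ℝ => deriv (f p.1) p.2) (Icc 0 T ×ˢ dataHull T L uo ub))
          f uo ub u partPos sgnPos k φ ∧
      0 ≤ entropyBalance T L
          (supNormOn (fun p : ℝ × ℝ => deriv (f p.1) p.2) (Icc 0 T ×ˢ dataHull T L uo ub))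
          f uo ub u partNeg sgnNeg k φ

/-- For a.e. `t ∈ [0,T]`, `u(t,·)` admits a trace for `x → 0+`: a real `w` such that the mean of
`|u(t,x) - w|` over `0 < x < r` tends to `0` as `r → 0+`. For bounded `u` this is the case as soon
as the (essential) limit of `u(t,x)` for `x → 0+` exists. -/
def HasLeftTrace (T : ℝ) (u : ℝ → ℝ → ℝ) : Prop :=
  ∀ᵐ t ∂(volume.restrict (Icc (0 : ℝ) T)), ∃ w : ℝ,
    Tendsto (fun r : ℝ => r⁻¹ * ∫ x in (0 : ℝ)..r, |u t x - w|) (𝓝[>] 0) (𝓝 0)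

/-- For a.e. `t ∈ [0,T]`, `u(t,·)` admits a trace for `x → L-`. -/
def HasRightTrace (T L : ℝ) (u : ℝ → ℝ → ℝ) : Prop :=
  ∀ᵐ t ∂(volume.restrict (Icc (0 : ℝ) T)), ∃ w : ℝ,
    Tendsto (fun r : ℝ => r⁻¹ * ∫ x in (L - r)..L, |u t x - w|) (𝓝[>] 0) (𝓝 0)

/-- `L¹([0,L]; ℝ)`. -/
abbrev L1Segment (L : ℝ) : Type := Lp ℝ 1 (volume.restrict (Icc (0 : ℝ) L))

/-- `U` is the representative of `u` in `C([0,T]; L¹([0,L]; ℝ))`, it takes the value `uo` at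
time `0` and the final value `u T` at time `T`. -/
structure IsTimeContinuousRepr (T L : ℝ) (uo : ℝ → ℝ) (u : ℝ → ℝ → ℝ)
    (U : ℝ → L1Segment L) : Prop where
  continuousOn : ContinuousOn U (Icc 0 T)
  ae_eq : ∀ᵐ t ∂(volume.restrict (Icc (0 : ℝ) T)), U t =ᵐ[volume.restrict (Icc (0 : ℝ) L)] u t
  initial : U 0 =ᵐ[volume.restrict (Icc (0 : ℝ) L)] uo
  final : U T =ᵐ[volume.restrict (Icc (0 : ℝ) L)] u T

end SegmentIBVP

end

noncomputable section

namespace SegmentIBVP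

/-! ### A smooth ramp and one-sided boundary layers -/

/-! The new time τ = ∫₀ᵗ v turns the equation into ∂_τ u + ∂_x g(u) = 0 (`EntIneq.timeChange`). The
boundary constant M only becomes M / vmin, and the Jacobian v reappears at the end as the factor ‖v‖
of the estimate. Testing with exp(-t) at the two extreme levels of the data hull shows that a
solution takes its values in that hull (`EntIneq.range`). So g may be modified outside it, and a
single globally Lipschitz flux serves both solutions.

In the interior, the inequality at a level outside the hull differs from the one at the projected
level by a constant entropy pair (`kruzkov_split`). Hence Kruzhkov's inequalities hold for all real
levels, and doubling of variables gives ∂_τ|u - u'| + ∂_x(sgn(u - u')(g(u) - g(u'))) ≤ 0 in the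
sense of distributions (`IsKruzkov.contraction`).

At x = 0, tests concentrated in a thin layer give q(w) ≤ M p(b) for the trace w, the datum b and
every semi-entropy pair (p, q) with level in the hull (`EntIneq.trace_le`). For k between b and w
the appropriate p vanishes at b, so M drops out and the Bardos-Leroux-Nédélec condition
`BoundaryAdmissible` remains. Two admissible pairs satisfy sgn(w - w')(g(w) - g(w')) ≤ C |b - b'|,
where C is a Lipschitz constant of g between b and b' only (`BoundaryAdmissible.kflux_le`); this is
why the hull of the boundary data alone enters the estimate. The end point L is treated by
reflection. Cutting off in x and letting the cut-off tend to 1 bounds the growth of the L¹ distance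
between almost all pairs of times (`InteriorSol.comparison`).

Continuity in time comes from the same comparison, applied to a solution and its time translate: the
increments are controlled by the deviation from the initial datum near time 0 and by the L¹ modulus
of continuity of the boundary data. The initial datum is attained in the mean, by using the levels
uo(y) and averaging in y (`AutSol.initial_estimate`). At the final time the semi-entropies at the
extreme levels are affine on the range of u, so the two inequalities together identify the final
value (`AutSol.final_eq`). Continuity then lets the earlier time in the comparison tend to 0
(`AutSol.norm_sub_le`). -/

/-- The derivative of the smooth transition from `0` to `1`. -/
def rampKernel : ℝ → ℝ := deriv Real.smoothTransition

theorem hasDerivAt_smoothTransition (x : ℝ) :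
    HasDerivAt Real.smoothTransition (rampKernel x) x :=
  ((Real.smoothTransition.contDiff (n := 1)).differentiable (by simp) x).hasDerivAt

theorem continuous_rampKernel : Continuous rampKernel :=
  (Real.smoothTransition.contDiff (n := 1)).continuous_deriv (by simp)

theorem rampKernel_nonneg (x : ℝ) : 0 ≤ rampKernel x :=
  Real.smoothTransition.monotone.deriv_nonneg

/-- The transition is at its global minimum on the whole half-line, so its derivative vanishes even
at the corner 0; the other end is symmetric. -/
theorem rampKernel_of_nonpos {x : ℝ} (hx : x ≤ 0) : rampKernel x = 0 := by
  have h : IsLocalMin Real.smoothTransition x := by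
    refine Eventually.of_forall fun y => ?_
    rw [Real.smoothTransition.zero_of_nonpos hx]
    exact Real.smoothTransition.nonneg y
  exact h.deriv_eq_zero

theorem rampKernel_of_one_le {x : ℝ} (hx : 1 ≤ x) : rampKernel x = 0 := by
  have h : IsLocalMax Real.smoothTransition x := by
    refine Eventually.of_forall fun y => ?_
    rw [Real.smoothTransition.one_of_one_le hx]
    exact Real.smoothTransition.le_one y
  exact h.deriv_eq_zero

theorem integral_rampKernel : ∫ x, rampKernel x = 1 := by
  have h1 : ∫ x, rampKernel x = ∫ x in Ioc (0 : ℝ) 1, rampKernel x := by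
    refine (setIntegral_eq_integral_of_forall_compl_eq_zero fun x hx => ?_).symm
    by_cases h : x ≤ 0
    · exact rampKernel_of_nonpos h
    · refine rampKernel_of_one_le ?_
      by_contra h'
      exact hx ⟨not_le.1 h, (not_le.1 h').le⟩
  rw [h1, ← intervalIntegral.integral_of_le zero_le_one,
    intervalIntegral.integral_eq_sub_of_hasDerivAt (fun x _ => hasDerivAt_smoothTransition x)
      (continuous_rampKernel.intervalIntegrable _ _)]
  simp

/-- `w` is the trace of `p` for `x → 0+`, in the sense of means. -/
def HasTrace (p : ℝ → ℝ) (w : ℝ) : Prop :=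
  Tendsto (fun r : ℝ => r⁻¹ * ∫ x in (0 : ℝ)..r, |p x - w|) (𝓝[>] 0) (𝓝 0)

theorem LocallyIntegrable.intervalIntegrable' {p : ℝ → ℝ} (hp : LocallyIntegrable p) (a b : ℝ) :
    IntervalIntegrable p volume a b :=
  (hp.integrableOn_isCompact isCompact_uIcc).intervalIntegrable

theorem exists_bound_of_support_Icc {κ : ℝ → ℝ} (hκ : Continuous κ) {a : ℝ}
    (h0 : ∀ x, x ∉ Icc 0 a → κ x = 0) : ∃ C, 0 ≤ C ∧ ∀ x, |κ x| ≤ C := by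
  obtain ⟨C, hC⟩ := (isCompact_Icc (a := (0 : ℝ)) (b := a)).exists_bound_of_continuousOn
    hκ.continuousOn
  refine ⟨max C 0, le_max_right _ _, fun x => ?_⟩
  by_cases hx : x ∈ Icc 0 a
  · exact (hC x hx).trans (le_max_left _ _)
  · simp [h0 x hx]

/-- Means against a concentrating kernel converge to the trace. -/
theorem HasTrace.tendsto_layer {p : ℝ → ℝ} {w : ℝ} (hw : HasTrace p w)
    (hp : LocallyIntegrable p) {κ : ℝ → ℝ} (hκ : Continuous κ) {a : ℝ} (ha : 0 < a)
    (h0 : ∀ x, x ∉ Icc 0 a → κ x = 0) (h1 : ∫ x, κ x = 1) :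
    Tendsto (fun r : ℝ => ∫ x, r⁻¹ * κ (r⁻¹ * x) * p x) (𝓝[>] 0) (𝓝 w) := by
  obtain ⟨C, hC0, hC⟩ := exists_bound_of_support_Icc hκ h0
  have hcs : HasCompactSupport κ := HasCompactSupport.intro isCompact_Icc h0
  -- The scaled kernel has mass one, lives on [0, a r] and is bounded by C / r. The error is
  -- therefore at most a C times the mean of |p - w| over (0, a r).
  have key : ∀ r : ℝ, 0 < r → |(∫ x, r⁻¹ * κ (r⁻¹ * x) * p x) - w|
      ≤ (a * C) * ((a * r)⁻¹ * ∫ x in (0 : ℝ)..(a * r), |p x - w|) := by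
    intro r hr
    have hsup : ∀ x, x ∉ Icc 0 (a * r) → κ (r⁻¹ * x) = 0 := by
      intro x hx
      refine h0 _ fun h => hx ⟨?_, ?_⟩
      · have := mul_nonneg hr.le h.1
        rwa [mul_inv_cancel_left₀ hr.ne'] at this
      · have := mul_le_mul_of_nonneg_left h.2 hr.le
        rw [mul_inv_cancel_left₀ hr.ne'] at this
        linarith
    have hk : Continuous fun x => r⁻¹ * κ (r⁻¹ * x) := by fun_prop
    have hkc : HasCompactSupport fun x => r⁻¹ * κ (r⁻¹ * x) :=
      HasCompactSupport.intro isCompact_Icc fun x hx => by rw [hsup x hx, mul_zero]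
    have hint1 : Integrable fun x => r⁻¹ * κ (r⁻¹ * x) * p x := by
      have := hp.integrable_smul_left_of_hasCompactSupport hk hkc
      simpa [smul_eq_mul] using this
    have hint2 : Integrable fun x => r⁻¹ * κ (r⁻¹ * x) * w :=
      (hk.integrable_of_hasCompactSupport hkc).mul_const w
    have hw1 : ∫ x, r⁻¹ * κ (r⁻¹ * x) * w = w := by
      rw [integral_mul_const, integral_const_mul, Measure.integral_comp_mul_left, h1]
      simp [abs_of_pos hr, hr.ne']
    have hsplit : (∫ x, r⁻¹ * κ (r⁻¹ * x) * p x) - w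
        = ∫ x in Icc 0 (a * r), r⁻¹ * κ (r⁻¹ * x) * (p x - w) := by
      rw [setIntegral_eq_integral_of_forall_compl_eq_zero
        (fun x hx => by rw [hsup x hx]; ring)]
      conv_lhs => rw [← hw1]
      rw [← integral_sub hint1 hint2]
      refine integral_congr_ae (Eventually.of_forall fun x => ?_)
      simp only []
      ring
    rw [hsplit, integral_Icc_eq_integral_Ioc,
      ← intervalIntegral.integral_of_le (by positivity : 0 ≤ a * r)]
    have hpi : IntervalIntegrable (fun x => |p x - w|) volume 0 (a * r) :=
      ((LocallyIntegrable.intervalIntegrable' hp _ _).sub intervalIntegrable_const).abs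
    calc |∫ x in (0 : ℝ)..(a * r), r⁻¹ * κ (r⁻¹ * x) * (p x - w)|
        ≤ ∫ x in (0 : ℝ)..(a * r), r⁻¹ * C * |p x - w| := by
          rw [← Real.norm_eq_abs]
          refine intervalIntegral.norm_integral_le_of_norm_le (by positivity) ?_
            (hpi.const_mul _)
          refine Eventually.of_forall fun x _ => ?_
          rw [Real.norm_eq_abs, abs_mul, abs_mul, abs_of_pos (inv_pos.2 hr)]
          gcongr
          exact hC _
      _ = (a * C) * ((a * r)⁻¹ * ∫ x in (0 : ℝ)..(a * r), |p x - w|) := by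
          rw [intervalIntegral.integral_const_mul]
          field_simp
  have hlim : Tendsto (fun r : ℝ => (a * C) * ((a * r)⁻¹ * ∫ x in (0 : ℝ)..(a * r), |p x - w|))
      (𝓝[>] 0) (𝓝 0) := by
    have h2 : Tendsto (fun r : ℝ => a * r) (𝓝[>] 0) (𝓝[>] 0) := by
      refine tendsto_nhdsWithin_iff.2 ⟨?_, ?_⟩
      · have : Tendsto (fun r : ℝ => a * r) (𝓝 0) (𝓝 (a * 0)) := by
          exact (continuous_const_mul a).tendsto 0
        rw [mul_zero] at this
        exact this.mono_left nhdsWithin_le_nhds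
      · filter_upwards [self_mem_nhdsWithin] with r hr
        exact mul_pos ha hr
    have := (hw.comp h2).const_mul (a * C)
    rw [mul_zero] at this
    exact this
  rw [tendsto_iff_norm_sub_tendsto_zero]
  refine squeeze_zero' (Eventually.of_forall fun _ => norm_nonneg _) ?_ hlim
  filter_upwards [self_mem_nhdsWithin] with r hr
  exact key r hr

/-- Almost every point is a right Lebesgue point. -/
theorem ae_hasTrace {p : ℝ → ℝ} (hp : LocallyIntegrable p) :
    ∀ᵐ s : ℝ, HasTrace (fun x => p (s + x)) (p s) := by
  filter_upwards [IsUnifLocDoublingMeasure.ae_tendsto_average_norm_sub volume hp 1] with s hs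
  have h := hs (ι := ℝ) (l := 𝓝[>] 0) (fun _ => s) id tendsto_id (by
    filter_upwards [self_mem_nhdsWithin] with r hr
    exact Metric.mem_closedBall_self (by simpa using (le_of_lt hr)))
  -- The one-sided interval has length r and the ball 2r, whence the factor 2 between the two means.
  have h2 := h.const_mul 2
  rw [mul_zero] at h2
  refine squeeze_zero' ?_ ?_ h2
  · filter_upwards [self_mem_nhdsWithin] with r hr
    have hr' : (0 : ℝ) < r := hr
    exact mul_nonneg (inv_nonneg.2 hr'.le)
      (intervalIntegral.integral_nonneg hr'.le fun _ _ => abs_nonneg _)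
  · filter_upwards [self_mem_nhdsWithin] with r hr
    have hr' : (0 : ℝ) < r := hr
    have e1 : ∫ x in (0 : ℝ)..r, |p (s + x) - p s| = ∫ x in s..(s + r), |p x - p s| := by
      have := intervalIntegral.integral_comp_add_left (a := 0) (b := r)
        (fun x => |p x - p s|) s
      simpa using this
    have hi : IntegrableOn (fun x => |p x - p s|) (Icc (s - r) (s + r)) :=
      ((hp.integrableOn_isCompact isCompact_Icc).sub
        (integrableOn_const (by simp))).abs
    rw [e1, setAverage_eq, Real.closedBall_eq_Icc, intervalIntegral.integral_of_le (by linarith)]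
    have e2 : volume.real (Icc (s - id r) (s + id r)) = 2 * r := by
      simp [Measure.real]
      rw [ENNReal.toReal_ofReal (by linarith)]; ring
    have e3 : ∫ x in Ioc s (s + r), |p x - p s| ≤ ∫ x in Icc (s - r) (s + r), |p x - p s| := by
      refine setIntegral_mono_set hi (Eventually.of_forall fun _ => abs_nonneg _) ?_
      exact (Ioc_subset_Icc_self.trans (Icc_subset_Icc (by linarith) le_rfl)).eventuallyLE
    rw [e2]
    simp only [smul_eq_mul, id, Real.norm_eq_abs]
    calc r⁻¹ * ∫ x in Ioc s (s + r), |p x - p s|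
        ≤ r⁻¹ * ∫ x in Icc (s - r) (s + r), |p x - p s| := by gcongr
      _ = 2 * ((2 * r)⁻¹ * ∫ x in Icc (s - r) (s + r), |p x - p s|) := by
        field_simp

/-- A function whose distributional derivative is controlled satisfies the corresponding
integrated inequality almost everywhere. -/
theorem ae_le_add_of_forall_test {N : ℝ → ℝ} (hN : LocallyIntegrable N) {T C : ℝ}
    (h : ∀ η : ℝ → ℝ, ContDiff ℝ 1 η → HasCompactSupport η → (∀ t, 0 ≤ η t) → (∀ t, η t ≤ 1) →
      tsupport η ⊆ Ioo 0 T → 0 ≤ (∫ t, deriv η t * N t) + C) :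
    ∀ᵐ s : ℝ, ∀ᵐ t : ℝ, 0 < s → s < t → t < T → N t ≤ N s + C := by
  filter_upwards [ae_hasTrace hN] with s hs
  filter_upwards [ae_hasTrace hN] with t ht hs0 hst htT
  have lim : ∀ a : ℝ, HasTrace (fun x => N (a + x)) (N a) →
      Tendsto (fun r : ℝ => ∫ x, r⁻¹ * rampKernel (r⁻¹ * (x - a)) * N x) (𝓝[>] 0) (𝓝 (N a)) := by
    intro a ha
    have hloc : LocallyIntegrable fun x => N (a + x) := by
      intro x
      obtain ⟨S, hS, hi⟩ := hN (a + x)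
      refine ⟨(fun y => a + y) ⁻¹' S, (continuous_const_add a).continuousAt hS, ?_⟩
      exact ((measurePreserving_add_left volume a).integrableOn_comp_preimage
        (measurableEmbedding_addLeft a)).2 hi
    have := ha.tendsto_layer hloc continuous_rampKernel one_pos (fun x hx => ?_)
      integral_rampKernel
    · refine this.congr fun r => ?_
      rw [← integral_add_left_eq_self (μ := volume)
        (fun x => r⁻¹ * rampKernel (r⁻¹ * (x - a)) * N x) a]
      simp
    · by_cases h0 : x ≤ 0
      · exact rampKernel_of_nonpos h0
      · exact rampKernel_of_one_le (by
          by_contra h'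
          exact hx ⟨(not_le.1 h0).le, (not_le.1 h').le⟩)
  have hlim := ((lim s hs).sub (lim t ht)).add_const C
  have : 0 ≤ N s - N t + C := by
    refine ge_of_tendsto hlim ?_
    have hsmall : ∀ᶠ r : ℝ in 𝓝[>] 0, r < T - t :=
      (eventually_lt_nhds (sub_pos.2 htT)).filter_mono nhdsWithin_le_nhds
    filter_upwards [self_mem_nhdsWithin, hsmall] with r hr hrT
    have hr' : (0 : ℝ) < r := hr
    -- A plateau rising on [s, s + r] and falling on [t, t + r]. The integral of η' N is a mean of N
    -- just after s minus one just after t; r < T - t keeps the falling ramp inside (0, T).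
    set η : ℝ → ℝ := fun x => Real.smoothTransition (r⁻¹ * (x - s))
      - Real.smoothTransition (r⁻¹ * (x - t)) with hη
    have hmono : ∀ x, r⁻¹ * (x - t) ≤ r⁻¹ * (x - s) := fun x => by gcongr
    have hout : ∀ x, x ∉ Icc s (t + r) → η x = 0 := by
      intro x hx
      by_cases h1 : x < s
      · simp only [hη]
        rw [Real.smoothTransition.zero_of_nonpos, Real.smoothTransition.zero_of_nonpos, sub_zero]
        · exact mul_nonpos_of_nonneg_of_nonpos (inv_nonneg.2 hr'.le) (by linarith)
        · exact mul_nonpos_of_nonneg_of_nonpos (inv_nonneg.2 hr'.le) (by linarith)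
      · have h2 : t + r < x := by
          by_contra h'
          exact hx ⟨not_lt.1 h1, not_lt.1 h'⟩
        have h3 : 1 ≤ r⁻¹ * (x - t) := by
          rw [inv_mul_eq_div, le_div_iff₀ hr']; linarith
        simp only [hη]
        rw [Real.smoothTransition.one_of_one_le h3,
          Real.smoothTransition.one_of_one_le (h3.trans (hmono x)), sub_self]
    have hder : ∀ x, HasDerivAt η (r⁻¹ * rampKernel (r⁻¹ * (x - s))
        - r⁻¹ * rampKernel (r⁻¹ * (x - t))) x := by
      intro x
      have aux : ∀ a : ℝ, HasDerivAt (fun x => Real.smoothTransition (r⁻¹ * (x - a)))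
          (r⁻¹ * rampKernel (r⁻¹ * (x - a))) x := by
        intro a
        have h1 : HasDerivAt (fun x : ℝ => r⁻¹ * (x - a)) r⁻¹ x := by
          simpa using ((hasDerivAt_id x).sub_const a).const_mul r⁻¹
        have := (hasDerivAt_smoothTransition (r⁻¹ * (x - a))).comp x h1
        rw [mul_comm] at this
        exact this
      exact (aux s).sub (aux t)
    have hη1 : ContDiff ℝ 1 η := by
      have hR : ContDiff ℝ 1 Real.smoothTransition := Real.smoothTransition.contDiff (n := 1)
      exact (hR.comp (by fun_prop)).sub (hR.comp (by fun_prop))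
    have hcs : HasCompactSupport η := HasCompactSupport.intro isCompact_Icc hout
    have hts : tsupport η ⊆ Ioo 0 T := by
      have : tsupport η ⊆ Icc s (t + r) :=
        closure_minimal (fun x hx => by
          by_contra h'
          exact hx (hout x h')) isClosed_Icc
      exact this.trans fun x hx => ⟨by linarith [hx.1], by linarith [hx.2]⟩
    have hmain := h η hη1 hcs
      (fun x => sub_nonneg.2 (Real.smoothTransition.monotone (hmono x)))
      (fun x => by
        have := Real.smoothTransition.le_one (r⁻¹ * (x - s))
        have := Real.smoothTransition.nonneg (r⁻¹ * (x - t))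
        simp only [hη]; linarith) hts
    have hint : ∀ a : ℝ, Integrable fun x => r⁻¹ * rampKernel (r⁻¹ * (x - a)) * N x := by
      intro a
      have hk : Continuous fun x => r⁻¹ * rampKernel (r⁻¹ * (x - a)) := by
        have := continuous_rampKernel
        fun_prop
      have hkc : HasCompactSupport fun x => r⁻¹ * rampKernel (r⁻¹ * (x - a)) := by
        refine HasCompactSupport.intro (isCompact_Icc (a := a) (b := a + r)) fun x hx => ?_
        by_cases h1 : x < a
        · rw [rampKernel_of_nonpos, mul_zero]
          exact mul_nonpos_of_nonneg_of_nonpos (inv_nonneg.2 hr'.le) (by linarith)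
        · rw [rampKernel_of_one_le, mul_zero]
          have : a + r < x := by
            by_contra h'
            exact hx ⟨not_lt.1 h1, not_lt.1 h'⟩
          rw [inv_mul_eq_div, le_div_iff₀ hr']; linarith
      have := hN.integrable_smul_left_of_hasCompactSupport hk hkc
      simpa [smul_eq_mul] using this
    rw [← integral_sub (hint s) (hint t)]
    have e : ∀ x, r⁻¹ * rampKernel (r⁻¹ * (x - s)) * N x - r⁻¹ * rampKernel (r⁻¹ * (x - t)) * N x
        = deriv η x * N x := fun x => by rw [(hder x).deriv]; ring
    simp only [e]
    exact hmain
  linarith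

/-! ### Mollification at Lebesgue points -/

/-- A sequence of bump functions at the origin with radii tending to zero. -/
def bumpSeq (E : Type*) [NormedAddCommGroup E] [NormedSpace ℝ E] [HasContDiffBump E] (n : ℕ) :
    ContDiffBump (0 : E) :=
  -- The outer radius is exactly twice the inner one; this bounded ratio is the constant K = 2 of
  -- the differentiation theorems used below.
  ⟨1 / ((n : ℝ) + 1), 2 * (1 / ((n : ℝ) + 1)), by positivity, by
    have : (0 : ℝ) < 1 / ((n : ℝ) + 1) := by positivity
    linarith⟩

theorem tendsto_bumpSeq_rOut (E : Type*) [NormedAddCommGroup E] [NormedSpace ℝ E]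
    [HasContDiffBump E] : Tendsto (fun n => (bumpSeq E n).rOut) atTop (𝓝 0) := by
  have := tendsto_one_div_add_atTop_nhds_zero_nat (𝕜 := ℝ).const_mul 2
  rwa [mul_zero] at this

/-- A locally integrable function with nonnegative means against all tests supported in an open
interval is nonnegative there. -/
theorem ae_nonneg_of_forall_test {h : ℝ → ℝ} (hh : LocallyIntegrable h) {a b : ℝ}
    (H : ∀ η : ℝ → ℝ, ContDiff ℝ 1 η → HasCompactSupport η → (∀ t, 0 ≤ η t) →
      tsupport η ⊆ Ioo a b → 0 ≤ ∫ t, η t * h t) : ∀ᵐ t : ℝ, t ∈ Ioo a b → 0 ≤ h t := by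
  -- Almost everywhere h is the limit of its mollifications, and at a point of (a, b) these are
  -- integrals against admissible tests once the radius is below the distance to the complement.
  filter_upwards [ContDiffBump.ae_convolution_tendsto_right_of_locallyIntegrable (K := 2)
    (tendsto_bumpSeq_rOut ℝ) (Eventually.of_forall fun n => le_rfl) hh] with t ht htab
  refine ge_of_tendsto ht ?_
  obtain ⟨δ, hδ, hball⟩ := Metric.isOpen_iff.1 isOpen_Ioo t htab
  filter_upwards [(tendsto_bumpSeq_rOut ℝ).eventually_lt_const hδ] with n hn
  rw [convolution_eq_swap]
  simp only [ContinuousLinearMap.lsmul_apply, smul_eq_mul]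
  refine H (fun s => (bumpSeq ℝ n).normed volume (t - s)) ?_ ?_
    (fun s => ContDiffBump.nonneg_normed _ _) fun s hs => ?_
  · exact ((bumpSeq ℝ n).contDiff_normed (n := 1)).comp (contDiff_const.sub contDiff_id)
  · exact ((bumpSeq ℝ n).hasCompactSupport_normed).comp_homeomorph (Homeomorph.subLeft t)
  · have h1 : t - s ∈ tsupport ((bumpSeq ℝ n).normed volume) :=
      tsupport_comp_subset_preimage _ (f := fun s => t - s) (by fun_prop) hs
    rw [(bumpSeq ℝ n).tsupport_normed_eq, Metric.mem_closedBall, dist_zero_right] at h1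
    apply hball
    rw [Metric.mem_ball, dist_comm, dist_eq_norm]
    exact h1.trans_lt hn

/-- Mollified oscillation of a locally integrable function tends to zero almost everywhere. -/
theorem ae_tendsto_mollified_osc {E : Type*} [NormedAddCommGroup E] [NormedSpace ℝ E]
    [FiniteDimensional ℝ E] [MeasurableSpace E] [BorelSpace E] (μ : Measure E)
    [μ.IsAddHaarMeasure] {w : E → ℝ} (hw : LocallyIntegrable w μ) :
    ∀ᵐ z ∂μ, Tendsto (fun n => ∫ y, (bumpSeq E n).normed μ (y - z) * |w y - w z| ∂μ)
      atTop (𝓝 0) := by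
  filter_upwards [IsUnifLocDoublingMeasure.ae_tendsto_average_norm_sub μ hw 1] with z hz
  have hr : Tendsto (fun n => (bumpSeq E n).rOut) atTop (𝓝[>] 0) :=
    tendsto_nhdsWithin_iff.2 ⟨tendsto_bumpSeq_rOut E,
      Eventually.of_forall fun n => (bumpSeq E n).rOut_pos⟩
  have h := hz (fun _ => z) _ hr (Eventually.of_forall fun n => by
    exact Metric.mem_closedBall_self (by simpa using (bumpSeq E n).rOut_pos.le))
  -- A normed bump with radius ratio 2 is at most 2 ^ dim divided by the volume of its outer ball.
  have h2 := h.const_mul (2 ^ Module.finrank ℝ E : ℝ)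
  rw [mul_zero] at h2
  refine squeeze_zero (fun n => integral_nonneg fun y =>
    mul_nonneg (ContDiffBump.nonneg_normed _ _) (abs_nonneg _)) (fun n => ?_) h2
  set B := bumpSeq E n with hB
  have hsupp : ∀ y, y ∉ Metric.closedBall z B.rOut → B.normed μ (y - z) * |w y - w z| = 0 := by
    intro y hy
    have : B.normed μ (y - z) = 0 := by
      by_contra hne
      have hm : y - z ∈ Function.support (B.normed μ) := hne
      rw [B.support_normed_eq, Metric.mem_ball, dist_zero_right] at hm
      exact hy (by rw [Metric.mem_closedBall, dist_eq_norm]; exact hm.le)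
    rw [this, zero_mul]
  rw [← setIntegral_eq_integral_of_forall_compl_eq_zero hsupp, setAverage_eq, smul_eq_mul,
    ← mul_assoc]
  have hosc : IntegrableOn (fun y => |w y - w z|) (Metric.closedBall z B.rOut) μ :=
    ((hw.integrableOn_isCompact (isCompact_closedBall _ _)).sub
      (integrableOn_const (isCompact_closedBall _ _).measure_lt_top.ne)).abs
  rw [← integral_const_mul]
  refine integral_mono_of_nonneg (Eventually.of_forall fun y =>
    mul_nonneg (ContDiffBump.nonneg_normed _ _) (abs_nonneg _)) (hosc.const_mul _)
    (Eventually.of_forall fun y => ?_)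
  have hle := B.normed_le_div_measure_closedBall_rOut μ 2 le_rfl (y - z)
  have hm : μ.real (Metric.closedBall (0 : E) B.rOut) = μ.real (Metric.closedBall z B.rOut) := by
    simp [Measure.real, Measure.addHaar_closedBall_center]
  rw [hm, div_eq_mul_inv] at hle
  simp only [Real.norm_eq_abs]
  exact mul_le_mul_of_nonneg_right hle (abs_nonneg _)

end SegmentIBVP

end

noncomputable section

namespace SegmentIBVP

/-! ### Doubling of variables -/

/-- The entropy flux `sgn (a - b) (g a - g b)`. -/
def kflux (g : ℝ → ℝ) (a b : ℝ) : ℝ := g (max a b) - g (min a b)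

/-- The max/min form hides the sign function: continuity is immediate, and so is the symmetry that
exchanges the two solutions in the doubling argument. -/
theorem kflux_comm (g : ℝ → ℝ) (a b : ℝ) : kflux g a b = kflux g b a := by
  rw [kflux, kflux, max_comm, min_comm]

theorem LipschitzWith.abs_sub_le {g : ℝ → ℝ} {K : NNReal} (hg : LipschitzWith K g) (x y : ℝ) :
    |g x - g y| ≤ K * |x - y| := by
  simpa [Real.dist_eq] using hg.dist_le_mul x y

theorem continuous_kflux {g : ℝ → ℝ} (hg : Continuous g) :
    Continuous fun p : ℝ × ℝ => kflux g p.1 p.2 := by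
  unfold kflux
  fun_prop

theorem abs_kflux_le {g : ℝ → ℝ} {K : NNReal} (hg : LipschitzWith K g) (a b : ℝ) :
    |kflux g a b| ≤ K * |a - b| := by
  have := LipschitzWith.abs_sub_le hg (max a b) (min a b)
  rwa [max_sub_min_eq_abs, abs_abs, abs_sub_comm b a] at this

theorem abs_kflux_sub_le {g : ℝ → ℝ} {K : NNReal} (hg : LipschitzWith K g) (a b a' b' : ℝ) :
    |kflux g a b - kflux g a' b'| ≤ 2 * K * (|a - a'| + |b - b'|) := by
  have h1 := LipschitzWith.abs_sub_le hg (max a b) (max a' b')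
  have h2 := LipschitzWith.abs_sub_le hg (min a b) (min a' b')
  have h3 : |max a b - max a' b'| ≤ |a - a'| + |b - b'| :=
    (abs_max_sub_max_le_max a b a' b').trans (max_le (by linarith [abs_nonneg (b - b')])
      (by linarith [abs_nonneg (a - a')]))
  have h4 : |min a b - min a' b'| ≤ |a - a'| + |b - b'| :=
    (abs_min_sub_min_le_max a b a' b').trans (max_le (by linarith [abs_nonneg (b - b')])
      (by linarith [abs_nonneg (a - a')]))
  have hK : (0 : ℝ) ≤ K := K.2
  have h5 := mul_le_mul_of_nonneg_left h3 hK
  have h6 := mul_le_mul_of_nonneg_left h4 hK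
  have : kflux g a b - kflux g a' b'
      = (g (max a b) - g (max a' b')) - (g (min a b) - g (min a' b')) := by
    unfold kflux; ring
  rw [this]
  refine (abs_sub _ _).trans ?_
  linarith

/-- The Kruzhkov entropy inequalities for `∂ₜu + ∂ₓ g(u) = 0` in `Ω`. -/
def IsKruzkov (Ω : Set (ℝ × ℝ)) (g : ℝ → ℝ) (u : ℝ × ℝ → ℝ) : Prop :=
  ∀ (k : ℝ) (φ : ℝ × ℝ → ℝ), ContDiff ℝ 1 φ → HasCompactSupport φ → (∀ z, 0 ≤ φ z) →
    tsupport φ ⊆ Ω →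
      0 ≤ ∫ z, (|u z - k| * fderiv ℝ φ z (1, 0) + kflux g (u z) k * fderiv ℝ φ z (0, 1))

theorem continuous_fderiv_dir {E : Type*} [NormedAddCommGroup E] [NormedSpace ℝ E] {φ : E → ℝ}
    (hφ : ContDiff ℝ 1 φ) (e : E) : Continuous fun z => fderiv ℝ φ z e :=
  (hφ.continuous_fderiv (by simp)).clm_apply continuous_const

theorem hasCompactSupport_fderiv_dir {E : Type*} [NormedAddCommGroup E] [NormedSpace ℝ E]
    {φ : E → ℝ} (hφ : HasCompactSupport φ) (e : E) :
    HasCompactSupport fun z => fderiv ℝ φ z e :=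
  hφ.fderiv_apply ℝ e

/-- Each term of the doubled inequality is a bounded measurable factor times a convolution
integrand, so Fubini applies term by term. -/
theorem integrable_bdd_mul_conv {A : (ℝ × ℝ) × (ℝ × ℝ) → ℝ} (hA : Measurable A) {C : ℝ}
    (hC : ∀ p, |A p| ≤ C) {c d : ℝ × ℝ → ℝ} (hc : Continuous c) (hcs : HasCompactSupport c)
    (hd : Continuous d) (hds : HasCompactSupport d) :
    Integrable fun p : (ℝ × ℝ) × (ℝ × ℝ) => A p * (c p.2 * d (p.1 - p.2)) := by
  have h := (hc.integrable_of_hasCompactSupport hcs (μ := volume)).convolution_integrand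
    (ContinuousLinearMap.mul ℝ ℝ) (hd.integrable_of_hasCompactSupport hds (μ := volume))
  exact Integrable.bdd_mul (c := C) h hA.aestronglyMeasurable (Eventually.of_forall hC)

/-- The term in the derivative of ρ carries the sign opposite to the one obtained by differentiating
in ζ; these terms cancel when the two entropy inequalities are added. -/
theorem fderiv_mul_comp_sub {φ ρ : ℝ × ℝ → ℝ} (hφ : ContDiff ℝ 1 φ) (hρ : ContDiff ℝ 1 ρ)
    (ζ z e : ℝ × ℝ) : fderiv ℝ (fun z => φ z * ρ (ζ - z)) z e
      = fderiv ℝ φ z e * ρ (ζ - z) - φ z * fderiv ℝ ρ (ζ - z) e := by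
  have h1 : HasFDerivAt φ (fderiv ℝ φ z) z := (hφ.differentiable (by simp) z).hasFDerivAt
  have h2 : HasFDerivAt ρ (fderiv ℝ ρ (ζ - z)) (ζ - z) :=
    (hρ.differentiable (by simp) _).hasFDerivAt
  have h3 : HasFDerivAt (fun z => ρ (ζ - z))
      ((fderiv ℝ ρ (ζ - z)).comp (-ContinuousLinearMap.id ℝ (ℝ × ℝ))) z :=
    h2.comp z ((hasFDerivAt_id z).const_sub ζ)
  have h4 : HasFDerivAt (fun z => φ z * ρ (ζ - z)) _ z := h1.mul h3
  rw [h4.fderiv]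
  simp
  ring

theorem fderiv_const_mul_comp_sub {ρ : ℝ × ℝ → ℝ} (hρ : ContDiff ℝ 1 ρ)
    (c : ℝ) (ζ z e : ℝ × ℝ) : fderiv ℝ (fun ζ => c * ρ (ζ - z)) ζ e
      = c * fderiv ℝ ρ (ζ - z) e := by
  have h2 : HasFDerivAt ρ (fderiv ℝ ρ (ζ - z)) (ζ - z) :=
    (hρ.differentiable (by simp) _).hasFDerivAt
  have h3 : HasFDerivAt (fun ζ => ρ (ζ - z))
      ((fderiv ℝ ρ (ζ - z)).comp (ContinuousLinearMap.id ℝ (ℝ × ℝ))) ζ :=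
    h2.comp ζ ((hasFDerivAt_id ζ).sub_const z)
  rw [(h3.const_mul c).fderiv]
  simp

section

variable {Ω : Set (ℝ × ℝ)} {g : ℝ → ℝ} {K : NNReal} {u u' : ℝ × ℝ → ℝ} {R : ℝ}

/-- The inequality for u is taken at the level u'(ζ), that for u' at the level u(z), both with the
test φ(z) ρ(ζ - z), and each is integrated over the other variable. In the sum only derivatives of φ
survive. Since the flux does not depend on the point, φ may be evaluated at z alone instead of at a
midpoint. The pair p is (ζ, z). -/
theorem IsKruzkov.doubled (hg : LipschitzWith K g)
    (hum : Measurable u) (hum' : Measurable u') (hR : ∀ z, |u z| ≤ R) (hR' : ∀ z, |u' z| ≤ R)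
    (hu : IsKruzkov Ω g u) (hu' : IsKruzkov Ω g u')
    {φ : ℝ × ℝ → ℝ} (hφ : ContDiff ℝ 1 φ) (hφc : HasCompactSupport φ) (hφ0 : ∀ z, 0 ≤ φ z)
    (hφΩ : tsupport φ ⊆ Ω) {ρ : ℝ × ℝ → ℝ} (hρ : ContDiff ℝ 1 ρ) (hρc : HasCompactSupport ρ)
    (hρ0 : ∀ z, 0 ≤ ρ z)
    (hρΩ : ∀ z ∈ tsupport φ, tsupport (fun ζ => ρ (ζ - z)) ⊆ Ω) :
    Integrable (fun p : (ℝ × ℝ) × (ℝ × ℝ) =>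
      (|u p.2 - u' p.1| * fderiv ℝ φ p.2 (1, 0)
        + kflux g (u p.2) (u' p.1) * fderiv ℝ φ p.2 (0, 1)) * ρ (p.1 - p.2)) ∧
    0 ≤ ∫ p : (ℝ × ℝ) × (ℝ × ℝ),
      (|u p.2 - u' p.1| * fderiv ℝ φ p.2 (1, 0)
        + kflux g (u p.2) (u' p.1) * fderiv ℝ φ p.2 (0, 1)) * ρ (p.1 - p.2) := by
  have hPm : Measurable fun p : (ℝ × ℝ) × (ℝ × ℝ) => |u p.2 - u' p.1| := by
    simp only [← Real.norm_eq_abs]; fun_prop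
  have hGm : Measurable fun p : (ℝ × ℝ) × (ℝ × ℝ) => kflux g (u p.2) (u' p.1) :=
    (continuous_kflux hg.continuous).measurable.comp
      ((hum.comp measurable_snd).prodMk (hum'.comp measurable_fst))
  have hP0 : ∀ z ζ, |u z - u' ζ| ≤ 2 * R := fun z ζ =>
    (abs_sub _ _).trans (by linarith [hR z, hR' ζ])
  have hP : ∀ p : (ℝ × ℝ) × (ℝ × ℝ), |(|u p.2 - u' p.1|)| ≤ 2 * R := fun p => by
    rw [abs_abs]; exact hP0 _ _
  have hG : ∀ p : (ℝ × ℝ) × (ℝ × ℝ), |kflux g (u p.2) (u' p.1)| ≤ K * (2 * R) := fun p =>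
    (abs_kflux_le hg _ _).trans (mul_le_mul_of_nonneg_left (hP0 _ _) K.2)
  have cφ := hφ.continuous
  have cρ := hρ.continuous
  have i1 := integrable_bdd_mul_conv hPm hP (continuous_fderiv_dir hφ (1, 0))
    (hasCompactSupport_fderiv_dir hφc _) cρ hρc
  have i2 := integrable_bdd_mul_conv hGm hG (continuous_fderiv_dir hφ (0, 1))
    (hasCompactSupport_fderiv_dir hφc _) cρ hρc
  have i3 := integrable_bdd_mul_conv hPm hP cφ hφc (continuous_fderiv_dir hρ (1, 0))
    (hasCompactSupport_fderiv_dir hρc _)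
  have i4 := integrable_bdd_mul_conv hGm hG cφ hφc (continuous_fderiv_dir hρ (0, 1))
    (hasCompactSupport_fderiv_dir hρc _)
  set H1 : (ℝ × ℝ) × (ℝ × ℝ) → ℝ := fun p =>
    |u p.2 - u' p.1| * fderiv ℝ (fun z => φ z * ρ (p.1 - z)) p.2 (1, 0)
      + kflux g (u p.2) (u' p.1) * fderiv ℝ (fun z => φ z * ρ (p.1 - z)) p.2 (0, 1) with hH1
  set H2 : (ℝ × ℝ) × (ℝ × ℝ) → ℝ := fun p =>
    |u' p.1 - u p.2| * fderiv ℝ (fun ζ => φ p.2 * ρ (ζ - p.2)) p.1 (1, 0)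
      + kflux g (u' p.1) (u p.2) * fderiv ℝ (fun ζ => φ p.2 * ρ (ζ - p.2)) p.1 (0, 1) with hH2
  have e1 : H1 = fun p => |u p.2 - u' p.1| * (fderiv ℝ φ p.2 (1, 0) * ρ (p.1 - p.2))
      + kflux g (u p.2) (u' p.1) * (fderiv ℝ φ p.2 (0, 1) * ρ (p.1 - p.2))
      - |u p.2 - u' p.1| * (φ p.2 * fderiv ℝ ρ (p.1 - p.2) (1, 0))
      - kflux g (u p.2) (u' p.1) * (φ p.2 * fderiv ℝ ρ (p.1 - p.2) (0, 1)) := by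
    ext p
    simp only [hH1, fderiv_mul_comp_sub hφ hρ]
    ring
  have e2 : H2 = fun p => |u p.2 - u' p.1| * (φ p.2 * fderiv ℝ ρ (p.1 - p.2) (1, 0))
      + kflux g (u p.2) (u' p.1) * (φ p.2 * fderiv ℝ ρ (p.1 - p.2) (0, 1)) := by
    ext p
    simp only [hH2, fderiv_const_mul_comp_sub hρ, abs_sub_comm (u' p.1), kflux_comm g (u' p.1)]
  have I1 : Integrable H1 := by
    rw [e1]; exact ((i1.add i2).sub i3).sub i4
  have I2 : Integrable H2 := by
    rw [e2]; exact i3.add i4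
  have n1 : 0 ≤ ∫ p, H1 p := by
    have : ∫ p, H1 p = ∫ ζ, ∫ z, H1 (ζ, z) := integral_prod H1 I1
    rw [this]
    refine integral_nonneg fun ζ => hu (u' ζ) (fun z => φ z * ρ (ζ - z)) ?_ ?_ ?_ ?_
    · exact hφ.mul (hρ.comp (contDiff_const.sub contDiff_id))
    · exact hφc.mul_right
    · exact fun z => mul_nonneg (hφ0 _) (hρ0 _)
    · exact (tsupport_mul_subset_left).trans hφΩ
  have n2 : 0 ≤ ∫ p, H2 p := by
    have : ∫ p, H2 p = ∫ z, ∫ ζ, H2 (ζ, z) := integral_prod_symm H2 I2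
    rw [this]
    refine integral_nonneg fun z => hu' (u z) (fun ζ => φ z * ρ (ζ - z)) ?_ ?_ ?_ ?_
    · exact contDiff_const.mul (hρ.comp (contDiff_id.sub contDiff_const))
    · exact (hρc.comp_homeomorph (Homeomorph.subRight z)).mul_left
    · exact fun ζ => mul_nonneg (hφ0 _) (hρ0 _)
    · by_cases hz : z ∈ tsupport φ
      · exact (tsupport_mul_subset_right).trans (hρΩ z hz)
      · have : (fun ζ => φ z * ρ (ζ - z)) = fun _ => 0 := by
          ext ζ
          rw [image_eq_zero_of_notMem_tsupport hz, zero_mul]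
        rw [this]
        simp [tsupport]
  have e3 : (fun p : (ℝ × ℝ) × (ℝ × ℝ) => (|u p.2 - u' p.1| * fderiv ℝ φ p.2 (1, 0)
        + kflux g (u p.2) (u' p.1) * fderiv ℝ φ p.2 (0, 1)) * ρ (p.1 - p.2))
      = fun p => H1 p + H2 p := by
    rw [e1, e2]
    ext p
    ring
  rw [e3]
  refine ⟨I1.add I2, ?_⟩
  rw [integral_add I1 I2]
  exact add_nonneg n1 n2

/-- Two Kruzhkov solutions satisfy the contraction inequality in the interior. -/
theorem IsKruzkov.contraction (hΩ : IsOpen Ω) (hg : LipschitzWith K g)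
    (hum : Measurable u) (hum' : Measurable u') (hR : ∀ z, |u z| ≤ R) (hR' : ∀ z, |u' z| ≤ R)
    (hu : IsKruzkov Ω g u) (hu' : IsKruzkov Ω g u')
    {φ : ℝ × ℝ → ℝ} (hφ : ContDiff ℝ 1 φ) (hφc : HasCompactSupport φ) (hφ0 : ∀ z, 0 ≤ φ z)
    (hφΩ : tsupport φ ⊆ Ω) :
    0 ≤ ∫ z, (|u z - u' z| * fderiv ℝ φ z (1, 0) + kflux g (u z) (u' z) * fderiv ℝ φ z (0, 1)) := by
  -- Bumps of radius less than δ centred in the support of φ stay inside Ω.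
  obtain ⟨δ, hδ, hδΩ⟩ := hφc.exists_cthickening_subset_open hΩ hφΩ
  set ρ : ℕ → ℝ × ℝ → ℝ := fun n => (bumpSeq (ℝ × ℝ) n).normed volume with hρdef
  have hρ : ∀ n, ContDiff ℝ 1 (ρ n) := fun n => (bumpSeq (ℝ × ℝ) n).contDiff_normed
  have hρc : ∀ n, HasCompactSupport (ρ n) := fun n => (bumpSeq (ℝ × ℝ) n).hasCompactSupport_normed
  have hρ0 : ∀ n z, 0 ≤ ρ n z := fun n z => ContDiffBump.nonneg_normed _ _
  have hρ1 : ∀ n z, ∫ ζ, ρ n (ζ - z) = 1 := fun n z => by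
    rw [integral_sub_right_eq_self (fun ζ => ρ n ζ) z]
    exact (bumpSeq (ℝ × ℝ) n).integral_normed
  have hρi : ∀ n z, Integrable fun ζ => ρ n (ζ - z) := fun n z =>
    ((hρ n).continuous.integrable_of_hasCompactSupport (hρc n)).comp_sub_right z
  have hsmall : ∀ᶠ n in atTop, (bumpSeq (ℝ × ℝ) n).rOut < δ :=
    (tendsto_bumpSeq_rOut (ℝ × ℝ)).eventually_lt_const hδ
  have hdoub : ∀ᶠ n in atTop, _ := hsmall.mono fun n hn =>
    IsKruzkov.doubled hg hum hum' hR hR' hu hu' hφ hφc hφ0 hφΩ (hρ n) (hρc n) (hρ0 n) (by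
      intro z hz ζ hζ
      apply hδΩ
      have h1 : ζ - z ∈ tsupport (ρ n) := by
        have := tsupport_comp_subset_preimage (ρ n) (f := fun ζ => ζ - z) (by fun_prop) hζ
        exact this
      rw [hρdef] at h1
      simp only [(bumpSeq (ℝ × ℝ) n).tsupport_normed_eq, Metric.mem_closedBall,
        dist_zero_right] at h1
      refine Metric.mem_cthickening_of_dist_le ζ z δ _ hz ?_
      rw [dist_eq_norm]
      exact h1.trans hn.le)
  set f : ℕ → ℝ × ℝ → ℝ := fun n z => ∫ ζ, (|u z - u' ζ| * fderiv ℝ φ z (1, 0)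
        + kflux g (u z) (u' ζ) * fderiv ℝ φ z (0, 1)) * ρ n (ζ - z) with hf
  have hP0 : ∀ z ζ, |u z - u' ζ| ≤ 2 * R := fun z ζ =>
    (abs_sub _ _).trans (by linarith [hR z, hR' ζ])
  have hG0 : ∀ z ζ, |kflux g (u z) (u' ζ)| ≤ K * (2 * R) := fun z ζ =>
    (abs_kflux_le hg _ _).trans (mul_le_mul_of_nonneg_left (hP0 _ _) K.2)
  have hcoef : ∀ z ζ, |(|u z - u' ζ| * fderiv ℝ φ z (1, 0)
        + kflux g (u z) (u' ζ) * fderiv ℝ φ z (0, 1))|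
      ≤ 2 * R * |fderiv ℝ φ z (1, 0)| + K * (2 * R) * |fderiv ℝ φ z (0, 1)| := by
    intro z ζ
    refine (abs_add_le _ _).trans ?_
    rw [abs_mul, abs_mul, abs_abs]
    gcongr
    · exact hP0 _ _
    · exact hG0 _ _
  have hmeasζ : ∀ z, Measurable fun ζ => |u z - u' ζ| * fderiv ℝ φ z (1, 0)
        + kflux g (u z) (u' ζ) * fderiv ℝ φ z (0, 1) := by
    intro z
    have h1 : Measurable fun ζ => |u z - u' ζ| := by
      simp only [← Real.norm_eq_abs]; fun_prop
    have h2 : Measurable fun ζ => kflux g (u z) (u' ζ) :=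
      (continuous_kflux hg.continuous).measurable.comp (measurable_const.prodMk hum')
    exact (h1.mul_const _).add (h2.mul_const _)
  have hint : ∀ n z, Integrable fun ζ => (|u z - u' ζ| * fderiv ℝ φ z (1, 0)
        + kflux g (u z) (u' ζ) * fderiv ℝ φ z (0, 1)) * ρ n (ζ - z) := fun n z =>
    Integrable.bdd_mul (hρi n z) (hmeasζ z).aestronglyMeasurable
      (Eventually.of_forall fun ζ => hcoef z ζ)
  -- As ρ concentrates, u'(ζ) may be replaced by u'(z): both coefficients are Lipschitz in that
  -- argument, so at almost every z the error is bounded by the mollified oscillation of u'.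
  -- Domination comes from the unit mass of ρ.
  have hlim : Tendsto (fun n => ∫ z, f n z) atTop
      (𝓝 (∫ z, (|u z - u' z| * fderiv ℝ φ z (1, 0)
        + kflux g (u z) (u' z) * fderiv ℝ φ z (0, 1)))) := by
    refine tendsto_integral_filter_of_dominated_convergence (fun z =>
      2 * R * |fderiv ℝ φ z (1, 0)| + K * (2 * R) * |fderiv ℝ φ z (0, 1)|) ?_ ?_ ?_ ?_
    · filter_upwards [hdoub] with n hn
      exact hn.1.integral_prod_right.aestronglyMeasurable
    · refine Eventually.of_forall fun n => Eventually.of_forall fun z => ?_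
      have : ‖f n z‖ ≤ ∫ ζ, (2 * R * |fderiv ℝ φ z (1, 0)|
          + K * (2 * R) * |fderiv ℝ φ z (0, 1)|) * ρ n (ζ - z) := by
        refine norm_integral_le_of_norm_le ((hρi n z).const_mul _)
          (Eventually.of_forall fun ζ => ?_)
        rw [norm_mul, Real.norm_eq_abs, Real.norm_eq_abs, abs_of_nonneg (hρ0 n _)]
        exact mul_le_mul_of_nonneg_right (hcoef z ζ) (hρ0 n _)
      rwa [integral_const_mul, hρ1, mul_one] at this
    · have ha := ((continuous_fderiv_dir hφ (1, 0)).integrable_of_hasCompactSupport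
        (hasCompactSupport_fderiv_dir hφc _) (μ := volume)).abs
      have hb := ((continuous_fderiv_dir hφ (0, 1)).integrable_of_hasCompactSupport
        (hasCompactSupport_fderiv_dir hφc _) (μ := volume)).abs
      exact (ha.const_mul _).add (hb.const_mul _)
    · have hloc : LocallyIntegrable u' :=
        (locallyIntegrable_const R).mono hum'.aestronglyMeasurable
          (Eventually.of_forall fun z => by
            rw [Real.norm_eq_abs, Real.norm_eq_abs]
            exact (hR' z).trans (le_abs_self _))
      filter_upwards [ae_tendsto_mollified_osc volume hloc] with z hz
      have hz2 := hz.const_mul (|fderiv ℝ φ z (1, 0)| + 2 * K * |fderiv ℝ φ z (0, 1)|)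
      rw [mul_zero] at hz2
      rw [tendsto_iff_norm_sub_tendsto_zero]
      refine squeeze_zero (fun n => norm_nonneg _) (fun n => ?_) hz2
      have e : f n z - (|u z - u' z| * fderiv ℝ φ z (1, 0)
          + kflux g (u z) (u' z) * fderiv ℝ φ z (0, 1))
          = ∫ ζ, ((|u z - u' ζ| - |u z - u' z|) * fderiv ℝ φ z (1, 0)
            + (kflux g (u z) (u' ζ) - kflux g (u z) (u' z)) * fderiv ℝ φ z (0, 1))
              * ρ n (ζ - z) := by
        have : (|u z - u' z| * fderiv ℝ φ z (1, 0) + kflux g (u z) (u' z) * fderiv ℝ φ z (0, 1))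
            = ∫ ζ, (|u z - u' z| * fderiv ℝ φ z (1, 0)
              + kflux g (u z) (u' z) * fderiv ℝ φ z (0, 1)) * ρ n (ζ - z) := by
          rw [integral_const_mul, hρ1, mul_one]
        rw [this, hf, ← integral_sub (hint n z) ((hρi n z).const_mul _)]
        refine integral_congr_ae (Eventually.of_forall fun ζ => ?_)
        simp only []
        ring
      rw [e, ← integral_const_mul]
      have hosc : Integrable fun ζ => ρ n (ζ - z) * |u' ζ - u' z| := by
        have hm : Measurable fun ζ => |u' ζ - u' z| := by
          simp only [← Real.norm_eq_abs]; fun_prop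
        have := Integrable.bdd_mul (c := 2 * R) (hρi n z) hm.aestronglyMeasurable
          (Eventually.of_forall fun ζ => by
            rw [Real.norm_eq_abs, abs_abs]
            exact (abs_sub _ _).trans (by linarith [hR' z, hR' ζ]))
        simpa [mul_comm] using this
      refine norm_integral_le_of_norm_le (hosc.const_mul _) (Eventually.of_forall fun ζ => ?_)
      rw [norm_mul, Real.norm_eq_abs, Real.norm_eq_abs, abs_of_nonneg (hρ0 n _)]
      have h1 : |(|u z - u' ζ| - |u z - u' z|)| ≤ |u' ζ - u' z| := by
        refine (abs_abs_sub_abs_le_abs_sub _ _).trans (le_of_eq ?_)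
        rw [abs_sub_comm (u' ζ)]
        congr 1
        ring
      have h2 : |kflux g (u z) (u' ζ) - kflux g (u z) (u' z)| ≤ 2 * K * |u' ζ - u' z| := by
        have := abs_kflux_sub_le hg (u z) (u' ζ) (u z) (u' z)
        simpa using this
      have h3 : |(|u z - u' ζ| - |u z - u' z|) * fderiv ℝ φ z (1, 0)
            + (kflux g (u z) (u' ζ) - kflux g (u z) (u' z)) * fderiv ℝ φ z (0, 1)|
          ≤ (|fderiv ℝ φ z (1, 0)| + 2 * K * |fderiv ℝ φ z (0, 1)|) * |u' ζ - u' z| := by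
        refine (abs_add_le _ _).trans ?_
        rw [abs_mul, abs_mul]
        have a1 := mul_le_mul_of_nonneg_right h1 (abs_nonneg (fderiv ℝ φ z (1, 0)))
        have a2 := mul_le_mul_of_nonneg_right h2 (abs_nonneg (fderiv ℝ φ z (0, 1)))
        linarith
      calc _ ≤ _ := mul_le_mul_of_nonneg_right h3 (hρ0 n (ζ - z))
        _ = _ := by ring
  refine ge_of_tendsto hlim ?_
  filter_upwards [hdoub] with n hn
  refine hn.2.trans (le_of_eq ?_)
  exact integral_prod_symm _ hn.1

end

end SegmentIBVP

end

noncomputable section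

namespace SegmentIBVP

/-! ### Boundary conditions and comparison of two solutions -/

/-- The condition linking the trace `w` to the boundary datum `b` at a left end point. -/
def BoundaryAdmissible (g : ℝ → ℝ) (w b : ℝ) : Prop :=
  (∀ k ∈ Icc b w, g w ≤ g k) ∧ ∀ k ∈ Icc w b, g k ≤ g w

/-- With w' ≤ w, the quantity to bound is g w - g w'. Admissibility of w bounds g w by the values of
g on [b, w]; that of w' bounds g w' below by the values on [w', b']. If these sets meet, or one of
them contains the other trace, the difference is nonpositive. In the remaining cases b' ≤ b, and
what is left is a difference of values of g at two points of [b', b], the only place where the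
Lipschitz bound is needed. -/
theorem BoundaryAdmissible.kflux_le {g : ℝ → ℝ} {w b w' b' C : ℝ}
    (h : BoundaryAdmissible g w b) (h' : BoundaryAdmissible g w' b') (hC0 : 0 ≤ C)
    (hC : ∀ x ∈ uIcc b b', ∀ y ∈ uIcc b b', |g x - g y| ≤ C * |x - y|) :
    kflux g w w' ≤ C * |b - b'| := by
  wlog hww : w' ≤ w generalizing w b w' b'
  · rw [kflux_comm, abs_sub_comm]
    exact this h' h (by rwa [uIcc_comm]) (le_of_not_ge hww)
  rw [kflux, max_eq_left hww, min_eq_right hww]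
  have hpos : 0 ≤ C * |b - b'| := mul_nonneg hC0 (abs_nonneg _)
  have lip : ∀ x y, b' ≤ y → y ≤ x → x ≤ b → g x - g y ≤ C * |b - b'| := by
    intro x y h1 h2 h3
    have hb : b' ≤ b := h1.trans (h2.trans h3)
    have hx : x ∈ uIcc b b' := by rw [uIcc_of_ge hb]; exact ⟨h1.trans h2, h3⟩
    have hy : y ∈ uIcc b b' := by rw [uIcc_of_ge hb]; exact ⟨h1, h2.trans h3⟩
    refine (le_abs_self _).trans ((hC x hx y hy).trans (mul_le_mul_of_nonneg_left ?_ hC0))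
    rw [abs_of_nonneg (by linarith), abs_of_nonneg (by linarith)]
    linarith
  rcases le_total b w with hb | hb <;> rcases le_total w' b' with hb' | hb'
  · by_cases h1 : b ≤ w'
    · linarith [h.1 w' ⟨h1, hww⟩]
    by_cases h2 : w ≤ b'
    · linarith [h'.2 w ⟨hww, h2⟩]
    push Not at h1 h2
    by_cases h3 : b ≤ b'
    · linarith [h.1 b ⟨le_rfl, hb⟩, h'.2 b ⟨h1.le, h3⟩]
    · push Not at h3
      linarith [h.1 b ⟨le_rfl, hb⟩, h'.2 b' ⟨hb', le_rfl⟩, lip b b' le_rfl h3.le le_rfl]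
  · by_cases h1 : b ≤ w'
    · linarith [h.1 w' ⟨h1, hww⟩]
    · push Not at h1
      linarith [h.1 b ⟨le_rfl, hb⟩, lip b w' hb' h1.le le_rfl]
  · by_cases h2 : w ≤ b'
    · linarith [h'.2 w ⟨hww, h2⟩]
    · push Not at h2
      linarith [h'.2 b' ⟨hb', le_rfl⟩, lip w b' le_rfl h2.le hb]
  · exact lip w w' hb' hww hb

theorem locallyIntegrable_of_abs_le {X : Type*} [MeasurableSpace X] [TopologicalSpace X]
    {μ : Measure X} [IsLocallyFiniteMeasure μ] {p : X → ℝ} (hp : Measurable p) {R : ℝ}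
    (hR : ∀ x, |p x| ≤ R) : LocallyIntegrable p μ :=
  (locallyIntegrable_const R).mono hp.aestronglyMeasurable (Eventually.of_forall fun z => by
    rw [Real.norm_eq_abs, Real.norm_eq_abs]
    exact (hR z).trans (le_abs_self _))

/-- Transports traces through Lipschitz functions: of two arguments for `kflux`, or of one, by
taking both functions equal. -/
theorem HasTrace.of_abs_le {p p' P : ℝ → ℝ} {w w' W C : ℝ} (h : HasTrace p w)
    (h' : HasTrace p' w') (hp : LocallyIntegrable p) (hp' : LocallyIntegrable p')
    (hP : ∀ x, |P x - W| ≤ C * (|p x - w| + |p' x - w'|)) : HasTrace P W := by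
  have hlim := (h.add h').const_mul C
  rw [add_zero, mul_zero] at hlim
  refine squeeze_zero' ?_ ?_ hlim
  · filter_upwards [self_mem_nhdsWithin] with r hr
    have hr' : (0 : ℝ) < r := hr
    exact mul_nonneg (inv_nonneg.2 hr'.le)
      (intervalIntegral.integral_nonneg hr'.le fun _ _ => abs_nonneg _)
  · filter_upwards [self_mem_nhdsWithin] with r hr
    have hr' : (0 : ℝ) < r := hr
    have i1 : IntervalIntegrable (fun x => |p x - w|) volume 0 r :=
      ((LocallyIntegrable.intervalIntegrable' hp _ _).sub intervalIntegrable_const).abs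
    have i2 : IntervalIntegrable (fun x => |p' x - w'|) volume 0 r :=
      ((LocallyIntegrable.intervalIntegrable' hp' _ _).sub intervalIntegrable_const).abs
    have : ∫ x in (0 : ℝ)..r, |P x - W| ≤ ∫ x in (0 : ℝ)..r, C * (|p x - w| + |p' x - w'|) := by
      rw [intervalIntegral.integral_of_le hr'.le, intervalIntegral.integral_of_le hr'.le]
      exact integral_mono_of_nonneg (Eventually.of_forall fun _ => abs_nonneg _)
        ((i1.add i2).const_mul C).1 (Eventually.of_forall hP)
    rw [intervalIntegral.integral_const_mul, intervalIntegral.integral_add i1 i2] at this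
    have h3 := mul_le_mul_of_nonneg_left this (inv_nonneg.2 hr'.le)
    refine h3.trans (le_of_eq ?_)
    ring

theorem contDiff_tensor {η ζ : ℝ → ℝ} (hη : ContDiff ℝ 1 η) (hζ : ContDiff ℝ 1 ζ) :
    ContDiff ℝ 1 fun z : ℝ × ℝ => η z.1 * ζ z.2 :=
  (hη.comp contDiff_fst).mul (hζ.comp contDiff_snd)

theorem fderiv_tensor {η ζ : ℝ → ℝ} {z : ℝ × ℝ} {a b : ℝ} (hη : HasDerivAt η a z.1)
    (hζ : HasDerivAt ζ b z.2) :
    fderiv ℝ (fun z : ℝ × ℝ => η z.1 * ζ z.2) z (1, 0) = a * ζ z.2 ∧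
      fderiv ℝ (fun z : ℝ × ℝ => η z.1 * ζ z.2) z (0, 1) = η z.1 * b := by
  have h1 : HasFDerivAt (fun z : ℝ × ℝ => η z.1) _ z := hη.hasFDerivAt.comp z hasFDerivAt_fst
  have h2 : HasFDerivAt (fun z : ℝ × ℝ => ζ z.2) _ z := hζ.hasFDerivAt.comp z hasFDerivAt_snd
  have h3 : HasFDerivAt (fun z : ℝ × ℝ => η z.1 * ζ z.2) _ z := h1.mul h2
  rw [h3.fderiv]
  constructor <;> simp [mul_comm]

/-- A smooth cut-off of the segment `[0,L]`, equal to `1` at distance `2r` from its end points. -/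
def cutoff (L r x : ℝ) : ℝ :=
  Real.smoothTransition (r⁻¹ * x - 1) - Real.smoothTransition (r⁻¹ * (x - L) + 2)

/-- The derivative of `cutoff L r`. -/
def cutoffDeriv (L r x : ℝ) : ℝ :=
  r⁻¹ * rampKernel (r⁻¹ * x - 1) - r⁻¹ * rampKernel (r⁻¹ * (x - L) + 2)

theorem hasDerivAt_cutoff (L r x : ℝ) : HasDerivAt (cutoff L r) (cutoffDeriv L r x) x := by
  have h1 : HasDerivAt (fun x : ℝ => r⁻¹ * x - 1) r⁻¹ x := by
    simpa using ((hasDerivAt_id x).const_mul r⁻¹).sub_const 1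
  have h2 : HasDerivAt (fun x : ℝ => r⁻¹ * (x - L) + 2) r⁻¹ x := by
    simpa using (((hasDerivAt_id x).sub_const L).const_mul r⁻¹).add_const 2
  have h3 := (hasDerivAt_smoothTransition (r⁻¹ * x - 1)).comp x h1
  have h4 := (hasDerivAt_smoothTransition (r⁻¹ * (x - L) + 2)).comp x h2
  rw [mul_comm] at h3 h4
  exact h3.sub h4

theorem contDiff_cutoff (L r : ℝ) : ContDiff ℝ 1 (cutoff L r) := by
  have hR : ContDiff ℝ 1 Real.smoothTransition := Real.smoothTransition.contDiff (n := 1)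
  exact (hR.comp (by fun_prop)).sub (hR.comp (by fun_prop))

section

variable {L r : ℝ}

/-- The condition 3r ≤ L says exactly that the argument of the falling ramp never exceeds that of
the rising one. -/
theorem cutoff_nonneg (hr : 0 < r) (hrL : 3 * r ≤ L) (x : ℝ) : 0 ≤ cutoff L r x := by
  refine sub_nonneg.2 (Real.smoothTransition.monotone ?_)
  have : 3 ≤ r⁻¹ * L := by rw [inv_mul_eq_div, le_div_iff₀ hr]; exact hrL
  linarith [mul_sub r⁻¹ x L]

theorem cutoff_le_one (L r x : ℝ) : cutoff L r x ≤ 1 := by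
  have := Real.smoothTransition.le_one (r⁻¹ * x - 1)
  have := Real.smoothTransition.nonneg (r⁻¹ * (x - L) + 2)
  unfold cutoff
  linarith

theorem cutoff_eq_zero (hr : 0 < r) (hrL : 3 * r ≤ L) {x : ℝ} (hx : x ∉ Icc r (L - r)) :
    cutoff L r x = 0 := by
  have h3 : 3 ≤ r⁻¹ * L := by rw [inv_mul_eq_div, le_div_iff₀ hr]; exact hrL
  unfold cutoff
  by_cases h1 : x < r
  · have h2 : r⁻¹ * x ≤ 1 := by rw [inv_mul_eq_div, div_le_one hr]; exact h1.le
    rw [Real.smoothTransition.zero_of_nonpos (by linarith),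
      Real.smoothTransition.zero_of_nonpos (by linarith [mul_sub r⁻¹ x L]), sub_zero]
  · have h2 : L - r < x := by
      by_contra h'
      exact hx ⟨not_lt.1 h1, not_lt.1 h'⟩
    have h4 : -1 ≤ r⁻¹ * (x - L) := by
      rw [inv_mul_eq_div, le_div_iff₀ hr]; linarith
    rw [Real.smoothTransition.one_of_one_le (by linarith [mul_sub r⁻¹ x L]),
      Real.smoothTransition.one_of_one_le (by linarith), sub_self]

theorem cutoff_eq_one (hr : 0 < r) {x : ℝ} (hx : x ∈ Icc (2 * r) (L - 2 * r)) :
    cutoff L r x = 1 := by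
  unfold cutoff
  have h1 : 2 ≤ r⁻¹ * x := by rw [inv_mul_eq_div, le_div_iff₀ hr]; exact hx.1
  have h2 : r⁻¹ * (x - L) ≤ -2 := by
    rw [inv_mul_eq_div, div_le_iff₀ hr]; linarith [hx.2]
  rw [Real.smoothTransition.one_of_one_le (by linarith),
    Real.smoothTransition.zero_of_nonpos (by linarith), sub_zero]

end

/-- The shift by 1 puts the ramp on [r, 2r], so that the cut-off vanishes near the end point and has
compact support in the open segment. -/
theorem HasTrace.tendsto_left_layer {p : ℝ → ℝ} {w : ℝ} (h : HasTrace p w)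
    (hp : LocallyIntegrable p) :
    Tendsto (fun r : ℝ => ∫ x, r⁻¹ * rampKernel (r⁻¹ * x - 1) * p x) (𝓝[>] 0) (𝓝 w) := by
  have ck := continuous_rampKernel
  exact h.tendsto_layer hp (κ := fun y => rampKernel (y - 1)) (by fun_prop) (a := 2) two_pos
    (fun x hx => by
      by_cases h : x ≤ 1
      · exact rampKernel_of_nonpos (by linarith)
      · refine rampKernel_of_one_le ?_
        by_contra h'
        exact hx ⟨by linarith, by linarith⟩)
    (by rw [integral_sub_right_eq_self rampKernel 1, integral_rampKernel])

theorem integrable_scaled_rampKernel {r : ℝ} (hr : 0 < r) (c : ℝ) :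
    Integrable (fun x => r⁻¹ * rampKernel (r⁻¹ * x + c)) ∧
      ∫ x, r⁻¹ * rampKernel (r⁻¹ * x + c) = 1 := by
  have hcs : HasCompactSupport rampKernel := HasCompactSupport.intro (isCompact_Icc (a := 0) (b := 1))
    fun x hx => by
      by_cases h : x ≤ 0
      · exact rampKernel_of_nonpos h
      · refine rampKernel_of_one_le ?_
        by_contra h'
        exact hx ⟨by linarith, by linarith⟩
  have hi : Integrable rampKernel := continuous_rampKernel.integrable_of_hasCompactSupport hcs
  constructor
  · exact ((hi.comp_add_right c).comp_mul_left' (inv_ne_zero hr.ne')).const_mul _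
  · rw [integral_const_mul, Measure.integral_comp_mul_left (fun x => rampKernel (x + c)),
      integral_add_right_eq_self rampKernel c, integral_rampKernel]
    simp [abs_of_pos hr, hr.ne']

/-- The means of `p` against `cutoffDeriv` see the two boundary traces. -/
theorem tendsto_integral_cutoffDeriv {L w0 wL R : ℝ} {p : ℝ → ℝ} (hp : Measurable p)
    (hR : ∀ x, |p x| ≤ R) (h0 : HasTrace p w0) (hL : HasTrace (fun x => p (L - x)) wL) :
    Tendsto (fun r : ℝ => ∫ x, cutoffDeriv L r x * p x) (𝓝[>] 0) (𝓝 (w0 - wL)) := by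
  have ck := continuous_rampKernel
  have a1 := h0.tendsto_left_layer (locallyIntegrable_of_abs_le hp hR)
  -- Measured from L inwards, the falling ramp is again a layer at the origin, with the reflected
  -- kernel `rampKernel (2 - y)`.
  have a2 := hL.tendsto_layer
    (locallyIntegrable_of_abs_le (hp.comp (measurable_const.sub measurable_id)) fun x => hR _)
    (κ := fun y => rampKernel (2 - y)) (by fun_prop) (a := 2) two_pos (fun x hx => by
      by_cases h : x ≤ 1
      · exact rampKernel_of_one_le (by linarith)
      · refine rampKernel_of_nonpos ?_
        by_contra h'
        exact hx ⟨by linarith, by linarith⟩) (by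
      rw [integral_sub_left_eq_self rampKernel volume 2, integral_rampKernel])
  refine (a1.sub a2).congr' ?_
  filter_upwards [self_mem_nhdsWithin] with r hr
  have hr' : (0 : ℝ) < r := hr
  have e : ∫ x, r⁻¹ * rampKernel (2 - r⁻¹ * x) * p (L - x)
      = ∫ x, r⁻¹ * rampKernel (r⁻¹ * (x - L) + 2) * p x := by
    rw [← integral_sub_left_eq_self (fun x => r⁻¹ * rampKernel (r⁻¹ * (x - L) + 2) * p x)
      volume L]
    refine integral_congr_ae (Eventually.of_forall fun x => ?_)
    simp only []
    congr 3
    ring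
  simp only [e]
  have hint : ∀ c : ℝ, Integrable fun x => r⁻¹ * rampKernel (r⁻¹ * x + c) * p x := fun c =>
    (integrable_scaled_rampKernel hr' c).1.mul_bdd (c := R) hp.aestronglyMeasurable
      (Eventually.of_forall hR)
  rw [← integral_sub]
  · refine integral_congr_ae (Eventually.of_forall fun x => ?_)
    simp only [cutoffDeriv]
    ring
  · exact hint (-1)
  · refine (hint (2 - r⁻¹ * L)).congr (Eventually.of_forall fun x => ?_)
    simp only [show r⁻¹ * (x - L) + 2 = r⁻¹ * x + (2 - r⁻¹ * L) by ring]

/-- The bound 2 is the total mass of the two ramps. Being independent of r, it provides domination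
when r tends to 0. -/
theorem integrable_cutoffDeriv_and_le {L r : ℝ} (hr : 0 < r) :
    Integrable (cutoffDeriv L r) ∧ ∫ x, |cutoffDeriv L r x| ≤ 2 := by
  have hI := integrable_scaled_rampKernel hr
  have e : cutoffDeriv L r = fun x => r⁻¹ * rampKernel (r⁻¹ * x + -1)
      - r⁻¹ * rampKernel (r⁻¹ * x + (2 - r⁻¹ * L)) := by
    ext x
    simp only [cutoffDeriv]
    congr 3
    ring
  rw [e]
  refine ⟨(hI _).1.sub (hI _).1, ?_⟩
  have h2 : ∫ x, (r⁻¹ * rampKernel (r⁻¹ * x + -1) + r⁻¹ * rampKernel (r⁻¹ * x + (2 - r⁻¹ * L)))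
      = 2 := by
    rw [integral_add (hI _).1 (hI _).1, (hI _).2, (hI _).2]; norm_num
  refine le_trans ?_ h2.le
  refine integral_mono_of_nonneg (Eventually.of_forall fun _ => abs_nonneg _)
    ((hI _).1.add (hI _).1) (Eventually.of_forall fun x => ?_)
  refine (abs_sub _ _).trans (le_of_eq ?_)
  rw [abs_of_nonneg (mul_nonneg (inv_nonneg.2 hr.le) (rampKernel_nonneg _)),
    abs_of_nonneg (mul_nonneg (inv_nonneg.2 hr.le) (rampKernel_nonneg _))]

/-- A bounded Kruzhkov solution in `(0,T) × (0,L)` whose traces are admissible for the boundary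
data `b0` and `bL`. -/
structure InteriorSol (T L : ℝ) (g b0 bL : ℝ → ℝ) (R : ℝ) (u : ℝ × ℝ → ℝ) : Prop where
  measurable : Measurable u
  bound : ∀ z, |u z| ≤ R
  kruzkov : IsKruzkov (Ioo 0 T ×ˢ Ioo 0 L) g u
  left : ∀ᵐ t : ℝ, t ∈ Ioo 0 T → ∃ w, HasTrace (fun x => u (t, x)) w ∧
    BoundaryAdmissible g w (b0 t)
  right : ∀ᵐ t : ℝ, t ∈ Ioo 0 T → ∃ w, HasTrace (fun x => u (t, L - x)) w ∧
    BoundaryAdmissible (fun s => -g s) w (bL t)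

/-- Reflecting the segment reverses the flux: the right end point is handled as a left end point for
-g. -/
theorem kflux_neg (g : ℝ → ℝ) (a b : ℝ) : kflux (fun s => -g s) a b = -kflux g a b := by
  unfold kflux; ring

section

variable {T L C R : ℝ} {g b0 bL b0' bL' : ℝ → ℝ} {K : NNReal} {u u' : ℝ × ℝ → ℝ}

/-- The limit is the Kruzhkov flux between the traces at 0 minus the one at L.
`BoundaryAdmissible.kflux_le` bounds the former from above with g and the negative of the latter
with -g. -/
theorem InteriorSol.exists_trace_flux (hg : LipschitzWith K g) (hu : InteriorSol T L g b0 bL R u)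
    (hu' : InteriorSol T L g b0' bL' R u') (hC0 : 0 ≤ C)
    (h0 : ∀ᵐ t : ℝ, t ∈ Ioo 0 T → ∀ x ∈ uIcc (b0 t) (b0' t), ∀ y ∈ uIcc (b0 t) (b0' t),
      |g x - g y| ≤ C * |x - y|)
    (hL : ∀ᵐ t : ℝ, t ∈ Ioo 0 T → ∀ x ∈ uIcc (bL t) (bL' t), ∀ y ∈ uIcc (bL t) (bL' t),
      |g x - g y| ≤ C * |x - y|) :
    ∀ᵐ t : ℝ, t ∈ Ioo 0 T → ∃ ℓ, Tendsto (fun r : ℝ =>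
      ∫ x, cutoffDeriv L r x * kflux g (u (t, x)) (u' (t, x))) (𝓝[>] 0) (𝓝 ℓ) ∧
      ℓ ≤ C * (|b0 t - b0' t| + |bL t - bL' t|) := by
  filter_upwards [hu.left, hu.right, hu'.left, hu'.right, h0, hL] with t a1 a2 a3 a4 a5 a6 ht
  obtain ⟨w0, hw0, hb0⟩ := a1 ht
  obtain ⟨wL, hwL, hbL⟩ := a2 ht
  obtain ⟨w0', hw0', hb0'⟩ := a3 ht
  obtain ⟨wL', hwL', hbL'⟩ := a4 ht
  have hm : Measurable fun x => u (t, x) := hu.measurable.comp measurable_prodMk_left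
  have hm' : Measurable fun x => u' (t, x) := hu'.measurable.comp measurable_prodMk_left
  have hs : Measurable fun x : ℝ => L - x := measurable_const.sub measurable_id
  have hG0 : ∀ x, |kflux g (u (t, x)) (u' (t, x))| ≤ K * (2 * R) := fun x =>
    (abs_kflux_le hg _ _).trans (mul_le_mul_of_nonneg_left
      ((abs_sub _ _).trans (by linarith [hu.bound (t, x), hu'.bound (t, x)])) K.2)
  have t0 : HasTrace (fun x => kflux g (u (t, x)) (u' (t, x))) (kflux g w0 w0') :=
    hw0.of_abs_le hw0' (locallyIntegrable_of_abs_le hm fun x => hu.bound _)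
      (locallyIntegrable_of_abs_le hm' fun x => hu'.bound _)
      fun x => abs_kflux_sub_le hg _ _ _ _
  have tL : HasTrace (fun x => kflux g (u (t, L - x)) (u' (t, L - x))) (kflux g wL wL') :=
    hwL.of_abs_le hwL' (locallyIntegrable_of_abs_le (hm.comp hs) fun x => hu.bound _)
      (locallyIntegrable_of_abs_le (hm'.comp hs) fun x => hu'.bound _)
      fun x => abs_kflux_sub_le hg _ _ _ _
  refine ⟨_, tendsto_integral_cutoffDeriv
    ((continuous_kflux hg.continuous).measurable.comp (hm.prodMk hm')) hG0 t0 tL, ?_⟩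
  have c0 := hb0.kflux_le hb0' hC0 (a5 ht)
  have cL := hbL.kflux_le hbL' hC0 (fun x hx y hy => by
    have := a6 ht x hx y hy
    rwa [← abs_neg, show -(-g x - -g y) = g x - g y by ring])
  rw [kflux_neg] at cL
  linarith

theorem abs_sub_le_two_mul {a b R : ℝ} (ha : |a| ≤ R) (hb : |b| ≤ R) : |a - b| ≤ 2 * R :=
  (abs_sub _ _).trans (by linarith)

/-- The distance in `L¹([0,L])` of two functions at time `t`. -/
def l1dist (L : ℝ) (u u' : ℝ × ℝ → ℝ) (t : ℝ) : ℝ := ∫ x in Icc 0 L, |u (t, x) - u' (t, x)|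

theorem measurable_abs_sub {X : Type*} [MeasurableSpace X] {p q : X → ℝ} (hp : Measurable p)
    (hq : Measurable q) : Measurable fun x => |p x - q x| := by
  simp only [← Real.norm_eq_abs]; fun_prop

theorem measurable_l1dist (L : ℝ) (hu : Measurable u) (hu' : Measurable u') :
    Measurable (l1dist L u u') := by
  have h := (measurable_abs_sub hu hu').stronglyMeasurable
  exact (h.integral_prod_right (ν := volume.restrict (Icc 0 L))).measurable

theorem l1dist_nonneg (L : ℝ) (u u' : ℝ × ℝ → ℝ) (t : ℝ) : 0 ≤ l1dist L u u' t :=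
  integral_nonneg fun _ => abs_nonneg _

theorem integrableOn_abs_sub (L : ℝ) (hu : Measurable u) (hu' : Measurable u')
    (hR : ∀ z, |u z| ≤ R) (hR' : ∀ z, |u' z| ≤ R) (t : ℝ) :
    IntegrableOn (fun x => |u (t, x) - u' (t, x)|) (Icc 0 L) := by
  refine Measure.integrableOn_of_bounded (M := 2 * R) (by simp) ?_ ?_
  · exact (measurable_abs_sub (hu.comp measurable_prodMk_left)
      (hu'.comp measurable_prodMk_left)).aestronglyMeasurable
  · refine Eventually.of_forall fun x => ?_
    rw [Real.norm_eq_abs, abs_abs]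
    exact abs_sub_le_two_mul (hR _) (hR' _)

theorem l1dist_le (hL : 0 ≤ L) (hR : ∀ z, |u z| ≤ R) (hR' : ∀ z, |u' z| ≤ R) (t : ℝ) :
    |l1dist L u u' t| ≤ 2 * R * L := by
  have := norm_setIntegral_le_of_norm_le_const (μ := volume) (s := Icc 0 L)
    (f := fun x => |u (t, x) - u' (t, x)|) (C := 2 * R) (by simp) (fun x _ => by
      rw [Real.norm_eq_abs, abs_abs]
      exact abs_sub_le_two_mul (hR _) (hR' _))
  simpa [l1dist, Measure.real, hL] using this

/-- The growth of the `L¹` distance of two solutions is controlled by the boundary data. -/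
theorem InteriorSol.comparison (hLpos : 0 < L) (hg : LipschitzWith K g)
    (hu : InteriorSol T L g b0 bL R u)
    (hu' : InteriorSol T L g b0' bL' R u') (hC0 : 0 ≤ C)
    (h0 : ∀ᵐ t : ℝ, t ∈ Ioo 0 T → ∀ x ∈ uIcc (b0 t) (b0' t), ∀ y ∈ uIcc (b0 t) (b0' t),
      |g x - g y| ≤ C * |x - y|)
    (hL : ∀ᵐ t : ℝ, t ∈ Ioo 0 T → ∀ x ∈ uIcc (bL t) (bL' t), ∀ y ∈ uIcc (bL t) (bL' t),
      |g x - g y| ≤ C * |x - y|)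
    (hβ : IntegrableOn (fun t => |b0 t - b0' t| + |bL t - bL' t|) (Ioo 0 T)) :
    ∀ᵐ s : ℝ, ∀ᵐ t : ℝ, 0 < s → s < t → t < T → l1dist L u u' t ≤ l1dist L u u' s
      + C * ∫ t in Ioo 0 T, (|b0 t - b0' t| + |bL t - bL' t|) := by
  have hNm := measurable_l1dist L hu.measurable hu'.measurable
  have hNb := l1dist_le hLpos.le hu.bound hu'.bound
  -- The tests are products of η(t) and the spatial cut-off. The derivative of the cut-off creates
  -- the two boundary layers; as its width tends to 0, the L¹ distance and the fluxes between the
  -- traces remain.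
  refine ae_le_add_of_forall_test (locallyIntegrable_of_abs_le hNm hNb) ?_
  intro η hη hηc hη0 hη1 hηT
  have hηd : ∀ t, HasDerivAt η (deriv η t) t := fun t =>
    (hη.differentiable (by simp) t).hasDerivAt
  have hηdi : Integrable (deriv η) :=
    (hη.continuous_deriv (by simp)).integrable_of_hasCompactSupport hηc.deriv
  have hηi : Integrable η := hη.continuous.integrable_of_hasCompactSupport hηc
  have hηout : ∀ t, t ∉ Ioo 0 T → η t = 0 := fun t ht =>
    image_eq_zero_of_notMem_tsupport fun h => ht (hηT h)
  have hPm := measurable_abs_sub hu.measurable hu'.measurable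
  have hGm : Measurable fun z => kflux g (u z) (u' z) :=
    (continuous_kflux hg.continuous).measurable.comp (hu.measurable.prodMk hu'.measurable)
  have hP : ∀ z, |u z - u' z| ≤ 2 * R := fun z => abs_sub_le_two_mul (hu.bound z) (hu'.bound z)
  have hR0 : 0 ≤ 2 * R := (abs_nonneg _).trans (hP 0)
  have hG : ∀ z, |kflux g (u z) (u' z)| ≤ K * (2 * R) := fun z =>
    (abs_kflux_le hg _ _).trans (mul_le_mul_of_nonneg_left (hP z) K.2)
  obtain ⟨r, hrpos, hr0⟩ : ∃ r : ℕ → ℝ, (∀ n, 0 < r n) ∧ Tendsto r atTop (𝓝 0) :=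
    ⟨fun n => 1 / ((n : ℝ) + 1), fun n => by positivity, tendsto_one_div_add_atTop_nhds_zero_nat⟩
  have hr : Tendsto r atTop (𝓝[>] 0) :=
    tendsto_nhdsWithin_iff.2 ⟨hr0, Eventually.of_forall hrpos⟩
  have hrs : ∀ ε : ℝ, 0 < ε → ∀ᶠ n in atTop, 3 * r n ≤ ε := by
    intro ε hε
    filter_upwards [hr0.eventually_lt_const (show 0 < ε / 3 by positivity)] with n hn
    linarith
  -- the inequality for product test functions
  have hineq : ∀ᶠ n in atTop, 0 ≤ (∫ z : ℝ × ℝ, |u z - u' z| * (deriv η z.1 * cutoff L (r n) z.2))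
      + ∫ z : ℝ × ℝ, kflux g (u z) (u' z) * (η z.1 * cutoffDeriv L (r n) z.2) := by
    filter_upwards [hrs L hLpos] with n hn
    have hz : ∀ x, x ∉ Icc (r n) (L - r n) → cutoff L (r n) x = 0 := fun x hx =>
      cutoff_eq_zero (hrpos n) hn hx
    have hcc : HasCompactSupport (cutoff L (r n)) := HasCompactSupport.intro isCompact_Icc hz
    have hsub : tsupport (fun z : ℝ × ℝ => η z.1 * cutoff L (r n) z.2)
        ⊆ tsupport η ×ˢ Icc (r n) (L - r n) := by
      refine closure_minimal (fun z hz' => ?_) ((isClosed_tsupport η).prod isClosed_Icc)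
      refine ⟨subset_tsupport _ (left_ne_zero_of_mul hz'), ?_⟩
      by_contra h'
      exact right_ne_zero_of_mul hz' (hz _ h')
    have hmain := IsKruzkov.contraction (isOpen_Ioo.prod isOpen_Ioo) hg hu.measurable
      hu'.measurable hu.bound hu'.bound hu.kruzkov hu'.kruzkov
      (contDiff_tensor hη (contDiff_cutoff L (r n)))
      (IsCompact.of_isClosed_subset (hηc.isCompact.prod isCompact_Icc) (isClosed_tsupport _) hsub)
      (fun z => mul_nonneg (hη0 _) (cutoff_nonneg (hrpos n) hn _))
      (hsub.trans (prod_mono hηT fun x hx => ⟨by linarith [hx.1, hrpos n],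
        by linarith [hx.2, hrpos n]⟩))
    simp only [fun z : ℝ × ℝ => (fderiv_tensor (hηd z.1) (hasDerivAt_cutoff L (r n) z.2)).1,
      fun z : ℝ × ℝ => (fderiv_tensor (hηd z.1) (hasDerivAt_cutoff L (r n) z.2)).2] at hmain
    rwa [integral_add] at hmain
    · refine Integrable.bdd_mul (c := 2 * R) ?_ hPm.aestronglyMeasurable
        (Eventually.of_forall fun z => by rw [Real.norm_eq_abs, abs_abs]; exact hP z)
      exact hηdi.mul_prod
        ((contDiff_cutoff L (r n)).continuous.integrable_of_hasCompactSupport hcc)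
    · refine Integrable.bdd_mul (c := K * (2 * R)) ?_ hGm.aestronglyMeasurable
        (Eventually.of_forall fun z => hG z)
      exact hηi.mul_prod (integrable_cutoffDeriv_and_le (hrpos n)).1
  have hlim1 : Tendsto (fun n => ∫ z : ℝ × ℝ, |u z - u' z| * (deriv η z.1 * cutoff L (r n) z.2))
      atTop (𝓝 (∫ t, deriv η t * l1dist L u u' t)) := by
    have hind : Integrable ((Ioo 0 L).indicator fun _ : ℝ => (1 : ℝ)) :=
      (integrableOn_const (by simp)).integrable_indicator measurableSet_Ioo
    have hF : Integrable fun z : ℝ × ℝ =>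
        |u z - u' z| * (deriv η z.1 * (Ioo 0 L).indicator (fun _ => (1 : ℝ)) z.2) :=
      Integrable.bdd_mul (c := 2 * R) (hηdi.mul_prod hind) hPm.aestronglyMeasurable
        (Eventually.of_forall fun z => by rw [Real.norm_eq_abs, abs_abs]; exact hP z)
    have e : ∫ t, deriv η t * l1dist L u u' t = ∫ z : ℝ × ℝ,
        |u z - u' z| * (deriv η z.1 * (Ioo 0 L).indicator (fun _ => (1 : ℝ)) z.2) := by
      have : ∫ z : ℝ × ℝ, |u z - u' z| * (deriv η z.1 * (Ioo 0 L).indicator (fun _ => (1 : ℝ)) z.2)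
          = ∫ t, ∫ x, |u (t, x) - u' (t, x)|
            * (deriv η t * (Ioo 0 L).indicator (fun _ => (1 : ℝ)) x) := integral_prod _ hF
      rw [this]
      refine integral_congr_ae (Eventually.of_forall fun t => ?_)
      simp only [l1dist]
      rw [integral_Icc_eq_integral_Ioo, ← integral_indicator measurableSet_Ioo,
        ← integral_const_mul]
      refine integral_congr_ae (Eventually.of_forall fun x => ?_)
      by_cases hx : x ∈ Ioo 0 L
      · simp [hx, mul_comm]
      · simp [hx]
    rw [e]
    refine tendsto_integral_filter_of_dominated_convergence (fun z : ℝ × ℝ =>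
      2 * R * (|deriv η z.1| * (Ioo 0 L).indicator (fun _ => (1 : ℝ)) z.2)) ?_ ?_ ?_ ?_
    · refine Eventually.of_forall fun n => ?_
      have c1 := hη.continuous_deriv (by simp)
      have c2 := (contDiff_cutoff L (r n)).continuous
      exact hPm.aestronglyMeasurable.mul (Continuous.aestronglyMeasurable (by fun_prop))
    · filter_upwards [hrs L hLpos] with n hn
      refine Eventually.of_forall fun z => ?_
      rw [norm_mul, norm_mul, Real.norm_eq_abs, Real.norm_eq_abs, Real.norm_eq_abs, abs_abs,
        abs_of_nonneg (cutoff_nonneg (hrpos n) hn _)]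
      refine mul_le_mul (hP z) ?_ (mul_nonneg (abs_nonneg _)
        (cutoff_nonneg (hrpos n) hn _)) hR0
      refine mul_le_mul_of_nonneg_left ?_ (abs_nonneg _)
      by_cases hx : z.2 ∈ Ioo 0 L
      · simpa [hx] using cutoff_le_one L (r n) z.2
      · rw [cutoff_eq_zero (hrpos n) hn fun h => hx ⟨by linarith [h.1, hrpos n],
          by linarith [h.2, hrpos n]⟩]
        simp [hx]
    · exact (hηdi.abs.mul_prod hind).const_mul _
    · refine Eventually.of_forall fun z => ?_
      refine (Tendsto.const_mul _ ?_).const_mul _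
      refine tendsto_const_nhds.congr' ?_
      by_cases hx : z.2 ∈ Ioo 0 L
      · filter_upwards [hrs z.2 hx.1, hrs (L - z.2) (by linarith [hx.2])] with n h1 h2
        rw [cutoff_eq_one (hrpos n) ⟨by linarith [hrpos n], by linarith [hrpos n]⟩]
        simp [hx]
      · filter_upwards [hrs L hLpos] with n hn
        rw [cutoff_eq_zero (hrpos n) hn fun h => hx ⟨by linarith [h.1, hrpos n],
          by linarith [h.2, hrpos n]⟩]
        simp [hx]
  -- the boundary layers
  obtain ⟨B, hB⟩ : ∃ B : ℝ → ℝ, ∀ᵐ t : ℝ, t ∈ Ioo 0 T → Tendsto (fun r : ℝ =>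
      ∫ x, cutoffDeriv L r x * kflux g (u (t, x)) (u' (t, x))) (𝓝[>] 0) (𝓝 (B t)) ∧
      B t ≤ C * (|b0 t - b0' t| + |bL t - bL' t|) := by
    have h := hu.exists_trace_flux hg hu' hC0 h0 hL
    have : ∀ t, ∃ ℓ, (∃ ℓ', Tendsto (fun r : ℝ =>
        ∫ x, cutoffDeriv L r x * kflux g (u (t, x)) (u' (t, x))) (𝓝[>] 0) (𝓝 ℓ') ∧
        ℓ' ≤ C * (|b0 t - b0' t| + |bL t - bL' t|)) → Tendsto (fun r : ℝ =>
        ∫ x, cutoffDeriv L r x * kflux g (u (t, x)) (u' (t, x))) (𝓝[>] 0) (𝓝 ℓ) ∧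
        ℓ ≤ C * (|b0 t - b0' t| + |bL t - bL' t|) := by
      intro t
      by_cases ht : ∃ ℓ', Tendsto (fun r : ℝ =>
        ∫ x, cutoffDeriv L r x * kflux g (u (t, x)) (u' (t, x))) (𝓝[>] 0) (𝓝 ℓ') ∧
        ℓ' ≤ C * (|b0 t - b0' t| + |bL t - bL' t|)
      · exact ⟨ht.choose, fun _ => ht.choose_spec⟩
      · exact ⟨0, fun h => absurd h ht⟩
    choose B hB using this
    exact ⟨B, h.mono fun t ht htT => hB t (ht htT)⟩
  set I : ℕ → ℝ → ℝ := fun n t =>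
    η t * ∫ x, cutoffDeriv L (r n) x * kflux g (u (t, x)) (u' (t, x)) with hI
  have hIm : ∀ n, AEStronglyMeasurable (I n) volume := by
    intro n
    refine hη.continuous.aestronglyMeasurable.mul ?_
    have ck := continuous_rampKernel
    have c1 : Continuous (cutoffDeriv L (r n)) := by unfold cutoffDeriv; fun_prop
    have : StronglyMeasurable fun z : ℝ × ℝ => cutoffDeriv L (r n) z.2 * kflux g (u z) (u' z) :=
      ((c1.measurable.comp measurable_snd).mul hGm).stronglyMeasurable
    exact (this.integral_prod_right (ν := volume)).aestronglyMeasurable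
  have hIb : ∀ n t, ‖I n t‖ ≤ K * (2 * R) * 2 * |η t| := by
    intro n t
    have hc := integrable_cutoffDeriv_and_le (L := L) (hrpos n)
    have : ‖∫ x, cutoffDeriv L (r n) x * kflux g (u (t, x)) (u' (t, x))‖
        ≤ ∫ x, |cutoffDeriv L (r n) x| * (K * (2 * R)) := by
      refine norm_integral_le_of_norm_le (hc.1.abs.mul_const _)
        (Eventually.of_forall fun x => ?_)
      rw [norm_mul, Real.norm_eq_abs, Real.norm_eq_abs]
      exact mul_le_mul_of_nonneg_left (hG _) (abs_nonneg _)
    rw [integral_mul_const] at this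
    have hKR : 0 ≤ K * (2 * R) := mul_nonneg K.2 hR0
    have h3 := this.trans (mul_le_mul_of_nonneg_right hc.2 hKR)
    rw [hI, norm_mul, Real.norm_eq_abs]
    calc _ ≤ |η t| * (2 * (K * (2 * R))) := mul_le_mul_of_nonneg_left h3 (abs_nonneg _)
      _ = _ := by ring
  have hIlim : ∀ᵐ t : ℝ, Tendsto (fun n => I n t) atTop (𝓝 (η t * B t)) := by
    filter_upwards [hB] with t ht
    by_cases htT : t ∈ Ioo 0 T
    · exact ((ht htT).1.comp hr).const_mul _
    · simp only [hI, hηout t htT, zero_mul]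
      exact tendsto_const_nhds
  have hbi : Integrable fun t => K * (2 * R) * 2 * |η t| := hηi.abs.const_mul _
  have hlim2 : Tendsto (fun n => ∫ t, I n t) atTop (𝓝 (∫ t, η t * B t)) :=
    tendsto_integral_of_dominated_convergence _ hIm hbi
      (fun n => Eventually.of_forall (hIb n)) hIlim
  -- B was chosen pointwise, so its measurability is not given; on the support of η it is inherited
  -- from the dominated limit.
  have hBi : Integrable fun t => η t * B t :=
    ⟨aestronglyMeasurable_of_tendsto_ae atTop hIm hIlim,
      hasFiniteIntegral_of_dominated_convergence hbi.2
        (fun n => Eventually.of_forall (hIb n)) hIlim⟩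
  have hIeq : ∀ n, ∫ z : ℝ × ℝ, kflux g (u z) (u' z) * (η z.1 * cutoffDeriv L (r n) z.2)
      = ∫ t, I n t := by
    intro n
    have hF : Integrable fun z : ℝ × ℝ =>
        kflux g (u z) (u' z) * (η z.1 * cutoffDeriv L (r n) z.2) :=
      Integrable.bdd_mul (c := K * (2 * R))
        (hηi.mul_prod (integrable_cutoffDeriv_and_le (hrpos n)).1) hGm.aestronglyMeasurable
        (Eventually.of_forall fun z => hG z)
    have : ∫ z : ℝ × ℝ, kflux g (u z) (u' z) * (η z.1 * cutoffDeriv L (r n) z.2)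
        = ∫ t, ∫ x, kflux g (u (t, x)) (u' (t, x)) * (η t * cutoffDeriv L (r n) x) :=
      integral_prod _ hF
    rw [this]
    refine integral_congr_ae (Eventually.of_forall fun t => ?_)
    simp only [hI]
    rw [← integral_const_mul]
    refine integral_congr_ae (Eventually.of_forall fun x => ?_)
    simp only []
    ring
  have hfin : 0 ≤ (∫ t, deriv η t * l1dist L u u' t) + ∫ t, η t * B t := by
    refine ge_of_tendsto (hlim1.add hlim2) ?_
    filter_upwards [hineq] with n hn
    rwa [hIeq n] at hn
  -- Here η ≤ 1 is used, together with the nonnegativity of the upper bound for B.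
  have hBle : ∫ t, η t * B t ≤ C * ∫ t in Ioo 0 T, (|b0 t - b0' t| + |bL t - bL' t|) := by
    rw [← integral_const_mul, ← integral_indicator measurableSet_Ioo]
    refine integral_mono_ae hBi (IntegrableOn.integrable_indicator (hβ.const_mul C) measurableSet_Ioo) ?_
    filter_upwards [hB] with t ht
    by_cases htT : t ∈ Ioo 0 T
    · simp only [htT, indicator_of_mem]
      have hb : 0 ≤ C * (|b0 t - b0' t| + |bL t - bL' t|) := by positivity
      exact (mul_le_mul_of_nonneg_left (ht htT).2 (hη0 t)).trans
        (mul_le_of_le_one_left hb (hη1 t))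
    · simp [htT, hηout t htT]
  linarith

end

end SegmentIBVP

end

noncomputable section

namespace SegmentIBVP

/-! ### Continuity in time -/

theorem toL1_dist {X : Type*} [MeasurableSpace X] {μ : Measure X} {p q : X → ℝ}
    (hp : Integrable p μ) (hq : Integrable q μ) :
    ‖hp.toL1 p - hq.toL1 q‖ = ∫ x, |p x - q x| ∂μ := by
  rw [← Integrable.toL1_sub p q hp hq, L1.norm_of_fun_eq_integral_norm]
  rfl

/-- Translations are continuous in `L¹`. -/
theorem tendsto_integral_translation {β : ℝ → ℝ} (hβ : Integrable β) :
    Tendsto (fun h : ℝ => ∫ t, |β (t + h) - β t|) (𝓝 0) (𝓝 0) := by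
  -- Translations form a continuous family of measure-preserving maps, and composition with such a
  -- family is continuous in L¹.
  let G : ℝ → C(ℝ, ℝ) := fun h => ⟨fun t => t + h, by fun_prop⟩
  have hGc : Continuous G := by
    have : Continuous (fun p : ℝ × ℝ => p.2 + p.1) := by fun_prop
    exact (ContinuousMap.curry ⟨_, this⟩).continuous
  have hG : ∀ h, MeasurePreserving (G h) volume volume := fun h =>
    measurePreserving_add_right volume h
  have hlim := Filter.Tendsto.compMeasurePreservingLp (p := 1) (E := ℝ) (μ := volume)
    (ν := volume) (l := 𝓝 (0 : ℝ)) (f := fun _ => hβ.toL1 β) (f₀ := hβ.toL1 β)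
    tendsto_const_nhds (hGc.tendsto 0) hG (hG 0) ENNReal.one_ne_top
  have key : ∀ h, Lp.compMeasurePreserving (G h) (hG h) (hβ.toL1 β)
      = (hβ.comp_add_right h).toL1 (fun t => β (t + h)) := by
    intro h
    exact Lp.toLp_compMeasurePreserving (memLp_one_iff_integrable.2 hβ) (hG h)
  simp only [key] at hlim
  rw [tendsto_iff_norm_sub_tendsto_zero] at hlim
  refine hlim.congr fun h => ?_
  rw [toL1_dist]
  simp

section

variable {T L R : ℝ} {g b0 bL : ℝ → ℝ} {K : NNReal} {u : ℝ × ℝ → ℝ}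

theorem InteriorSol.mono {T' : ℝ} (hT : T' ≤ T) (hu : InteriorSol T L g b0 bL R u) :
    InteriorSol T' L g b0 bL R u where
  measurable := hu.measurable
  bound := hu.bound
  kruzkov := fun k φ h1 h2 h3 h4 => hu.kruzkov k φ h1 h2 h3
    (h4.trans (prod_mono (Ioo_subset_Ioo le_rfl hT) le_rfl))
  left := hu.left.mono fun _ ht htT => ht ⟨htT.1, htT.2.trans_le hT⟩
  right := hu.right.mono fun _ ht htT => ht ⟨htT.1, htT.2.trans_le hT⟩

/-- Time translates solve the same equation because the flux is autonomous; this is what the change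
of time is for. -/
theorem InteriorSol.shift {h : ℝ} (hh : 0 ≤ h) (hu : InteriorSol T L g b0 bL R u) :
    InteriorSol (T - h) L g (fun t => b0 (t + h)) (fun t => bL (t + h)) R
      (fun z => u (z.1 + h, z.2)) where
  measurable := hu.measurable.comp (by fun_prop)
  bound := fun z => hu.bound _
  kruzkov := by
    intro k φ h1 h2 h3 h4
    have key : ∀ z : ℝ × ℝ, fderiv ℝ (fun z => φ (z - (h, 0))) z = fderiv ℝ φ (z - (h, 0)) :=
      fun z => fderiv_comp_sub _
    have := hu.kruzkov k (fun z => φ (z - (h, 0))) (h1.comp (contDiff_id.sub contDiff_const))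
      (h2.comp_homeomorph (Homeomorph.subRight (h, 0))) (fun z => h3 _) (by
        intro z hz
        have hz' : z - ((h, 0) : ℝ × ℝ) ∈ tsupport φ :=
          tsupport_comp_subset_preimage φ (f := fun z : ℝ × ℝ => z - (h, 0)) (by fun_prop) hz
        have := h4 hz'
        simp only [mem_prod, mem_Ioo, Prod.fst_sub, Prod.snd_sub, sub_zero] at this ⊢
        exact ⟨⟨by linarith, by linarith⟩, this.2⟩)
    simp only [key] at this
    rw [← integral_add_right_eq_self _ ((h, 0) : ℝ × ℝ)] at this
    have e : ∀ z : ℝ × ℝ, z + (h, 0) = (z.1 + h, z.2) := fun z => by ext <;> simp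
    simpa [e] using this
  left := by
    have := (measurePreserving_add_right volume h).quasiMeasurePreserving.ae hu.left
    exact this.mono fun t ht htT => ht ⟨by linarith [htT.1], by linarith [htT.2]⟩
  right := by
    have := (measurePreserving_add_right volume h).quasiMeasurePreserving.ae hu.right
    exact this.mono fun t ht htT => ht ⟨by linarith [htT.1], by linarith [htT.2]⟩

theorem l1dist_triangle {u v w : ℝ × ℝ → ℝ} (L : ℝ) (hu : Measurable u) (hv : Measurable v)
    (hw : Measurable w) (hRu : ∀ z, |u z| ≤ R) (hRv : ∀ z, |v z| ≤ R) (hRw : ∀ z, |w z| ≤ R)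
    (t : ℝ) : l1dist L u w t ≤ l1dist L u v t + l1dist L v w t := by
  unfold l1dist
  rw [← integral_add (integrableOn_abs_sub L hu hv hRu hRv t)
    (integrableOn_abs_sub L hv hw hRv hRw t)]
  exact integral_mono_of_nonneg (Eventually.of_forall fun _ => abs_nonneg _)
    ((integrableOn_abs_sub L hu hv hRu hRv t).add (integrableOn_abs_sub L hv hw hRv hRw t))
    (Eventually.of_forall fun x => abs_sub_le _ _ _)

/-- Selects a good instant when only almost-everywhere information is at hand: the value there does
not exceed the mean. The complement of the interval is added to the excluded null set to force s
into it. -/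
theorem exists_le_mean {D : ℝ → ℝ} (hD : LocallyIntegrable D) {h : ℝ} (hh : 0 < h) {P : ℝ → Prop}
    (hP : ∀ᵐ s : ℝ, P s) : ∃ s ∈ Ioo 0 h, P s ∧ D s ≤ h⁻¹ * ∫ s in Ioo 0 h, D s := by
  have hne : volume (Ioo 0 h) ≠ 0 := by simpa using hh
  obtain ⟨s, hs, hs2⟩ := exists_notMem_null_le_average (μ := volume.restrict (Ioo 0 h))
    (f := D) (N := {s | ¬ P s} ∪ (Ioo 0 h)ᶜ) (by simpa using hh)
    ((hD.integrableOn_isCompact isCompact_Icc).mono_set Ioo_subset_Icc_self) (by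
      refine measure_union_null ?_ ?_
      · exact ae_restrict_of_ae hP
      · rw [Measure.restrict_apply measurableSet_Ioo.compl]; simp)
  rw [mem_union, not_or, mem_ofPred_eq, not_not, notMem_compl_iff] at hs
  refine ⟨s, hs.2, hs.1, hs2.trans (le_of_eq ?_)⟩
  rw [setAverage_eq]
  simp [Measure.real, hh.le]

/-- Almost everywhere in time, the increment of a solution over a time span `h` is controlled by
its initial oscillation and by the translations of the boundary data. -/
theorem InteriorSol.ae_increment_le (hL : 0 < L) (hg : LipschitzWith K g)
    (hu : InteriorSol T L g b0 bL R u) (hb0 : IntegrableOn b0 (Ioo 0 T))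
    (hbL : IntegrableOn bL (Ioo 0 T)) {w : ℝ → ℝ} (hw : Measurable w) (hwR : ∀ x, |w x| ≤ R)
    {h : ℝ} (hh : 0 < h) :
    ∀ᵐ t : ℝ, h ≤ t → t + h < T → l1dist L (fun z => u (z.1 + h, z.2)) u t
      ≤ 2 * ((2 * h)⁻¹ * ∫ s in Ioo 0 (2 * h), l1dist L u (fun z => w z.2) s)
        + K * ((∫ t, |(Ioo 0 T).indicator b0 (t + h) - (Ioo 0 T).indicator b0 t|)
          + ∫ t, |(Ioo 0 T).indicator bL (t + h) - (Ioo 0 T).indicator bL t|) := by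
  have hsh := hu.shift hh.le
  have hmono : InteriorSol (T - h) L g b0 bL R u := hu.mono (by linarith)
  have lip : ∀ x y, |g x - g y| ≤ K * |x - y| := LipschitzWith.abs_sub_le hg
  have hi : ∀ b : ℝ → ℝ, IntegrableOn b (Ioo 0 T) →
      Integrable fun t => |(Ioo 0 T).indicator b (t + h) - (Ioo 0 T).indicator b t| := by
    intro b hb
    have := hb.integrable_indicator measurableSet_Ioo
    exact ((this.comp_add_right h).sub this).abs
  have heq : ∀ b : ℝ → ℝ, ∀ t ∈ Ioo 0 (T - h),
      |(Ioo 0 T).indicator b (t + h) - (Ioo 0 T).indicator b t| = |b (t + h) - b t| := by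
    intro b t ht
    rw [indicator_of_mem, indicator_of_mem]
    · exact ⟨ht.1, by linarith [ht.2]⟩
    · exact ⟨by linarith [ht.1], by linarith [ht.2]⟩
  have hsum := (hi b0 hb0).add (hi bL hbL)
  have hβ : IntegrableOn (fun t => |b0 (t + h) - b0 t| + |bL (t + h) - bL t|) (Ioo 0 (T - h)) :=
    hsum.integrableOn.congr_fun (fun t ht => by
      simp only [Pi.add_apply, heq b0 t ht, heq bL t ht]) measurableSet_Ioo
  have hβle : ∫ t in Ioo 0 (T - h), (|b0 (t + h) - b0 t| + |bL (t + h) - bL t|)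
      ≤ (∫ t, |(Ioo 0 T).indicator b0 (t + h) - (Ioo 0 T).indicator b0 t|)
          + ∫ t, |(Ioo 0 T).indicator bL (t + h) - (Ioo 0 T).indicator bL t| := by
    rw [← integral_add (hi b0 hb0) (hi bL hbL)]
    rw [← setIntegral_congr_fun measurableSet_Ioo (fun t ht => by
      simp only [heq b0 t ht, heq bL t ht] :
      EqOn (fun t => |(Ioo 0 T).indicator b0 (t + h) - (Ioo 0 T).indicator b0 t|
        + |(Ioo 0 T).indicator bL (t + h) - (Ioo 0 T).indicator bL t|) _ (Ioo 0 (T - h)))]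
    exact setIntegral_le_integral hsum (Eventually.of_forall fun t => by positivity)
  -- The solution is compared with its own translate by h on (0, T - h); the boundary data of the
  -- two differ by a translation.
  have hcomp := hsh.comparison hL hg hmono (C := K) K.2 (Eventually.of_forall fun t _ x _ y _ =>
    lip x y) (Eventually.of_forall fun t _ x _ y _ => lip x y) hβ
  set D := l1dist L u fun z => w z.2 with hDdef
  have hwm : Measurable fun z : ℝ × ℝ => w z.2 := hw.comp measurable_snd
  have hDm : Measurable D := measurable_l1dist L hu.measurable hwm
  have hDb : ∀ t, |D t| ≤ 2 * R * L := l1dist_le hL.le hu.bound fun z => hwR _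
  have hDloc : LocallyIntegrable D := locallyIntegrable_of_abs_le hDm hDb
  have hD0 : ∀ t, 0 ≤ D t := fun t => l1dist_nonneg _ _ _ _
  set N := l1dist L (fun z => u (z.1 + h, z.2)) u with hN
  have hNloc : LocallyIntegrable N := locallyIntegrable_of_abs_le
    (measurable_l1dist L hsh.measurable hu.measurable) (l1dist_le hL.le hsh.bound hu.bound)
  -- The starting time lies in (0, h), which is why the conclusion is restricted to h ≤ t.
  obtain ⟨s, hs, hs1, hs2⟩ := exists_le_mean hNloc hh hcomp
  -- Passing through the initial datum, N(s) ≤ D(s + h) + D(s); integrating s over (0, h) covers (0,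
  -- 2h) once.
  have hmean : h⁻¹ * ∫ s in Ioo 0 h, N s ≤ 2 * ((2 * h)⁻¹ * ∫ s in Ioo 0 (2 * h), D s) := by
    have hDi : ∀ a b : ℝ, IntervalIntegrable D volume a b := fun a b =>
      LocallyIntegrable.intervalIntegrable' hDloc a b
    have hN1 : ∀ s, N s ≤ D (s + h) + D s := by
      intro s
      have h1 := l1dist_triangle L hsh.measurable hwm hu.measurable hsh.bound (fun z => hwR _)
        hu.bound s
      refine h1.trans (le_of_eq ?_)
      congr 1
      simp only [hDdef, l1dist]
      exact integral_congr_ae (Eventually.of_forall fun x => abs_sub_comm _ _)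
    have h2 : ∫ s in Ioo 0 h, N s ≤ ∫ s in Ioo 0 (2 * h), D s := by
      rw [← integral_Ioc_eq_integral_Ioo, ← integral_Ioc_eq_integral_Ioo,
        ← intervalIntegral.integral_of_le hh.le,
        ← intervalIntegral.integral_of_le (by linarith : (0 : ℝ) ≤ 2 * h),
        ← intervalIntegral.integral_add_adjacent_intervals (hDi 0 h) (hDi h (2 * h))]
      have e : ∫ s in h..(2 * h), D s = ∫ s in (0 : ℝ)..h, D (s + h) := by
        rw [intervalIntegral.integral_comp_add_right]
        congr 1 <;> ring
      have hi2 : IntervalIntegrable (fun s => D (s + h)) volume 0 h := by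
        have := (hDi h (2 * h)).comp_add_right h
        convert this using 1 <;> ring
      rw [e, add_comm, ← intervalIntegral.integral_add hi2 (hDi 0 h)]
      exact intervalIntegral.integral_mono_on hh.le
        (LocallyIntegrable.intervalIntegrable' hNloc 0 h) (hi2.add (hDi 0 h)) fun s _ => hN1 s
    calc h⁻¹ * ∫ s in Ioo 0 h, N s ≤ h⁻¹ * ∫ s in Ioo 0 (2 * h), D s := by gcongr
      _ = _ := by field_simp
  filter_upwards [hs1] with t ht hht htT
  have h1 := ht hs.1 (hs.2.trans_le hht) (by linarith)
  exact h1.trans (add_le_add (hs2.trans hmean)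
    (mul_le_mul_of_nonneg_left hβle (NNReal.coe_nonneg K)))

end

end SegmentIBVP

end

/-! ### From increments to a continuous curve in L¹ -/

noncomputable section

namespace SegmentIBVP

section

variable {T L R : ℝ} {g b0 bL : ℝ → ℝ} {K : NNReal} {u : ℝ × ℝ → ℝ}

theorem integrable_slice (L : ℝ) (hu : Measurable u) (hR : ∀ z, |u z| ≤ R) (t : ℝ) :
    Integrable (fun x => u (t, x)) (volume.restrict (Icc 0 L)) :=
  Measure.integrableOn_of_bounded (M := R) (by simp)
    (hu.comp measurable_prodMk_left).aestronglyMeasurable (Eventually.of_forall fun _ => hR _)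

theorem eventually_small_of_tendsto {μ : ℝ → ℝ} (h : Tendsto μ (𝓝[>] 0) (𝓝 0)) {ε : ℝ}
    (hε : 0 < ε) : ∃ δ > 0, ∀ r, 0 < r → r < δ → μ r ≤ ε := by
  have := h.eventually_lt_const hε
  rw [eventually_nhdsWithin_iff, Metric.eventually_nhds_iff] at this
  obtain ⟨δ, hδ, H⟩ := this
  refine ⟨δ, hδ, fun r hr0 hr => (H ?_ hr0).le⟩
  rw [Real.dist_eq, sub_zero, abs_of_pos hr0]
  exact hr

theorem tendsto_two_mul_nhdsGT : Tendsto (fun r : ℝ => 2 * r) (𝓝[>] 0) (𝓝[>] 0) := by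
  refine tendsto_nhdsWithin_iff.2 ⟨?_, ?_⟩
  · have : Tendsto (fun r : ℝ => 2 * r) (𝓝 0) (𝓝 (2 * 0)) := (continuous_const_mul 2).tendsto 0
    rw [mul_zero] at this
    exact this.mono_left nhdsWithin_le_nhds
  · filter_upwards [self_mem_nhdsWithin] with r hr
    exact mul_pos (two_pos (α := ℝ)) (mem_Ioi.1 hr)

/-- A family that is close to its forward translates extends continuously. -/
theorem exists_continuousOn_of_forward_increments {X : Type*} [MetricSpace X] [CompleteSpace X]
    {T : ℝ} (hT : 0 < T) {f : ℝ → X} {x₀ : X} {A : ℝ → ℝ} (hA : Tendsto A (𝓝[>] 0) (𝓝 0))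
    (hmean : ∀ t, 0 < t → ∀ P : ℝ → Prop, (∀ᵐ h : ℝ, P h) →
      ∃ h ∈ Ioo 0 t, P h ∧ dist (f (t + h)) x₀ ≤ A t)
    (hinc : ∀ ε > 0, ∃ δ > 0, ∀ᵐ t : ℝ, ∀ᵐ h : ℝ, 0 < h → h < δ → h ≤ t → t + h < T →
      dist (f (t + h)) (f t) ≤ ε) :
    ∃ U : ℝ → X, ContinuousOn U (Icc 0 T) ∧ (∀ᵐ t : ℝ, t ∈ Ioo 0 T → U t = f t) ∧ U 0 = x₀ := by
  choose δ hδ hinc using fun n : ℕ => hinc (1 / ((n : ℝ) + 1)) (by positivity)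
  set S : Set ℝ := {t | ∀ n, ∀ᵐ h : ℝ, 0 < h → h < δ n → h ≤ t → t + h < T →
      dist (f (t + h)) (f t) ≤ 1 / ((n : ℝ) + 1)} with hS
  have hSae : ∀ᵐ t : ℝ, t ∈ S := ae_all_iff.2 hinc
  set E := Ioo 0 T ∩ S with hE
  have hEcl : Icc 0 T ⊆ closure E := by
    have hd : Dense S := Measure.dense_of_ae hSae
    have h1 : Ioo 0 T ⊆ closure E := hd.open_subset_closure_inter isOpen_Ioo
    have := closure_mono h1
    rwa [closure_Ioo hT.ne, closure_closure] at this
  -- Two good times s ≤ t are both compared with a common later time t + h. Almost every small h is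
  -- good for both; the halves of δ and s ensure that the increment t - s + h from s stays below δ
  -- and does not exceed s.
  have claim : ∀ n, ∀ s ∈ E, ∀ t ∈ E, s ≤ t → t - s < δ n / 2 → t - s < s / 2 →
      dist (f t) (f s) ≤ 2 * (1 / ((n : ℝ) + 1)) := by
    intro n s hs t ht hst h1 h2
    have hs1 := hs.2 n
    have ht1 := ht.2 n
    have hs2 : ∀ᵐ h : ℝ, 0 < (t - s) + h → (t - s) + h < δ n → (t - s) + h ≤ s →
        s + ((t - s) + h) < T → dist (f (s + ((t - s) + h))) (f s) ≤ 1 / ((n : ℝ) + 1) :=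
      (measurePreserving_add_left volume (t - s)).quasiMeasurePreserving.ae hs1
    have hpos : 0 < min (min (δ n / 2) (s / 2)) (T - t) :=
      lt_min (lt_min (half_pos (hδ n)) (half_pos hs.1.1)) (sub_pos.2 ht.1.2)
    have hex : ∃ h ∈ Ioo 0 (min (min (δ n / 2) (s / 2)) (T - t)),
        dist (f (t + h)) (f t) ≤ 1 / ((n : ℝ) + 1) ∧ dist (f (t + h)) (f s) ≤ 1 / ((n : ℝ) + 1) := by
      -- The zero function serves only to extract a point of a set of full measure.
      obtain ⟨h, hh, ⟨p1, p2⟩, -⟩ := exists_le_mean (locallyIntegrable_const (0 : ℝ)) hpos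
        (ht1.and hs2)
      have q1 := hh.2.trans_le ((min_le_left _ _).trans (min_le_left _ _))
      have q2 := hh.2.trans_le ((min_le_left _ _).trans (min_le_right _ _))
      have q3 := hh.2.trans_le (min_le_right _ _)
      have := hδ n
      refine ⟨h, hh, p1 hh.1 (by linarith) (by linarith [hs.1.1]) (by linarith), ?_⟩
      have := p2 (by linarith [hh.1]) (by linarith) (by linarith) (by linarith)
      rwa [show s + (t - s + h) = t + h by ring] at this
    obtain ⟨h, -, p1, p2⟩ := hex
    rw [dist_comm] at p1
    linarith [dist_triangle (f t) (f (t + h)) (f s)]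
  -- The restriction h ≤ t makes the claim useless at 0. Instead f(t) is compared with f(t + h) for
  -- an h < t such that f(t + h) is close to x₀; t < T / 2 keeps t + h below T.
  have lim0 : Tendsto f (𝓝[E] 0) (𝓝 x₀) := by
    rw [Metric.tendsto_nhds]
    intro ε hε
    obtain ⟨n, hn⟩ := exists_nat_one_div_lt (half_pos hε)
    obtain ⟨d, hd, H⟩ := eventually_small_of_tendsto hA (half_pos hε)
    have hev : ∀ᶠ t : ℝ in 𝓝[E] 0, t < min (min d (δ n)) (T / 2) :=
      (eventually_lt_nhds (lt_min (lt_min hd (hδ n)) (half_pos hT))).filter_mono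
        nhdsWithin_le_nhds
    filter_upwards [self_mem_nhdsWithin, hev] with t ht ht2
    have q1 := ht2.trans_le ((min_le_left _ _).trans (min_le_left _ _))
    have q2 := ht2.trans_le ((min_le_left _ _).trans (min_le_right _ _))
    have q3 := ht2.trans_le (min_le_right _ _)
    obtain ⟨h, hh, p1, p2⟩ := hmean t ht.1.1 _ (ht.2 n)
    have p3 := p1 hh.1 (hh.2.trans q2) hh.2.le (by linarith [hh.2])
    rw [dist_comm] at p3
    linarith [dist_triangle (f t) (f (t + h)) x₀, H t ht.1.1 q1]
  have limpos : ∀ x ∈ Icc 0 T, ∃ y, Tendsto f (𝓝[E] x) (𝓝 y) := by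
    intro x hx
    rcases hx.1.eq_or_lt with rfl | hx0
    · exact ⟨x₀, lim0⟩
    have hne : (𝓝[E] x).NeBot := mem_closure_iff_nhdsWithin_neBot.1 (hEcl hx)
    refine cauchy_map_iff_exists_tendsto.1 (Metric.cauchy_iff.2 ⟨inferInstance, fun ε hε => ?_⟩)
    obtain ⟨n, hn⟩ := exists_nat_one_div_lt (half_pos hε)
    -- Points of this ball differ by less than both δ / 4 and x / 4 and exceed 7x / 8, which meets
    -- both conditions of the claim.
    set ρ := min (δ n) x / 8 with hρ
    have hρpos : 0 < ρ := by have := lt_min (hδ n) hx0; positivity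
    have hρ1 : ρ ≤ δ n / 8 := by have := min_le_left (δ n) x; linarith
    have hρ2 : ρ ≤ x / 8 := by have := min_le_right (δ n) x; linarith
    refine ⟨f '' (E ∩ Metric.ball x ρ), image_mem_map
      (inter_mem self_mem_nhdsWithin (mem_nhdsWithin_of_mem_nhds (Metric.ball_mem_nhds x hρpos))),
      ?_⟩
    have main : ∀ s ∈ E ∩ Metric.ball x ρ, ∀ t ∈ E ∩ Metric.ball x ρ, s ≤ t →
        dist (f t) (f s) < ε := by
      intro s hs t ht hst
      have hs' := hs.2
      have ht' := ht.2
      rw [Metric.mem_ball, Real.dist_eq, abs_lt] at hs' ht'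
      have := claim n s hs.1 t ht.1 hst (by linarith) (by linarith)
      linarith
    rintro _ ⟨s, hs, rfl⟩ _ ⟨t, ht, rfl⟩
    rcases le_total s t with hst | hst
    · rw [dist_comm]; exact main s hs t ht hst
    · exact main t ht s hs hst
  refine ⟨extendFrom E f, continuousOn_extendFrom hEcl limpos, ?_, ?_⟩
  · filter_upwards [hSae] with t ht htT
    have htE : t ∈ E := ⟨htT, ht⟩
    obtain ⟨y, hy⟩ := limpos t ⟨htT.1.le, htT.2.le⟩
    have : y = f t := tendsto_nhds_unique (hy.mono_left (pure_le_nhdsWithin htE))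
      (tendsto_pure_nhds f t)
    exact extendFrom_eq (subset_closure htE) (this ▸ hy)
  · exact extendFrom_eq (hEcl ⟨le_rfl, hT.le⟩) lim0

/-- A solution attaining its initial datum in the mean has a representative which is continuous
in time. -/
theorem InteriorSol.exists_continuousOn (hT : 0 < T) (hL : 0 < L) (hg : LipschitzWith K g)
    (hu : InteriorSol T L g b0 bL R u) (hb0 : IntegrableOn b0 (Ioo 0 T))
    (hbL : IntegrableOn bL (Ioo 0 T)) {w : ℝ → ℝ} (hw : Measurable w) (hwR : ∀ x, |w x| ≤ R)
    (hinit : Tendsto (fun ε => ε⁻¹ * ∫ s in Ioo 0 ε, l1dist L u (fun z => w z.2) s)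
      (𝓝[>] 0) (𝓝 0)) :
    ∃ U : ℝ → L1Segment L, ContinuousOn U (Icc 0 T) ∧
      (∀ᵐ t : ℝ, t ∈ Ioo 0 T → U t = (integrable_slice L hu.measurable hu.bound t).toL1 _) ∧
      U 0 =ᵐ[volume.restrict (Icc 0 L)] w := by
  have hwm : Measurable fun z : ℝ × ℝ => w z.2 := hw.comp measurable_snd
  have hwi : Integrable w (volume.restrict (Icc 0 L)) := integrable_slice L hwm (fun z => hwR _) 0
  set D := l1dist L u fun z => w z.2 with hDdef
  have hDloc : LocallyIntegrable D := locallyIntegrable_of_abs_le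
    (measurable_l1dist L hu.measurable hwm) (l1dist_le hL.le hu.bound fun z => hwR _)
  have hD0 : ∀ t, 0 ≤ D t := fun t => l1dist_nonneg _ _ _ _
  set f : ℝ → L1Segment L := fun t =>
    (integrable_slice L hu.measurable hu.bound t).toL1 (fun x => u (t, x)) with hf
  have hfd : ∀ s t, dist (f s) (f t) = ∫ x in Icc 0 L, |u (s, x) - u (t, x)| := fun s t => by
    rw [dist_eq_norm, hf, toL1_dist]
  have hfw : ∀ t, dist (f t) (hwi.toL1 w) = D t := fun t => by
    rw [dist_eq_norm, hf, toL1_dist]; rfl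
  have hA := (hinit.comp tendsto_two_mul_nhdsGT).const_mul 2
  rw [mul_zero] at hA
  obtain ⟨U, hU1, hU2, hU3⟩ := exists_continuousOn_of_forward_increments hT (f := f)
    (x₀ := hwi.toL1 w) hA (by
      intro t ht P hP
      have hloc : LocallyIntegrable fun h => D (t + h) := locallyIntegrable_of_abs_le
        ((measurable_l1dist L hu.measurable hwm).comp (measurable_const_add t))
        fun h => l1dist_le hL.le hu.bound (fun z => hwR _) _
      obtain ⟨h, hh, hPh, hle⟩ := exists_le_mean hloc ht hP
      refine ⟨h, hh, hPh, ?_⟩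
      rw [hfw]
      refine hle.trans ?_
      -- The mean of D over (t, 2t) is at most twice its mean over (0, 2t).
      have e : ∫ s in Ioo 0 t, D (t + s) ≤ ∫ s in Ioo 0 (2 * t), D s := by
        have hDi : ∀ a b : ℝ, IntervalIntegrable D volume a b := fun a b =>
          LocallyIntegrable.intervalIntegrable' hDloc a b
        rw [← integral_Ioc_eq_integral_Ioo, ← integral_Ioc_eq_integral_Ioo,
          ← intervalIntegral.integral_of_le ht.le,
          ← intervalIntegral.integral_of_le (by linarith : (0 : ℝ) ≤ 2 * t),
          ← intervalIntegral.integral_add_adjacent_intervals (hDi 0 t) (hDi t (2 * t)),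
          intervalIntegral.integral_comp_add_left, add_zero, ← two_mul]
        linarith [intervalIntegral.integral_nonneg (μ := volume) ht.le fun s _ => hD0 s]
      simp only [Function.comp]
      calc t⁻¹ * ∫ s in Ioo 0 t, D (t + s) ≤ t⁻¹ * ∫ s in Ioo 0 (2 * t), D s := by gcongr
        _ = _ := by field_simp) (by
      intro ε hε
      have hμ : Tendsto (fun h : ℝ => 2 * ((2 * h)⁻¹ * ∫ s in Ioo 0 (2 * h), D s)
          + K * ((∫ t, |(Ioo 0 T).indicator b0 (t + h) - (Ioo 0 T).indicator b0 t|)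
          + ∫ t, |(Ioo 0 T).indicator bL (t + h) - (Ioo 0 T).indicator bL t|))
          (𝓝[>] 0) (𝓝 0) := by
        have h1 := (tendsto_integral_translation
          (hb0.integrable_indicator measurableSet_Ioo)).mono_left
          (nhdsWithin_le_nhds (s := Ioi 0))
        have h2 := (tendsto_integral_translation
          (hbL.integrable_indicator measurableSet_Ioo)).mono_left
          (nhdsWithin_le_nhds (s := Ioi 0))
        have h3 := hA.add ((h1.add h2).const_mul (K : ℝ))
        rw [add_zero, mul_zero, add_zero] at h3
        exact h3
      obtain ⟨δ, hδ, H⟩ := eventually_small_of_tendsto hμ hε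
      refine ⟨δ, hδ, ?_⟩
      have hm : Measurable fun p : ℝ × ℝ => ∫ x in Icc 0 L, |u (p.2 + p.1, x) - u (p.2, x)| := by
        have h1 : Measurable fun q : (ℝ × ℝ) × ℝ => |u (q.1.2 + q.1.1, q.2) - u (q.1.2, q.2)| :=
          measurable_abs_sub (hu.measurable.comp (by fun_prop)) (hu.measurable.comp (by fun_prop))
        exact (h1.stronglyMeasurable.integral_prod_right
          (ν := volume.restrict (Icc 0 L))).measurable
      have hset : MeasurableSet {p : ℝ × ℝ | 0 < p.1 → p.1 < δ → p.1 ≤ p.2 → p.2 + p.1 < T →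
          dist (f (p.2 + p.1)) (f p.2) ≤ ε} := by
        simp only [hfd]
        refine MeasurableSet.imp (measurableSet_lt measurable_const measurable_fst) ?_
        refine MeasurableSet.imp (measurableSet_lt measurable_fst measurable_const) ?_
        refine MeasurableSet.imp (measurableSet_le measurable_fst measurable_snd) ?_
        refine MeasurableSet.imp (measurableSet_lt (by fun_prop) measurable_const) ?_
        exact measurableSet_le hm measurable_const
      -- The increment estimate holds for every h and almost every t, with a null set depending on
      -- h. Fubini, which needs the measurability just shown, exchanges the two quantifiers.
      refine (Measure.ae_ae_comm hset).1 (Eventually.of_forall fun h => ?_)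
      by_cases hh : 0 < h ∧ h < δ
      · filter_upwards [hu.ae_increment_le hL hg hb0 hbL hw hwR hh.1] with t ht _ _ h3 h4
        rw [hfd]
        exact (ht h3 h4).trans (H h hh.1 hh.2)
      · exact Eventually.of_forall fun t h1 h2 => absurd ⟨h1, h2⟩ hh)
  refine ⟨U, hU1, hU2, ?_⟩
  rw [hU3]
  exact hwi.coeFn_toL1

end

end SegmentIBVP

end

noncomputable section

namespace SegmentIBVP

/-! ### Consequences of the entropy inequalities -/

/-- The entropy balance for the entropy `p` and the entropy flux `v q` on `[0,T] × [0,L]`. -/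
def entBalance (T L M : ℝ) (v uo uT b0 bL : ℝ → ℝ) (u : ℝ × ℝ → ℝ) (p q : ℝ → ℝ)
    (φ : ℝ × ℝ → ℝ) : ℝ :=
  (∫ z in Icc 0 T ×ˢ Icc 0 L,
      (p (u z) * fderiv ℝ φ z (1, 0) + v z.1 * q (u z) * fderiv ℝ φ z (0, 1)))
    + (∫ x in Icc 0 L, p (uo x) * φ (0, x))
    - (∫ x in Icc 0 L, p (uT x) * φ (T, x))
    + M * ∫ t in Icc 0 T, (p (b0 t) * φ (t, 0) + p (bL t) * φ (t, L))

/-- Nonnegativity of the entropy balance for all nonnegative compactly supported tests. -/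
def EntIneq (T L M : ℝ) (v uo uT b0 bL : ℝ → ℝ) (u : ℝ × ℝ → ℝ) (p q : ℝ → ℝ) : Prop :=
  ∀ φ : ℝ × ℝ → ℝ, ContDiff ℝ 1 φ → HasCompactSupport φ → (∀ z, 0 ≤ φ z) →
    0 ≤ entBalance T L M v uo uT b0 bL u p q φ

section

variable {T L M R : ℝ} {v uo uT b0 bL : ℝ → ℝ} {u : ℝ × ℝ → ℝ} {p q : ℝ → ℝ}

/-- Compactness of the support of the test function is not needed. -/
theorem EntIneq.nonneg (h : EntIneq T L M v uo uT b0 bL u p q) (hT : 0 ≤ T) (hL : 0 ≤ L)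
    {φ : ℝ × ℝ → ℝ} (hφ : ContDiff ℝ 1 φ) (hφ0 : ∀ z, 0 ≤ φ z) :
    0 ≤ entBalance T L M v uo uT b0 bL u p q φ := by
  -- The inner ball is a neighbourhood of the rectangle in the sup norm, so multiplication by B
  -- changes neither the test nor its derivative there.
  let B : ContDiffBump (0 : ℝ × ℝ) := ⟨T + L + 1, T + L + 2, by linarith, by linarith⟩
  have hball : ∀ z ∈ Icc 0 T ×ˢ Icc 0 L, z ∈ Metric.ball (0 : ℝ × ℝ) (T + L + 1) := by
    intro z hz
    rw [Metric.mem_ball, dist_zero_right, Prod.norm_def, max_lt_iff, Real.norm_eq_abs,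
      Real.norm_eq_abs, abs_of_nonneg hz.1.1, abs_of_nonneg hz.2.1]
    exact ⟨by linarith [hz.1.2], by linarith [hz.2.2]⟩
  have hone : ∀ z ∈ Icc 0 T ×ˢ Icc 0 L, φ z * B z = φ z := fun z hz => by
    rw [B.one_of_mem_closedBall (Metric.ball_subset_closedBall (hball z hz)), mul_one]
  have hder : ∀ z ∈ Icc 0 T ×ˢ Icc 0 L, fderiv ℝ (fun z => φ z * B z) z = fderiv ℝ φ z := by
    intro z hz
    refine Filter.EventuallyEq.fderiv_eq ?_
    filter_upwards [Metric.isOpen_ball.mem_nhds (hball z hz)] with y hy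
    rw [B.one_of_mem_closedBall (Metric.ball_subset_closedBall hy), mul_one]
  have h0 : (0 : ℝ) ∈ Icc 0 T := ⟨le_rfl, hT⟩
  have hTT : T ∈ Icc 0 T := ⟨hT, le_rfl⟩
  have hL0 : (0 : ℝ) ∈ Icc 0 L := ⟨le_rfl, hL⟩
  have hLL : L ∈ Icc 0 L := ⟨hL, le_rfl⟩
  have := h (fun z => φ z * B z) (hφ.mul B.contDiff) (B.hasCompactSupport.mul_left)
    (fun z => mul_nonneg (hφ0 z) B.nonneg)
  have e : entBalance T L M v uo uT b0 bL u p q (fun z => φ z * B z)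
      = entBalance T L M v uo uT b0 bL u p q φ := by
    unfold entBalance
    congr 1
    · congr 1
      · congr 1
        · refine setIntegral_congr_fun (measurableSet_Icc.prod measurableSet_Icc) fun z hz => ?_
          simp only [hder z hz]
        · refine setIntegral_congr_fun measurableSet_Icc fun x hx => ?_
          simp only [hone (0, x) ⟨h0, hx⟩]
      · refine setIntegral_congr_fun measurableSet_Icc fun x hx => ?_
        simp only [hone (T, x) ⟨hTT, hx⟩]
    · congr 1
      refine setIntegral_congr_fun measurableSet_Icc fun t ht => ?_
      simp only [hone (t, 0) ⟨ht, hL0⟩, hone (t, L) ⟨ht, hLL⟩]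
  rwa [e] at this

/-- The entropy balance for a product test function. -/
theorem EntIneq.tensor (h : EntIneq T L M (fun _ => 1) uo uT b0 bL u p q) (hT : 0 ≤ T)
    (hL : 0 ≤ L) {θ θ' ζ ζ' : ℝ → ℝ} (hθ : ContDiff ℝ 1 θ) (hζ : ContDiff ℝ 1 ζ)
    (hθ' : ∀ t, HasDerivAt θ (θ' t) t) (hζ' : ∀ t, HasDerivAt ζ (ζ' t) t)
    (hθ0 : ∀ t, 0 ≤ θ t) (hζ0 : ∀ x, 0 ≤ ζ x) :
    0 ≤ (∫ z in Icc 0 T ×ˢ Icc 0 L, (p (u z) * (θ' z.1 * ζ z.2) + q (u z) * (θ z.1 * ζ' z.2)))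
      + θ 0 * (∫ x in Icc 0 L, p (uo x) * ζ x) - θ T * (∫ x in Icc 0 L, p (uT x) * ζ x)
      + M * ∫ t in Icc 0 T, (p (b0 t) * (θ t * ζ 0) + p (bL t) * (θ t * ζ L)) := by
  have := h.nonneg hT hL (contDiff_tensor hθ hζ) fun z => mul_nonneg (hθ0 _) (hζ0 _)
  unfold entBalance at this
  simp only [fun z : ℝ × ℝ => (fderiv_tensor (hθ' z.1) (hζ' z.2)).1,
    fun z : ℝ × ℝ => (fderiv_tensor (hθ' z.1) (hζ' z.2)).2, one_mul] at this
  convert this using 4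
  · rw [← integral_const_mul]
    refine integral_congr_ae (Eventually.of_forall fun x => ?_)
    simp only []
    ring
  · rw [← integral_const_mul]
    refine integral_congr_ae (Eventually.of_forall fun x => ?_)
    simp only []
    ring

/-- If a nonnegative entropy vanishes on the data, then it vanishes on the solution. -/
theorem EntIneq.range (h : EntIneq T L M v uo uT b0 bL u p q) (hT : 0 ≤ T) (hL : 0 ≤ L)
    (hp0 : ∀ s, 0 ≤ p s) (hpu : IntegrableOn (fun z => p (u z)) (Icc 0 T ×ˢ Icc 0 L))
    (hpT : IntegrableOn (fun x => p (uT x)) (Icc 0 L))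
    (huo : ∀ᵐ x ∂volume.restrict (Icc 0 L), p (uo x) = 0)
    (hb0 : ∀ᵐ t ∂volume.restrict (Icc 0 T), p (b0 t) = 0)
    (hbL : ∀ᵐ t ∂volume.restrict (Icc 0 T), p (bL t) = 0) :
    (∀ᵐ z ∂volume.restrict (Icc 0 T ×ˢ Icc 0 L), p (u z) = 0) ∧
      ∀ᵐ x ∂volume.restrict (Icc 0 L), p (uT x) = 0 := by
  -- A test independent of x removes the flux, and its decay in t makes the interior term
  -- nonpositive, like the final one. With vanishing data, both must be zero.
  have hexp : ContDiff ℝ 1 fun t : ℝ => Real.exp (-t) := by fun_prop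
  have hexpd : ∀ t : ℝ, HasDerivAt (fun t : ℝ => Real.exp (-t)) (-Real.exp (-t)) t := fun t => by
    simpa using (hasDerivAt_neg t).exp
  have key := h.nonneg hT hL (contDiff_tensor hexp (contDiff_const (c := (1 : ℝ))))
    fun z => mul_nonneg (Real.exp_pos _).le zero_le_one
  unfold entBalance at key
  simp only [fun z : ℝ × ℝ => (fderiv_tensor (hexpd z.1) (hasDerivAt_const z.2 (1 : ℝ))).1,
    fun z : ℝ × ℝ => (fderiv_tensor (hexpd z.1) (hasDerivAt_const z.2 (1 : ℝ))).2] at key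
  have z1 : ∫ x in Icc 0 L, p (uo x) * (Real.exp (-0) * 1) = 0 := by
    refine integral_eq_zero_of_ae ?_
    filter_upwards [huo] with x hx
    simp [hx]
  have z2 : ∫ t in Icc 0 T, (p (b0 t) * (Real.exp (-t) * 1) + p (bL t) * (Real.exp (-t) * 1))
      = 0 := by
    refine integral_eq_zero_of_ae ?_
    filter_upwards [hb0, hbL] with t h1 h2
    simp [h1, h2]
  rw [z1, z2] at key
  have e : ∫ z in Icc 0 T ×ˢ Icc 0 L, (p (u z) * (-Real.exp (-z.1) * 1)
      + v z.1 * q (u z) * (Real.exp (-z.1) * 0))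
      = -∫ z in Icc 0 T ×ˢ Icc 0 L, p (u z) * Real.exp (-z.1) := by
    rw [← integral_neg]
    refine integral_congr_ae (Eventually.of_forall fun z => ?_)
    simp
  rw [e] at key
  have n1 : 0 ≤ ∫ z in Icc 0 T ×ˢ Icc 0 L, p (u z) * Real.exp (-z.1) :=
    integral_nonneg fun z => mul_nonneg (hp0 _) (Real.exp_pos _).le
  have n2 : 0 ≤ ∫ x in Icc 0 L, p (uT x) * (Real.exp (-T) * 1) :=
    integral_nonneg fun z => mul_nonneg (hp0 _) (by positivity)
  have i1 : IntegrableOn (fun z => p (u z) * Real.exp (-z.1)) (Icc 0 T ×ˢ Icc 0 L) := by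
    refine IntegrableOn.mul_continuousOn hpu ?_ (isCompact_Icc.prod isCompact_Icc)
    exact Continuous.continuousOn (by fun_prop)
  have i2 : IntegrableOn (fun x => p (uT x) * (Real.exp (-T) * 1)) (Icc 0 L) :=
    Integrable.mul_const hpT _
  constructor
  · have : ∫ z in Icc 0 T ×ˢ Icc 0 L, p (u z) * Real.exp (-z.1) = 0 := by linarith
    rw [integral_eq_zero_iff_of_nonneg (fun z => mul_nonneg (hp0 _) (Real.exp_pos _).le) i1]
      at this
    filter_upwards [this] with z hz
    exact (mul_eq_zero.1 hz).resolve_right (Real.exp_pos _).ne'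
  · have : ∫ x in Icc 0 L, p (uT x) * (Real.exp (-T) * 1) = 0 := by linarith
    rw [integral_eq_zero_iff_of_nonneg (fun z => mul_nonneg (hp0 _) (by positivity)) i2] at this
    filter_upwards [this] with z hz
    exact (mul_eq_zero.1 hz).resolve_right (by positivity)

/-- Reflection of the segment. -/
theorem EntIneq.reflect (h : EntIneq T L M v uo uT b0 bL u p q) :
    EntIneq T L M v (fun x => uo (L - x)) (fun x => uT (L - x)) bL b0 (fun z => u (z.1, L - z.2))
      p (fun s => -q s) := by
  intro φ hφ hφc hφ0
  have hrefl : ∀ f : ℝ → ℝ, ∫ x in Icc 0 L, f (L - x) = ∫ x in Icc 0 L, f x := by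
    intro f
    have := (Measure.measurePreserving_sub_left (volume : Measure ℝ) L).setIntegral_preimage_emb
      (Homeomorph.subLeft L).measurableEmbedding f (Icc 0 L)
    rw [← this]
    simp
  have hrefl2 : ∀ f : ℝ × ℝ → ℝ, ∫ z in Icc 0 T ×ˢ Icc 0 L, f (z.1, L - z.2)
      = ∫ z in Icc 0 T ×ˢ Icc 0 L, f z := by
    intro f
    have hmp : MeasurePreserving (fun z : ℝ × ℝ => (z.1, L - z.2)) volume volume :=
      (MeasurePreserving.id volume).prod (Measure.measurePreserving_sub_left (volume : Measure ℝ) L)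
    have := hmp.setIntegral_preimage_emb
      ((Homeomorph.refl ℝ).prodCongr (Homeomorph.subLeft L)).measurableEmbedding f
      (Icc 0 T ×ˢ Icc 0 L)
    rw [← this]
    congr 2
    ext z
    simp only [mem_prod, mem_Icc, mem_preimage]
    constructor <;> rintro ⟨h1, h2, h3⟩ <;> exact ⟨h1, by linarith, by linarith⟩
  have hd : ∀ z : ℝ × ℝ, ∀ a b : ℝ, fderiv ℝ (fun z : ℝ × ℝ => φ (z.1, L - z.2)) z (a, b)
      = fderiv ℝ φ (z.1, L - z.2) (a, -b) := by
    intro z a b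
    have h1 : HasFDerivAt φ (fderiv ℝ φ (z.1, L - z.2)) (z.1, L - z.2) :=
      (hφ.differentiable (by simp) _).hasFDerivAt
    have h2 : HasFDerivAt (fun z : ℝ × ℝ => (z.1, L - z.2)) _ z :=
      HasFDerivAt.prodMk (hasFDerivAt_fst (𝕜 := ℝ))
        ((hasFDerivAt_snd (𝕜 := ℝ) (E := ℝ) (F := ℝ) (p := z)).const_sub L)
    have h3 : HasFDerivAt (fun z : ℝ × ℝ => φ (z.1, L - z.2)) _ z := h1.comp z h2
    rw [h3.fderiv]
    simp
  have key := h (fun z => φ (z.1, L - z.2)) (hφ.comp (by fun_prop))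
    (hφc.comp_homeomorph ((Homeomorph.refl ℝ).prodCongr (Homeomorph.subLeft L)))
    fun z => hφ0 _
  unfold entBalance at key ⊢
  rw [← hrefl2, ← hrefl fun x => p (uo x) * φ (0, L - x), ← hrefl fun x => p (uT x) * φ (T, L - x)]
    at key
  simp only [hd, sub_sub_cancel, sub_zero, sub_self, neg_zero] at key
  convert key using 3
  · congr 1
    refine integral_congr_ae (Eventually.of_forall fun z => ?_)
    have e : fderiv ℝ φ z (0, -1) = -fderiv ℝ φ z (0, 1) := by
      rw [← map_neg]; simp
    simp only [e, Prod.mk.eta]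
    ring
  · refine integral_congr_ae (Eventually.of_forall fun t => ?_)
    simp only []
    ring

end

end SegmentIBVP

end

/-! ### The autonomous problem and Kruzhkov's inequality at all levels -/

noncomputable section

namespace SegmentIBVP

/-- A solution of the autonomous problem with flux `g`, with values in `[α,β]`. -/
structure AutSol (T L M α β : ℝ) (g uo uT b0 bL : ℝ → ℝ) (u : ℝ × ℝ → ℝ) : Prop where
  meas : Measurable u
  meas_init : Measurable uo
  meas_final : Measurable uT
  meas_left : Measurable b0
  meas_right : Measurable bL
  range : ∀ z, u z ∈ Icc α β
  range_init : ∀ x, uo x ∈ Icc α β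
  range_final : ∀ x, uT x ∈ Icc α β
  range_left : ∀ t, b0 t ∈ Icc α β
  range_right : ∀ t, bL t ∈ Icc α β
  pos : ∀ k ∈ Icc α β, EntIneq T L M (fun _ => 1) uo uT b0 bL u (fun s => max (s - k) 0)
    (fun s => g (max s k) - g k)
  neg : ∀ k ∈ Icc α β, EntIneq T L M (fun _ => 1) uo uT b0 bL u (fun s => max (k - s) 0)
    (fun s => g k - g (min s k))
  trace_left : ∀ᵐ t : ℝ, t ∈ Ioo 0 T → ∃ w, HasTrace (fun x => u (t, x)) w
  trace_right : ∀ᵐ t : ℝ, t ∈ Ioo 0 T → ∃ w, HasTrace (fun x => u (t, L - x)) w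

theorem exists_abs_le_of_continuous {p : ℝ → ℝ} (hp : Continuous p) (α β : ℝ) :
    ∃ C, 0 ≤ C ∧ ∀ s ∈ Icc α β, |p s| ≤ C := by
  obtain ⟨C, hC⟩ := (isCompact_Icc (a := α) (b := β)).exists_bound_of_continuousOn hp.continuousOn
  exact ⟨max C 0, le_max_right _ _, fun s hs => (hC s hs).trans (le_max_left _ _)⟩

theorem integrableOn_comp_mul {X : Type*} [MeasurableSpace X] [TopologicalSpace X]
    [OpensMeasurableSpace X] [SecondCountableTopology X] [TopologicalSpace.PseudoMetrizableSpace X]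
    [T2Space X]
    {μ : Measure X} [IsLocallyFiniteMeasure μ] {p : ℝ → ℝ} (hp : Continuous p) {α β : ℝ}
    {w : X → ℝ} (hw : Measurable w) (hwr : ∀ x, w x ∈ Icc α β) {c : X → ℝ} (hc : Continuous c)
    {s : Set X} (hs : IsCompact s) : IntegrableOn (fun x => p (w x) * c x) s μ := by
  obtain ⟨C, -, hC⟩ := exists_abs_le_of_continuous hp α β
  exact Integrable.bdd_mul (c := C) (hc.continuousOn.integrableOn_compact hs)
    (hp.measurable.comp hw).aestronglyMeasurable (Eventually.of_forall fun x => hC _ (hwr x))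

section

variable {T L M α β : ℝ} {g uo uT b0 bL : ℝ → ℝ} {u : ℝ × ℝ → ℝ} {K : NNReal}

theorem AutSol.entIneq_add (h : AutSol T L M α β g uo uT b0 bL u) {p q p' q' : ℝ → ℝ}
    (hp : Continuous p) (hq : Continuous q) (hp' : Continuous p') (hq' : Continuous q')
    (h1 : EntIneq T L M (fun _ => 1) uo uT b0 bL u p q)
    (h2 : EntIneq T L M (fun _ => 1) uo uT b0 bL u p' q') :
    EntIneq T L M (fun _ => 1) uo uT b0 bL u (fun s => p s + p' s) (fun s => q s + q' s) := by
  intro φ hφ hφc hφ0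
  have k1 := h1 φ hφ hφc hφ0
  have k2 := h2 φ hφ hφc hφ0
  have hQ : IsCompact (Icc 0 T ×ˢ Icc 0 L) := isCompact_Icc.prod isCompact_Icc
  have cφ := hφ.continuous
  have i1 : ∀ {p q : ℝ → ℝ}, Continuous p → Continuous q → IntegrableOn (fun z =>
      p (u z) * fderiv ℝ φ z (1, 0) + q (u z) * fderiv ℝ φ z (0, 1)) (Icc 0 T ×ˢ Icc 0 L) :=
    fun hp hq => (integrableOn_comp_mul hp h.meas h.range (continuous_fderiv_dir hφ _) hQ).add
      (integrableOn_comp_mul hq h.meas h.range (continuous_fderiv_dir hφ _) hQ)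
  have i2 : ∀ {p : ℝ → ℝ}, Continuous p → IntegrableOn (fun x => p (uo x) * φ (0, x))
      (Icc 0 L) := fun hp => integrableOn_comp_mul hp h.meas_init h.range_init
        (by fun_prop) isCompact_Icc
  have i3 : ∀ {p : ℝ → ℝ}, Continuous p → IntegrableOn (fun x => p (uT x) * φ (T, x))
      (Icc 0 L) := fun hp => integrableOn_comp_mul hp h.meas_final h.range_final
        (by fun_prop) isCompact_Icc
  have i4 : ∀ {p : ℝ → ℝ}, Continuous p → IntegrableOn (fun t =>
      p (b0 t) * φ (t, 0) + p (bL t) * φ (t, L)) (Icc 0 T) := fun hp =>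
    (integrableOn_comp_mul hp h.meas_left h.range_left (by fun_prop) isCompact_Icc).add
      (integrableOn_comp_mul hp h.meas_right h.range_right (by fun_prop) isCompact_Icc)
  unfold entBalance at k1 k2 ⊢
  simp only [one_mul] at k1 k2 ⊢
  have e1 : ∫ z in Icc 0 T ×ˢ Icc 0 L, ((p (u z) + p' (u z)) * fderiv ℝ φ z (1, 0)
      + (q (u z) + q' (u z)) * fderiv ℝ φ z (0, 1))
      = (∫ z in Icc 0 T ×ˢ Icc 0 L, (p (u z) * fderiv ℝ φ z (1, 0) + q (u z) * fderiv ℝ φ z (0, 1)))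
        + ∫ z in Icc 0 T ×ˢ Icc 0 L,
          (p' (u z) * fderiv ℝ φ z (1, 0) + q' (u z) * fderiv ℝ φ z (0, 1)) := by
    rw [← integral_add (i1 hp hq) (i1 hp' hq')]
    exact integral_congr_ae (Eventually.of_forall fun z => by ring)
  have e2 : ∫ x in Icc 0 L, (p (uo x) + p' (uo x)) * φ (0, x)
      = (∫ x in Icc 0 L, p (uo x) * φ (0, x)) + ∫ x in Icc 0 L, p' (uo x) * φ (0, x) := by
    rw [← integral_add (i2 hp) (i2 hp')]
    exact integral_congr_ae (Eventually.of_forall fun z => by ring)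
  have e3 : ∫ x in Icc 0 L, (p (uT x) + p' (uT x)) * φ (T, x)
      = (∫ x in Icc 0 L, p (uT x) * φ (T, x)) + ∫ x in Icc 0 L, p' (uT x) * φ (T, x) := by
    rw [← integral_add (i3 hp) (i3 hp')]
    exact integral_congr_ae (Eventually.of_forall fun z => by ring)
  have e4 : ∫ t in Icc 0 T, ((p (b0 t) + p' (b0 t)) * φ (t, 0) + (p (bL t) + p' (bL t)) * φ (t, L))
      = (∫ t in Icc 0 T, (p (b0 t) * φ (t, 0) + p (bL t) * φ (t, L)))
        + ∫ t in Icc 0 T, (p' (b0 t) * φ (t, 0) + p' (bL t) * φ (t, L)) := by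
    rw [← integral_add (i4 hp) (i4 hp')]
    exact integral_congr_ae (Eventually.of_forall fun z => by ring)
  rw [e1, e2, e3, e4]
  linarith

theorem max_sub_add_max_sub (s k : ℝ) : max (s - k) 0 + max (k - s) 0 = |s - k| := by
  rcases le_total k s with h | h
  · rw [max_eq_left (by linarith), max_eq_right (by linarith), abs_of_nonneg (by linarith)]; ring
  · rw [max_eq_right (by linarith), max_eq_left (by linarith), abs_of_nonpos (by linarith)]; ring

/-- The full Kruzhkov inequality for levels in the range of the data. -/
theorem AutSol.entIneq_abs (h : AutSol T L M α β g uo uT b0 bL u) (hg : Continuous g) {k : ℝ}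
    (hk : k ∈ Icc α β) : EntIneq T L M (fun _ => 1) uo uT b0 bL u (fun s => |s - k|)
      (fun s => kflux g s k) := by
  have := h.entIneq_add (by fun_prop) (by fun_prop) (by fun_prop) (by fun_prop)
    (h.pos k hk) (h.neg k hk)
  simp only [max_sub_add_max_sub, sub_add_sub_cancel] at this
  exact this

theorem integral_fderiv_eq_zero {φ : ℝ × ℝ → ℝ} (hφ : ContDiff ℝ 1 φ) (hφc : HasCompactSupport φ)
    (e : ℝ × ℝ) : ∫ z, fderiv ℝ φ z e = 0 := by
  have hi := (continuous_fderiv_dir hφ e).integrable_of_hasCompactSupport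
    (hasCompactSupport_fderiv_dir hφc e) (μ := volume)
  have := integral_mul_fderiv_eq_neg_fderiv_mul_of_integrable (μ := (volume : Measure (ℝ × ℝ)))
    (f := fun _ : ℝ × ℝ => (1 : ℝ)) (g := φ) (v := e) (by simp) (by simpa using hi)
    (by simpa using hφ.continuous.integrable_of_hasCompactSupport hφc)
    (fun _ _ => by fun_prop) (fun z _ => hφ.differentiable (by simp) z)
  simpa using this

/-- The projection of k onto [α, β] lies between s and k unless it equals k, so both the distance
and the flux difference are additive across it. -/
theorem kruzkov_split {s k : ℝ} (hs : s ∈ Icc α β) :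
    |s - k| = |s - max α (min k β)| + |max α (min k β) - k| ∧
      kflux g s k = kflux g s (max α (min k β)) + kflux g (max α (min k β)) k := by
  have hαβ := hs.1.trans hs.2
  unfold kflux
  rcases le_total k α with h1 | h1
  · rw [min_eq_left (h1.trans hαβ), max_eq_left h1, max_eq_left (h1.trans hs.1),
      min_eq_right (h1.trans hs.1), max_eq_left hs.1, min_eq_right hs.1, max_eq_left h1,
      min_eq_right h1, abs_of_nonneg (by linarith [hs.1]), abs_of_nonneg (by linarith [hs.1]),
      abs_of_nonneg (by linarith)]
    constructor <;> ring
  rcases le_total k β with h2 | h2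
  · rw [min_eq_left h2, max_eq_right h1]
    simp
  · rw [min_eq_right h2, max_eq_right hαβ, max_eq_right (hs.2.trans h2),
      min_eq_left (hs.2.trans h2), max_eq_right hs.2, min_eq_left hs.2, max_eq_right h2,
      min_eq_left h2, abs_of_nonpos (by linarith [hs.2]), abs_of_nonpos (by linarith [hs.2]),
      abs_of_nonpos (by linarith)]
    constructor <;> ring

/-- Doubling needs levels taken from the other solution, possibly outside [α, β]. Replacing such a
level by its projection changes the entropy pair by constants, and constants integrate to zero
against derivatives of compactly supported tests. -/
theorem AutSol.isKruzkov (h : AutSol T L M α β g uo uT b0 bL u) (hg : Continuous g) :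
    IsKruzkov (Ioo 0 T ×ˢ Ioo 0 L) g u := by
  intro k φ hφ hφc hφ0 hφΩ
  set k₀ := max α (min k β) with hk₀
  have hαβ : α ≤ β := (h.range 0).1.trans (h.range 0).2
  have hk : k₀ ∈ Icc α β := ⟨le_max_left _ _, max_le hαβ (min_le_right _ _)⟩
  have key := h.entIneq_abs hg hk φ hφ hφc hφ0
  have hz : ∀ z, z ∉ Ioo 0 T ×ˢ Ioo 0 L → φ z = 0 := fun z hz =>
    image_eq_zero_of_notMem_tsupport fun h' => hz (hφΩ h')
  have hzd : ∀ z, z ∉ Icc 0 T ×ˢ Icc 0 L → fderiv ℝ φ z = 0 := fun z hz => by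
    refine image_eq_zero_of_notMem_tsupport fun h' => hz ?_
    exact prod_mono Ioo_subset_Icc_self Ioo_subset_Icc_self
      (hφΩ (tsupport_fderiv_subset ℝ h'))
  unfold entBalance at key
  rw [setIntegral_eq_integral_of_forall_compl_eq_zero (fun z hz' => by
    simp [hzd z hz'])] at key
  simp only [hz (0, _) (by simp), hz (T, _) (by simp), hz (_, 0) (by simp), hz (_, L) (by simp),
    mul_zero, integral_zero, add_zero, sub_zero, one_mul] at key
  have hs := fun z => kruzkov_split (g := g) (k := k) (h.range z)
  simp only [← hk₀] at hs
  have hi : ∀ e, Integrable fun z => fderiv ℝ φ z e := fun e =>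
    (continuous_fderiv_dir hφ e).integrable_of_hasCompactSupport
      (hasCompactSupport_fderiv_dir hφc e) (μ := volume)
  have hb : ∀ {p : ℝ → ℝ}, Continuous p → ∀ e, Integrable fun z => p (u z) * fderiv ℝ φ z e := by
    intro p hp e
    obtain ⟨C, -, hC⟩ := exists_abs_le_of_continuous hp α β
    exact Integrable.bdd_mul (c := C) (hi e) (hp.measurable.comp h.meas).aestronglyMeasurable
      (Eventually.of_forall fun z => hC _ (h.range z))
  have c1 : Continuous fun s : ℝ => |s - k₀| := by fun_prop
  have c2 : Continuous fun s : ℝ => kflux g s k₀ :=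
    (continuous_kflux hg).comp (continuous_id.prodMk continuous_const)
  have e : ∫ z, (|u z - k| * fderiv ℝ φ z (1, 0) + kflux g (u z) k * fderiv ℝ φ z (0, 1))
      = (∫ z, (|u z - k₀| * fderiv ℝ φ z (1, 0) + kflux g (u z) k₀ * fderiv ℝ φ z (0, 1)))
        + ((∫ z, |k₀ - k| * fderiv ℝ φ z (1, 0)) + ∫ z, kflux g k₀ k * fderiv ℝ φ z (0, 1)) := by
    have I1 : Integrable fun z => |u z - k₀| * fderiv ℝ φ z (1, 0)
        + kflux g (u z) k₀ * fderiv ℝ φ z (0, 1) := (hb c1 _).add (hb c2 _)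
    have I2 : Integrable fun z => |k₀ - k| * fderiv ℝ φ z (1, 0)
        + kflux g k₀ k * fderiv ℝ φ z (0, 1) := ((hi _).const_mul _).add ((hi _).const_mul _)
    rw [← integral_add ((hi _).const_mul _) ((hi _).const_mul _), ← integral_add I1 I2]
    refine integral_congr_ae (Eventually.of_forall fun z => ?_)
    simp only [(hs z).1, (hs z).2]
    ring
  rw [e, integral_const_mul, integral_const_mul, integral_fderiv_eq_zero hφ hφc,
    integral_fderiv_eq_zero hφ hφc]
  simpa using key

end

end SegmentIBVP

end

noncomputable section

namespace SegmentIBVP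

/-! ### The boundary condition at the traces -/

/-- A smooth boundary layer at the origin of width `2r`. -/
def layer (r x : ℝ) : ℝ := 1 - Real.smoothTransition (r⁻¹ * x - 1)

theorem hasDerivAt_layer (r x : ℝ) :
    HasDerivAt (layer r) (-(r⁻¹ * rampKernel (r⁻¹ * x - 1))) x := by
  have h1 : HasDerivAt (fun x : ℝ => r⁻¹ * x - 1) r⁻¹ x := by
    simpa using ((hasDerivAt_id x).const_mul r⁻¹).sub_const 1
  have h3 := (hasDerivAt_smoothTransition (r⁻¹ * x - 1)).comp x h1
  rw [mul_comm] at h3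
  exact h3.const_sub 1

theorem contDiff_layer (r : ℝ) : ContDiff ℝ 1 (layer r) := by
  have hR : ContDiff ℝ 1 Real.smoothTransition := Real.smoothTransition.contDiff (n := 1)
  exact contDiff_const.sub (hR.comp (by fun_prop))

theorem layer_nonneg (r x : ℝ) : 0 ≤ layer r x := sub_nonneg.2 (Real.smoothTransition.le_one _)

theorem layer_le_one (r x : ℝ) : layer r x ≤ 1 := by
  have := Real.smoothTransition.nonneg (r⁻¹ * x - 1)
  unfold layer; linarith

theorem layer_eq_zero {r x : ℝ} (hr : 0 < r) (hx : 2 * r ≤ x) : layer r x = 0 := by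
  have : 2 ≤ r⁻¹ * x := by rw [inv_mul_eq_div, le_div_iff₀ hr]; exact hx
  rw [layer, Real.smoothTransition.one_of_one_le (by linarith), sub_self]

theorem layer_zero (r : ℝ) : layer r 0 = 1 := by
  rw [layer, Real.smoothTransition.zero_of_nonpos (by simp), sub_zero]

section

variable {T L M α β : ℝ} {g uo uT b0 bL : ℝ → ℝ} {u : ℝ × ℝ → ℝ} {p q : ℝ → ℝ} {K : NNReal}

/-- The test is η(t) times a layer equal to 1 at 0 and to 0 at L. As its width tends to 0, the
time-derivative term vanishes, the flux term tends to the integral of -η q(w), and the boundary term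
keeps only the datum at 0. -/
theorem EntIneq.trace_le (h : EntIneq T L M (fun _ => 1) uo uT b0 bL u p q) (hT : 0 < T)
    (hL : 0 < L) (hum : Measurable u) (hur : ∀ z, u z ∈ Icc α β) (hbm : Measurable b0)
    (hbr : ∀ t, b0 t ∈ Icc α β) (hp : Continuous p) (hq : LipschitzWith K q)
    (htr : ∀ᵐ t : ℝ, t ∈ Ioo 0 T → ∃ w, HasTrace (fun x => u (t, x)) w) :
    ∀ᵐ t : ℝ, t ∈ Ioo 0 T → ∀ w, HasTrace (fun x => u (t, x)) w → q w ≤ M * p (b0 t) := by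
  obtain ⟨Cp, hCp0, hCp⟩ := exists_abs_le_of_continuous hp α β
  obtain ⟨Cq, hCq0, hCq⟩ := exists_abs_le_of_continuous hq.continuous α β
  have hpm : Measurable fun z => p (u z) := hp.measurable.comp hum
  have hqm : Measurable fun z => q (u z) := hq.continuous.measurable.comp hum
  have ck := continuous_rampKernel
  -- convergence of the layers
  have hlay : ∀ t w, HasTrace (fun x => u (t, x)) w → Tendsto (fun r : ℝ =>
      ∫ x, r⁻¹ * rampKernel (r⁻¹ * x - 1) * q (u (t, x))) (𝓝[>] 0) (𝓝 (q w)) := by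
    intro t w hw
    have hm : Measurable fun x => u (t, x) := hum.comp measurable_prodMk_left
    obtain ⟨C, -, hC⟩ := exists_abs_le_of_continuous continuous_id α β
    have hloc : LocallyIntegrable fun x => u (t, x) :=
      locallyIntegrable_of_abs_le hm fun x => hC _ (hur _)
    have : HasTrace (fun x => q (u (t, x))) (q w) :=
      hw.of_abs_le (C := K) hw hloc hloc fun x => by
        refine (LipschitzWith.abs_sub_le hq _ _).trans (mul_le_mul_of_nonneg_left ?_ K.2)
        linarith [abs_nonneg (u (t, x) - w)]
    exact this.tendsto_left_layer (locallyIntegrable_of_abs_le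
      (hq.continuous.measurable.comp hm) fun x => hCq _ (hur _))
  -- Defining H as a limit makes it a function of t that does not depend on any choice of the trace.
  obtain ⟨H, hH⟩ : ∃ H : ℝ → ℝ, ∀ t w, HasTrace (fun x => u (t, x)) w → H t = q w := by
    refine ⟨fun t => limUnder (𝓝[>] 0) fun r : ℝ =>
      ∫ x, r⁻¹ * rampKernel (r⁻¹ * x - 1) * q (u (t, x)), fun t w hw => ?_⟩
    exact (hlay t w hw).limUnder_eq
  obtain ⟨r, hrpos, hr0⟩ : ∃ r : ℕ → ℝ, (∀ n, 0 < r n) ∧ Tendsto r atTop (𝓝 0) :=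
    ⟨fun n => 1 / ((n : ℝ) + 1), fun n => by positivity, tendsto_one_div_add_atTop_nhds_zero_nat⟩
  have hr : Tendsto r atTop (𝓝[>] 0) :=
    tendsto_nhdsWithin_iff.2 ⟨hr0, Eventually.of_forall hrpos⟩
  have hrs : ∀ ε : ℝ, 0 < ε → ∀ᶠ n in atTop, 2 * r n ≤ ε := by
    intro ε hε
    filter_upwards [hr0.eventually_lt_const (show 0 < ε / 2 by positivity)] with n hn
    linarith
  have hκ : ∀ n, Integrable (fun x => (r n)⁻¹ * rampKernel ((r n)⁻¹ * x - 1)) ∧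
      ∫ x, (r n)⁻¹ * rampKernel ((r n)⁻¹ * x - 1) = 1 := fun n =>
    integrable_scaled_rampKernel (hrpos n) (-1)
  have hκ0 : ∀ n x, 0 ≤ (r n)⁻¹ * rampKernel ((r n)⁻¹ * x - 1) := fun n x =>
    mul_nonneg (inv_nonneg.2 (hrpos n).le) (rampKernel_nonneg _)
  set I : ℕ → ℝ → ℝ := fun n t =>
    ∫ x, (r n)⁻¹ * rampKernel ((r n)⁻¹ * x - 1) * q (u (t, x)) with hI
  have hIm : ∀ n, Measurable (I n) := by
    intro n
    have c1 : Continuous fun x => (r n)⁻¹ * rampKernel ((r n)⁻¹ * x - 1) := by fun_prop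
    have : StronglyMeasurable fun z : ℝ × ℝ =>
        (r n)⁻¹ * rampKernel ((r n)⁻¹ * z.2 - 1) * q (u z) :=
      ((c1.measurable.comp measurable_snd).mul hqm).stronglyMeasurable
    exact (this.integral_prod_right (ν := volume)).measurable
  have hIb : ∀ n t, |I n t| ≤ Cq := by
    intro n t
    have : ‖I n t‖ ≤ ∫ x, (r n)⁻¹ * rampKernel ((r n)⁻¹ * x - 1) * Cq := by
      refine norm_integral_le_of_norm_le ((hκ n).1.mul_const _) (Eventually.of_forall fun x => ?_)
      rw [norm_mul, Real.norm_eq_abs, Real.norm_eq_abs, abs_of_nonneg (hκ0 n x)]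
      exact mul_le_mul_of_nonneg_left (hCq _ (hur _)) (hκ0 n x)
    rwa [integral_mul_const, (hκ n).2, one_mul] at this
  have hlimI : ∀ᵐ t : ℝ, Tendsto (fun n => (Ioo 0 T).indicator (I n) t) atTop
      (𝓝 ((Ioo 0 T).indicator H t)) := by
    filter_upwards [htr] with t ht
    by_cases htT : t ∈ Ioo 0 T
    · obtain ⟨w, hw⟩ := ht htT
      simp only [indicator_of_mem htT, hH t w hw]
      exact (hlay t w hw).comp hr
    · simp only [indicator_of_notMem htT]
      exact tendsto_const_nhds
  have hImm : ∀ n, AEStronglyMeasurable ((Ioo 0 T).indicator (I n)) volume := fun n =>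
    ((hIm n).indicator measurableSet_Ioo).aestronglyMeasurable
  have hIbb : ∀ n t, ‖(Ioo 0 T).indicator (I n) t‖ ≤ Cq := by
    intro n t
    by_cases htT : t ∈ Ioo 0 T
    · rw [indicator_of_mem htT]; exact hIb n t
    · simpa only [indicator_of_notMem htT, norm_zero] using hCq0
  have hHm : AEStronglyMeasurable ((Ioo 0 T).indicator H) volume :=
    aestronglyMeasurable_of_tendsto_ae atTop hImm hlimI
  have hHloc : LocallyIntegrable ((Ioo 0 T).indicator H) :=
    (locallyIntegrable_const Cq).mono hHm (by
      filter_upwards [hlimI] with t ht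
      rw [Real.norm_of_nonneg hCq0]
      exact le_of_tendsto ht.norm (Eventually.of_forall fun n => hIbb n t))
  have hbloc : LocallyIntegrable fun t => M * p (b0 t) :=
    locallyIntegrable_of_abs_le (R := |M| * Cp)
      ((hp.measurable.comp hbm).const_mul M) fun t => by
        rw [abs_mul]; exact mul_le_mul_of_nonneg_left (hCp _ (hbr t)) (abs_nonneg _)
  have main := ae_nonneg_of_forall_test (hbloc.sub hHloc) (a := 0) (b := T) (by
    intro η hη hηc hη0 hηT
    have hηd : ∀ t, HasDerivAt η (deriv η t) t := fun t =>
      (hη.differentiable (by simp) t).hasDerivAt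
    have hηdc : Continuous (deriv η) := hη.continuous_deriv (by simp)
    have hηi : Integrable η := hη.continuous.integrable_of_hasCompactSupport hηc
    have hηout : ∀ t, t ∉ Ioo 0 T → η t = 0 := fun t ht =>
      image_eq_zero_of_notMem_tsupport fun h => ht (hηT h)
    have hQ : IsCompact (Icc 0 T ×ˢ Icc 0 L) := isCompact_Icc.prod isCompact_Icc
    have lim1 : Tendsto (fun n => ∫ z in Icc 0 T ×ˢ Icc 0 L,
        p (u z) * (deriv η z.1 * layer (r n) z.2)) atTop (𝓝 0) := by
      have hdom : IntegrableOn (fun z : ℝ × ℝ => Cp * |deriv η z.1|) (Icc 0 T ×ˢ Icc 0 L) :=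
        (Continuous.continuousOn (by fun_prop)).integrableOn_compact hQ
      rw [show 𝓝 (0 : ℝ) = 𝓝 (∫ _ in Icc (0 : ℝ) T ×ˢ Icc (0 : ℝ) L, (0 : ℝ)) by
        rw [integral_zero]]
      refine tendsto_integral_of_dominated_convergence (fun z : ℝ × ℝ => Cp * |deriv η z.1|)
        ?_ hdom ?_ ?_
      · intro n
        have c2 := (contDiff_layer (r n)).continuous
        exact hpm.aestronglyMeasurable.mul (Continuous.aestronglyMeasurable (by fun_prop))
      · refine fun n => Eventually.of_forall fun z => ?_
        rw [norm_mul, norm_mul, Real.norm_eq_abs, Real.norm_eq_abs, Real.norm_eq_abs,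
          abs_of_nonneg (layer_nonneg _ _)]
        exact mul_le_mul (hCp _ (hur z)) (mul_le_of_le_one_right (abs_nonneg _)
          (layer_le_one _ _)) (mul_nonneg (abs_nonneg _) (layer_nonneg _ _)) hCp0
      · have hne : ∀ᵐ z : ℝ × ℝ, z.2 ≠ 0 :=
          Measure.quasiMeasurePreserving_snd.ae (Measure.ae_ne volume (0 : ℝ))
        filter_upwards [ae_restrict_mem (measurableSet_Icc.prod measurableSet_Icc),
          ae_restrict_of_ae hne] with z hz hz0
        have hz2 : 0 < z.2 := lt_of_le_of_ne hz.2.1 (Ne.symm hz0)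
        refine tendsto_const_nhds.congr' ?_
        filter_upwards [hrs _ hz2] with n hn
        rw [layer_eq_zero (hrpos n) hn, mul_zero, mul_zero]
    have lim2 : Tendsto (fun n => ∫ t, η t * (Ioo 0 T).indicator (I n) t) atTop
        (𝓝 (∫ t, η t * (Ioo 0 T).indicator H t)) := by
      refine tendsto_integral_of_dominated_convergence (fun t => |η t| * Cq) ?_
        (hηi.abs.mul_const _) ?_ ?_
      · exact fun n => hη.continuous.aestronglyMeasurable.mul (hImm n)
      · refine fun n => Eventually.of_forall fun t => ?_
        rw [norm_mul]
        exact mul_le_mul_of_nonneg_left (hIbb n t) (norm_nonneg _)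
      · filter_upwards [hlimI] with t ht
        exact ht.const_mul _
    have hineq : ∀ᶠ n in atTop, 0 ≤ (∫ z in Icc 0 T ×ˢ Icc 0 L,
        p (u z) * (deriv η z.1 * layer (r n) z.2)) - (∫ t, η t * (Ioo 0 T).indicator (I n) t)
        + ∫ t, η t * (M * p (b0 t)) := by
      filter_upwards [hrs L hL] with n hn
      have key := h.tensor hT.le hL.le hη (contDiff_layer (r n)) hηd (hasDerivAt_layer (r n))
        hη0 (layer_nonneg (r n))
      rw [hηout 0 (by simp), hηout T (by simp), zero_mul, zero_mul, add_zero, sub_zero,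
        layer_zero, layer_eq_zero (hrpos n) hn] at key
      simp only [mul_one, mul_zero, add_zero] at key
      have e1 : M * ∫ t in Icc 0 T, p (b0 t) * η t = ∫ t, η t * (M * p (b0 t)) := by
        rw [setIntegral_eq_integral_of_forall_compl_eq_zero (fun t ht => by
          rw [hηout t fun h' => ht (Ioo_subset_Icc_self h'), mul_zero]), ← integral_const_mul]
        exact integral_congr_ae (Eventually.of_forall fun t => by ring)
      have c2 := (contDiff_layer (r n)).continuous
      have j1 : IntegrableOn (fun z : ℝ × ℝ => p (u z) * (deriv η z.1 * layer (r n) z.2))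
          (Icc 0 T ×ˢ Icc 0 L) := integrableOn_comp_mul hp hum hur (by fun_prop) hQ
      have j2 : Integrable fun z : ℝ × ℝ => q (u z) * (η z.1
          * -((r n)⁻¹ * rampKernel ((r n)⁻¹ * z.2 - 1))) :=
        Integrable.bdd_mul (c := Cq) (hηi.mul_prod (hκ n).1.neg) hqm.aestronglyMeasurable
          (Eventually.of_forall fun z => hCq _ (hur z))
      have e2 : ∫ z in Icc 0 T ×ˢ Icc 0 L, q (u z) * (η z.1
          * -((r n)⁻¹ * rampKernel ((r n)⁻¹ * z.2 - 1)))
          = -∫ t, η t * (Ioo 0 T).indicator (I n) t := by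
        rw [setIntegral_eq_integral_of_forall_compl_eq_zero (fun z hz => ?_)]
        · have : ∫ z : ℝ × ℝ, q (u z) * (η z.1 * -((r n)⁻¹ * rampKernel ((r n)⁻¹ * z.2 - 1)))
              = ∫ t, ∫ x, q (u (t, x)) * (η t * -((r n)⁻¹ * rampKernel ((r n)⁻¹ * x - 1))) :=
            integral_prod _ j2
          rw [this, ← integral_neg]
          refine integral_congr_ae (Eventually.of_forall fun t => ?_)
          by_cases htT : t ∈ Ioo 0 T
          · simp only [indicator_of_mem htT, hI]
            rw [← integral_const_mul, ← integral_neg]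
            exact integral_congr_ae (Eventually.of_forall fun x => by ring)
          · simp [hηout t htT]
        · by_cases hz1 : z.1 ∈ Ioo 0 T
          · have : rampKernel ((r n)⁻¹ * z.2 - 1) = 0 := by
              have hz2 : z.2 ∉ Icc 0 L := fun h' => hz ⟨Ioo_subset_Icc_self hz1, h'⟩
              by_cases h0 : z.2 < 0
              · refine rampKernel_of_nonpos ?_
                have := mul_nonpos_of_nonneg_of_nonpos (inv_nonneg.2 (hrpos n).le) h0.le
                linarith
              · refine rampKernel_of_one_le ?_
                have h3 : L < z.2 := by
                  by_contra h'
                  exact hz2 ⟨not_lt.1 h0, not_lt.1 h'⟩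
                have : 2 ≤ (r n)⁻¹ * z.2 := by
                  rw [inv_mul_eq_div, le_div_iff₀ (hrpos n)]; linarith
                linarith
            simp [this]
          · simp [hηout _ hz1]
      rw [integral_add j1 j2.integrableOn, e2, e1] at key
      linarith
    have hfin := ge_of_tendsto ((lim1.sub lim2).add_const _) hineq
    have e3 : ∫ t, η t * ((fun t => M * p (b0 t)) - (Ioo 0 T).indicator H) t
        = (∫ t, η t * (M * p (b0 t))) - ∫ t, η t * (Ioo 0 T).indicator H t := by
      rw [← integral_sub]
      · exact integral_congr_ae (Eventually.of_forall fun t => by simp only [Pi.sub_apply]; ring)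
      · simpa [smul_eq_mul] using
          hbloc.integrable_smul_left_of_hasCompactSupport hη.continuous hηc
      · simpa [smul_eq_mul] using
          hHloc.integrable_smul_left_of_hasCompactSupport hη.continuous hηc
    rw [e3]
    linarith)
  filter_upwards [main] with t ht htT w hw
  have := ht htT
  rw [Pi.sub_apply, indicator_of_mem htT, hH t w hw] at this
  linarith

/-- A trace of a function with values in `[α,β]` lies in `[α,β]`. -/
theorem HasTrace.mem_Icc {p : ℝ → ℝ} {w : ℝ} (h : HasTrace p w) (hp : Measurable p)
    (hr : ∀ x, p x ∈ Icc α β) : w ∈ Icc α β := by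
  obtain ⟨C, -, hC⟩ := exists_abs_le_of_continuous continuous_id α β
  have hloc := locallyIntegrable_of_abs_le (μ := volume) hp fun x => hC _ (hr x)
  have hαβ := (hr 0).1.trans (hr 0).2
  -- The distance from w to its projection is at most the distance from w to any value of p, hence
  -- at most the means that tend to 0.
  have hle : |max α (min w β) - w| ≤ 0 := by
    refine ge_of_tendsto h ?_
    filter_upwards [self_mem_nhdsWithin] with r hr0
    have hr' : (0 : ℝ) < r := hr0
    have h1 : ∫ _ in (0 : ℝ)..r, |max α (min w β) - w| ≤ ∫ x in (0 : ℝ)..r, |p x - w| := by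
      refine intervalIntegral.integral_mono_on hr'.le (by simp)
        ((LocallyIntegrable.intervalIntegrable' hloc 0 r).sub intervalIntegrable_const).abs
        fun x _ => ?_
      have := (kruzkov_split (g := id) (k := w) (hr x)).1
      rw [this]
      linarith [abs_nonneg (p x - max α (min w β))]
    rw [intervalIntegral.integral_const, sub_zero, smul_eq_mul] at h1
    rw [inv_mul_eq_div, le_div_iff₀ hr', mul_comm]
    exact h1
  have : max α (min w β) = w := by
    have := abs_nonpos_iff.1 hle
    linarith
  rw [← this]
  exact ⟨le_max_left _ _, max_le hαβ (min_le_right _ _)⟩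

theorem lipschitzWith_sub_const {f : ℝ → ℝ} (hf : LipschitzWith K f) (c : ℝ) :
    LipschitzWith K fun s => f s - c :=
  LipschitzWith.of_dist_le_mul fun x y => by
    rw [dist_sub_right]; exact hf.dist_le_mul x y

theorem lipschitzWith_neg {f : ℝ → ℝ} (hf : LipschitzWith K f) :
    LipschitzWith K fun s => -f s :=
  LipschitzWith.of_dist_le_mul fun x y => by
    rw [dist_neg_neg]; exact hf.dist_le_mul x y

/-- The boundary condition follows from the semi-entropy inequalities at one end point. -/
theorem ae_boundaryAdmissible (hT : 0 < T) (hL : 0 < L) (hg : LipschitzWith K g)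
    (hum : Measurable u) (hur : ∀ z, u z ∈ Icc α β) (hbm : Measurable b0)
    (hbr : ∀ t, b0 t ∈ Icc α β)
    (hpos : ∀ k ∈ Icc α β, EntIneq T L M (fun _ => 1) uo uT b0 bL u (fun s => max (s - k) 0)
      (fun s => g (max s k) - g k))
    (hneg : ∀ k ∈ Icc α β, EntIneq T L M (fun _ => 1) uo uT b0 bL u (fun s => max (k - s) 0)
      (fun s => g k - g (min s k)))
    (htr : ∀ᵐ t : ℝ, t ∈ Ioo 0 T → ∃ w, HasTrace (fun x => u (t, x)) w) :
    ∀ᵐ t : ℝ, t ∈ Ioo 0 T → ∃ w, HasTrace (fun x => u (t, x)) w ∧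
      BoundaryAdmissible g w (b0 t) := by
  have hαβ := (hur 0).1.trans (hur 0).2
  have : Nonempty (Icc α β) := ⟨⟨α, le_rfl, hαβ⟩⟩
  have hg1 := hg.continuous
  -- The exceptional null set depends on the level; a countable dense set of levels gives a single
  -- null set, and continuity in k recovers all the others.
  have a1 : ∀ᵐ t : ℝ, ∀ n : ℕ, t ∈ Ioo 0 T → ∀ w, HasTrace (fun x => u (t, x)) w →
      g (max w (TopologicalSpace.denseSeq (Icc α β) n))
        - g (TopologicalSpace.denseSeq (Icc α β) n)
        ≤ M * max (b0 t - TopologicalSpace.denseSeq (Icc α β) n) 0 := by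
    refine ae_all_iff.2 fun n => ?_
    have hl : LipschitzWith K fun s : ℝ => g (max s (TopologicalSpace.denseSeq (Icc α β) n))
        - g (TopologicalSpace.denseSeq (Icc α β) n) := by
      refine lipschitzWith_sub_const ?_ _
      simpa [Function.comp_def] using
        hg.comp (LipschitzWith.id.max_const (TopologicalSpace.denseSeq (Icc α β) n : ℝ))
    exact (hpos _ (TopologicalSpace.denseSeq (Icc α β) n).2).trace_le hT hL hum hur hbm hbr
      (by fun_prop) hl htr
  have a2 : ∀ᵐ t : ℝ, ∀ n : ℕ, t ∈ Ioo 0 T → ∀ w, HasTrace (fun x => u (t, x)) w →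
      g (TopologicalSpace.denseSeq (Icc α β) n)
        - g (min w (TopologicalSpace.denseSeq (Icc α β) n))
        ≤ M * max (TopologicalSpace.denseSeq (Icc α β) n - b0 t) 0 := by
    refine ae_all_iff.2 fun n => ?_
    have hl : LipschitzWith K fun s : ℝ => g (TopologicalSpace.denseSeq (Icc α β) n)
        - g (min s (TopologicalSpace.denseSeq (Icc α β) n)) := by
      have : LipschitzWith K fun s : ℝ => g (min s (TopologicalSpace.denseSeq (Icc α β) n)) := by
        simpa [Function.comp_def] using hg.comp
          (LipschitzWith.id.min_const (TopologicalSpace.denseSeq (Icc α β) n : ℝ))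
      have h2 := lipschitzWith_neg
        (lipschitzWith_sub_const this (g (TopologicalSpace.denseSeq (Icc α β) n)))
      simpa only [neg_sub] using h2
    exact (hneg _ (TopologicalSpace.denseSeq (Icc α β) n).2).trace_le hT hL hum hur hbm hbr
      (by fun_prop) hl htr
  filter_upwards [htr, a1, a2] with t ht b1 b2 htT
  obtain ⟨w, hw⟩ := ht htT
  have hwr := hw.mem_Icc (hum.comp measurable_prodMk_left) fun x => hur _
  have c1 : ∀ k : Icc α β, g (max w k) - g k ≤ M * max (b0 t - k) 0 := fun k =>
    (TopologicalSpace.denseRange_denseSeq (Icc α β)).induction_on k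
      (isClosed_le (by fun_prop) (by fun_prop)) fun n => b1 n htT w hw
  have c2 : ∀ k : Icc α β, g k - g (min w k) ≤ M * max (k - b0 t) 0 := fun k =>
    (TopologicalSpace.denseRange_denseSeq (Icc α β)).induction_on k
      (isClosed_le (by fun_prop) (by fun_prop)) fun n => b2 n htT w hw
  -- For k between the datum and the trace, the semi-entropy vanishes at the datum, so the size of M
  -- is irrelevant.
  refine ⟨w, hw, fun k hk => ?_, fun k hk => ?_⟩
  · have := c1 ⟨k, (hbr t).1.trans hk.1, hk.2.trans hwr.2⟩
    simp only [max_eq_left hk.2, max_eq_right (sub_nonpos.2 hk.1), mul_zero] at this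
    linarith
  · have := c2 ⟨k, hwr.1.trans hk.1, hk.2.trans (hbr t).2⟩
    simp only [min_eq_left hk.1, max_eq_right (sub_nonpos.2 hk.2), mul_zero] at this
    linarith

theorem AutSol.interiorSol (h : AutSol T L M α β g uo uT b0 bL u) (hT : 0 < T) (hL : 0 < L)
    (hg : LipschitzWith K g) {R : ℝ} (hR : ∀ s ∈ Icc α β, |s| ≤ R) :
    InteriorSol T L g b0 bL R u where
  measurable := h.meas
  bound := fun z => hR _ (h.range z)
  kruzkov := h.isKruzkov hg.continuous
  left := ae_boundaryAdmissible hT hL hg h.meas h.range h.meas_left h.range_left h.pos h.neg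
    h.trace_left
  right := by
    -- The reflected solution has flux -g and exchanged boundary data, so its left end is the
    -- original right end.
    refine ae_boundaryAdmissible (M := M) (uo := fun x => uo (L - x))
      (uT := fun x => uT (L - x)) (bL := b0) hT hL (lipschitzWith_neg hg)
      (u := fun z : ℝ × ℝ => u (z.1, L - z.2)) (h.meas.comp (by fun_prop)) (fun z => h.range _)
      h.meas_right h.range_right (fun k hk => ?_) (fun k hk => ?_) h.trace_right
    · have := (h.pos k hk).reflect
      simpa only [neg_sub, neg_sub_neg] using this
    · have := (h.neg k hk).reflect
      simpa only [neg_sub, neg_sub_neg] using this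

end

end SegmentIBVP

end

noncomputable section

namespace SegmentIBVP

/-! ### The initial datum -/

/-- Mollified oscillation. -/
def oscMean (w : ℝ → ℝ) (n : ℕ) (x : ℝ) : ℝ :=
  ∫ y, (bumpSeq ℝ n).normed volume (y - x) * |w y - w x|

section

variable {w : ℝ → ℝ} {R : ℝ}

theorem integrable_bump_sub (n : ℕ) (x : ℝ) :
    Integrable fun y => (bumpSeq ℝ n).normed volume (y - x) :=
  (((bumpSeq ℝ n).contDiff_normed (n := 0)).continuous.integrable_of_hasCompactSupport
    (bumpSeq ℝ n).hasCompactSupport_normed).comp_sub_right x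

theorem integral_bump_sub (n : ℕ) (x : ℝ) :
    ∫ y, (bumpSeq ℝ n).normed volume (y - x) = 1 := by
  rw [integral_sub_right_eq_self (fun y => (bumpSeq ℝ n).normed volume y) x]
  exact (bumpSeq ℝ n).integral_normed

theorem integrable_bump_mul {f : ℝ → ℝ} (hf : Measurable f) {C : ℝ} (hC : ∀ x, |f x| ≤ C) (n : ℕ)
    (x : ℝ) : Integrable fun y => (bumpSeq ℝ n).normed volume (y - x) * f y :=
  (integrable_bump_sub n x).mul_bdd (c := C) hf.aestronglyMeasurable (Eventually.of_forall hC)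

/-- All radii are at most 2, which is why levels uo(y) with y in [-2, L + 2] suffice for points of
[0, L]. -/
theorem bump_sub_eq_zero (n : ℕ) {x y : ℝ} (h : 2 < |y - x|) :
    (bumpSeq ℝ n).normed volume (y - x) = 0 := by
  by_contra hne
  have hm : y - x ∈ Function.support ((bumpSeq ℝ n).normed volume) := hne
  rw [(bumpSeq ℝ n).support_normed_eq, Metric.mem_ball, dist_zero_right, Real.norm_eq_abs] at hm
  have : (bumpSeq ℝ n).rOut ≤ 2 := by
    change 2 * (1 / ((n : ℝ) + 1)) ≤ 2
    have : 1 / ((n : ℝ) + 1) ≤ 1 := by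
      rw [div_le_one (by positivity)]
      linarith [n.cast_nonneg (α := ℝ)]
    linarith
  linarith

theorem measurable_oscMean (hw : Measurable w) (n : ℕ) : Measurable (oscMean w n) := by
  have hc : Continuous ((bumpSeq ℝ n).normed volume) :=
    ((bumpSeq ℝ n).contDiff_normed (n := 0)).continuous
  have h : Measurable fun z : ℝ × ℝ => (bumpSeq ℝ n).normed volume (z.2 - z.1) * |w z.2 - w z.1| :=
    (hc.measurable.comp (by fun_prop)).mul
      (measurable_abs_sub (hw.comp measurable_snd) (hw.comp measurable_fst))
  exact (h.stronglyMeasurable.integral_prod_right (ν := volume)).measurable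

theorem oscMean_nonneg (w : ℝ → ℝ) (n : ℕ) (x : ℝ) : 0 ≤ oscMean w n x :=
  integral_nonneg fun _ => mul_nonneg (ContDiffBump.nonneg_normed _ _) (abs_nonneg _)

theorem integrable_oscMean_integrand (hw : Measurable w) (hR : ∀ x, |w x| ≤ R) (n : ℕ) (x : ℝ) :
    Integrable fun y => (bumpSeq ℝ n).normed volume (y - x) * |w y - w x| :=
  integrable_bump_mul (C := 2 * R) (measurable_abs_sub hw measurable_const) (fun y => by
    rw [abs_abs]; exact abs_sub_le_two_mul (hR _) (hR _)) n x

theorem oscMean_le (hR : ∀ x, |w x| ≤ R) (n : ℕ) (x : ℝ) : |oscMean w n x| ≤ 2 * R := by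
  have : ‖oscMean w n x‖ ≤ ∫ y, (bumpSeq ℝ n).normed volume (y - x) * (2 * R) := by
    refine norm_integral_le_of_norm_le ((integrable_bump_sub n x).mul_const _)
      (Eventually.of_forall fun y => ?_)
    rw [norm_mul, Real.norm_eq_abs, Real.norm_eq_abs, abs_abs,
      abs_of_nonneg (ContDiffBump.nonneg_normed _ _)]
    exact mul_le_mul_of_nonneg_left (abs_sub_le_two_mul (hR _) (hR _))
      (ContDiffBump.nonneg_normed _ _)
  rwa [integral_mul_const, integral_bump_sub, one_mul] at this

theorem integrableOn_oscMean (hw : Measurable w) (hR : ∀ x, |w x| ≤ R) (n : ℕ) (L : ℝ) :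
    IntegrableOn (oscMean w n) (Icc 0 L) :=
  (locallyIntegrable_of_abs_le (measurable_oscMean hw n) (oscMean_le hR n)).integrableOn_isCompact
    isCompact_Icc

theorem tendsto_integral_oscMean (hw : Measurable w) (hR : ∀ x, |w x| ≤ R) (L : ℝ) :
    Tendsto (fun n => ∫ x in Icc 0 L, oscMean w n x) atTop (𝓝 0) := by
  rw [show 𝓝 (0 : ℝ) = 𝓝 (∫ _ in Icc (0 : ℝ) L, (0 : ℝ)) by rw [integral_zero]]
  refine tendsto_integral_of_dominated_convergence (fun _ => 2 * R) ?_ (integrable_const _) ?_ ?_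
  · exact fun n => (measurable_oscMean hw n).aestronglyMeasurable
  · exact fun n => Eventually.of_forall fun x => oscMean_le hR n x
  · exact ae_restrict_of_ae
      (ae_tendsto_mollified_osc volume (locallyIntegrable_of_abs_le hw hR))

end

theorem hasDerivAt_exp_decay (ε t : ℝ) :
    HasDerivAt (fun t => Real.exp (-(ε⁻¹ * t))) (-(ε⁻¹ * Real.exp (-(ε⁻¹ * t)))) t := by
  have h1 : HasDerivAt (fun t : ℝ => -(ε⁻¹ * t)) (-(ε⁻¹ * 1)) t :=
    ((hasDerivAt_id t).const_mul ε⁻¹).neg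
  exact h1.exp.congr_deriv (by ring)

theorem integral_exp_decay_le {T : ℝ} (hT : 0 ≤ T) (ε : ℝ) :
    ∫ t in Icc 0 T, ε⁻¹ * Real.exp (-(ε⁻¹ * t)) ≤ 1 := by
  rw [integral_Icc_eq_integral_Ioc, ← intervalIntegral.integral_of_le hT]
  have hd : ∀ t ∈ uIcc 0 T, HasDerivAt (fun t => -Real.exp (-(ε⁻¹ * t)))
      (ε⁻¹ * Real.exp (-(ε⁻¹ * t))) t :=
    fun t _ => (hasDerivAt_exp_decay ε t).neg.congr_deriv (neg_neg _)
  rw [intervalIntegral.integral_eq_sub_of_hasDerivAt hd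
    (Continuous.intervalIntegrable (by fun_prop) _ _)]
  have := Real.exp_pos (-(ε⁻¹ * T))
  simp only [mul_zero, neg_zero, Real.exp_zero]
  linarith

section

variable {T L M α β R : ℝ} {g uo uT b0 bL : ℝ → ℝ} {u : ℝ × ℝ → ℝ} {K : NNReal}

theorem integrableOn_bdd_mul_continuous {X : Type*} [MeasurableSpace X] [TopologicalSpace X]
    [OpensMeasurableSpace X] [T2Space X]
    {μ : Measure X} [IsLocallyFiniteMeasure μ] {A c : X → ℝ} {C : ℝ} (hA : Measurable A)
    (hC : ∀ x, |A x| ≤ C) (hc : Continuous c) {s : Set X} (hs : IsCompact s) :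
    IntegrableOn (fun x => A x * c x) s μ :=
  Integrable.bdd_mul (c := C) (hc.continuousOn.integrableOn_compact hs)
    hA.aestronglyMeasurable (Eventually.of_forall hC)

/-- The entropy inequality at the level `uo y`, for a test function concentrated at time `0` and
at the point `y`. -/
theorem AutSol.initial_inequality (h : AutSol T L M α β g uo uT b0 bL u) (hT : 0 < T) (hL : 0 < L)
    (hg : Continuous g) {θ θ' ζ ζ' : ℝ → ℝ} (hθ : ContDiff ℝ 1 θ) (hζ : ContDiff ℝ 1 ζ)
    (hθ' : ∀ t, HasDerivAt θ (θ' t) t) (hζ' : ∀ t, HasDerivAt ζ (ζ' t) t)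
    (hθ0 : ∀ t, 0 ≤ θ t) (hζ0 : ∀ x, 0 ≤ ζ x) (hz0 : ζ 0 = 0) (hzL : ζ L = 0) (hθ1 : θ 0 = 1)
    (y : ℝ) :
    0 ≤ (∫ z in Icc 0 T ×ˢ Icc 0 L, (|u z - uo y| * (θ' z.1 * ζ z.2)
        + kflux g (u z) (uo y) * (θ z.1 * ζ' z.2)))
      + ∫ x in Icc 0 L, |uo x - uo y| * ζ x := by
  have key := (h.entIneq_abs hg (h.range_init y)).tensor hT.le hL.le hθ hζ hθ' hζ' hθ0 hζ0
  rw [hz0, hzL, hθ1, one_mul] at key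
  simp only [mul_zero, add_zero, integral_zero] at key
  have : 0 ≤ θ T * ∫ x in Icc 0 L, |uT x - uo y| * ζ x :=
    mul_nonneg (hθ0 _) (integral_nonneg fun x => mul_nonneg (abs_nonneg _) (hζ0 _))
  linarith

/-- The level uo(y) is used with the test exp(-t/ε) ψ(x) ρ(y - x), ψ being the cut-off and ρ the
bump, and the result is integrated in y. Replacing uo(y) by uo(x) costs one mean oscillation of uo
in the time-derivative term; the initial term is bounded by another, whence the factor 2. The flux
term has no factor 1/ε, so it contributes O(ε), with a constant depending on n and r but not on ε.
-/
theorem AutSol.initial_estimate (h : AutSol T L M α β g uo uT b0 bL u) (hT : 0 < T) (hL : 0 < L)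
    (hg : LipschitzWith K g) (hR : ∀ s ∈ Icc α β, |s| ≤ R) (n : ℕ) {r : ℝ} (hr : 0 < r)
    (hrL : 3 * r ≤ L) : ∃ C, ∀ ε, 0 < ε →
      ∫ z in Icc 0 T ×ˢ Icc 0 L, ε⁻¹ * Real.exp (-(ε⁻¹ * z.1))
        * (cutoff L r z.2 * |u z - uo z.2|)
      ≤ 2 * (∫ x in Icc 0 L, oscMean uo n x) + C * ε := by
  have huR : ∀ z, |u z| ≤ R := fun z => hR _ (h.range z)
  have hoR : ∀ x, |uo x| ≤ R := fun x => hR _ (h.range_init x)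
  have hR0 : 0 ≤ R := (abs_nonneg _).trans (hoR 0)
  set ρ := (bumpSeq ℝ n).normed volume with hρ
  have hρ1 : ContDiff ℝ 1 ρ := (bumpSeq ℝ n).contDiff_normed
  have hρ0 : ∀ x, 0 ≤ ρ x := fun x => ContDiffBump.nonneg_normed _ _
  have cρ := hρ1.continuous
  have cρ' : Continuous (deriv ρ) := hρ1.continuous_deriv (by simp)
  have cψ := (contDiff_cutoff L r).continuous
  have cψ' : Continuous (cutoffDeriv L r) := by
    have := continuous_rampKernel
    unfold cutoffDeriv; fun_prop
  have hψ0 := cutoff_nonneg hr hrL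
  -- the spatial test functions and their derivatives
  set ζ' : ℝ → ℝ → ℝ := fun y x => cutoffDeriv L r x * ρ (y - x) - cutoff L r x * deriv ρ (y - x)
    with hζ'
  have hζd : ∀ y x, HasDerivAt (fun x => cutoff L r x * ρ (y - x)) (ζ' y x) x := by
    intro y x
    have h1 : HasDerivAt ρ (deriv ρ (y - x)) (y - x) :=
      (hρ1.differentiable (by simp) _).hasDerivAt
    have h2 : HasDerivAt (fun x => ρ (y - x)) (-deriv ρ (y - x)) x :=
      (h1.comp x ((hasDerivAt_id' x).const_sub y)).congr_deriv (by ring)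
    have := (hasDerivAt_cutoff L r x).mul h2
    refine this.congr_deriv ?_
    simp only [hζ']
    ring
  have hQ : IsCompact (Icc (0 : ℝ) T ×ˢ Icc (0 : ℝ) L) := isCompact_Icc.prod isCompact_Icc
  have hY : IsCompact (Icc (-2 : ℝ) (L + 2)) := isCompact_Icc
  obtain ⟨C₁, hC₁⟩ := (hY.prod (isCompact_Icc (a := (0 : ℝ)) (b := L))).exists_bound_of_continuousOn
    (f := fun q : ℝ × ℝ => ζ' q.1 q.2) (Continuous.continuousOn (by simp only [hζ']; fun_prop))
  have hC₁0 : 0 ≤ C₁ := (norm_nonneg _).trans (hC₁ (0, 0) ⟨⟨by norm_num, by linarith⟩, le_rfl, hL.le⟩)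
  -- The factors bound the flux, the derivative of the spatial test, the length of the interval of
  -- levels and the length of the segment.
  refine ⟨K * (2 * R) * C₁ * (L + 4) * L, fun ε hε => ?_⟩
  set θ : ℝ → ℝ := fun t => Real.exp (-(ε⁻¹ * t)) with hθ
  have hθd : ∀ t, HasDerivAt θ (-(ε⁻¹ * θ t)) t := hasDerivAt_exp_decay ε
  have hθ1 : ContDiff ℝ 1 θ := by simp only [hθ]; fun_prop
  have cθ := hθ1.continuous
  have hθ0 : ∀ t, 0 ≤ θ t := fun t => (Real.exp_pos _).le
  have hy : ∀ y, 0 ≤ (∫ z in Icc 0 T ×ˢ Icc 0 L,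
      (|u z - uo y| * (-(ε⁻¹ * θ z.1) * (cutoff L r z.2 * ρ (y - z.2)))
        + kflux g (u z) (uo y) * (θ z.1 * ζ' y z.2)))
      + ∫ x in Icc 0 L, |uo x - uo y| * (cutoff L r x * ρ (y - x)) := by
    intro y
    refine h.initial_inequality hT hL hg.continuous (θ := θ) (θ' := fun t => -(ε⁻¹ * θ t))
      (ζ := fun x => cutoff L r x * ρ (y - x)) (ζ' := ζ' y) hθ1
      ((contDiff_cutoff L r).mul (hρ1.comp (contDiff_const.sub contDiff_id))) hθd (hζd y) hθ0
      (fun x => mul_nonneg (hψ0 x) (hρ0 _)) ?_ ?_ (by simp [hθ]) y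
    · simp [cutoff_eq_zero hr hrL (x := 0) fun h => by linarith [h.1]]
    · simp [cutoff_eq_zero hr hrL (x := L) fun h => by linarith [h.2]]
  -- integration in the level
  have m1 : Measurable fun q : ℝ × (ℝ × ℝ) => |u q.2 - uo q.1| :=
    measurable_abs_sub (h.meas.comp measurable_snd) (h.meas_init.comp measurable_fst)
  have m2 : Measurable fun q : ℝ × (ℝ × ℝ) => kflux g (u q.2) (uo q.1) :=
    (continuous_kflux hg.continuous).measurable.comp
      ((h.meas.comp measurable_snd).prodMk (h.meas_init.comp measurable_fst))
  have m3 : Measurable fun q : ℝ × ℝ => |uo q.2 - uo q.1| :=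
    measurable_abs_sub (h.meas_init.comp measurable_snd) (h.meas_init.comp measurable_fst)
  have hkf : ∀ z y, |kflux g (u z) (uo y)| ≤ K * (2 * R) := fun z y =>
    (abs_kflux_le hg _ _).trans (mul_le_mul_of_nonneg_left
      (abs_sub_le_two_mul (huR _) (hoR _)) K.2)
  have iΦ : IntegrableOn (fun q : ℝ × (ℝ × ℝ) =>
      |u q.2 - uo q.1| * (-(ε⁻¹ * θ q.2.1) * (cutoff L r q.2.2 * ρ (q.1 - q.2.2)))
        + kflux g (u q.2) (uo q.1) * (θ q.2.1 * ζ' q.1 q.2.2))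
      (Icc (-2) (L + 2) ×ˢ (Icc 0 T ×ˢ Icc 0 L)) := by
    refine Integrable.add ?_ ?_
    · exact integrableOn_bdd_mul_continuous m1 (C := 2 * R) (fun q => by
        rw [abs_abs]; exact abs_sub_le_two_mul (huR _) (hoR _)) (by fun_prop) (hY.prod hQ)
    · exact integrableOn_bdd_mul_continuous m2 (fun q => hkf _ _)
        (by simp only [hζ']; fun_prop) (hY.prod hQ)
  have iΘ : IntegrableOn (fun q : ℝ × ℝ =>
      |uo q.2 - uo q.1| * (cutoff L r q.2 * ρ (q.1 - q.2))) (Icc (-2) (L + 2) ×ˢ Icc 0 L) :=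
    integrableOn_bdd_mul_continuous m3 (C := 2 * R) (fun q => by
      rw [abs_abs]; exact abs_sub_le_two_mul (hoR _) (hoR _)) (by fun_prop)
      (hY.prod isCompact_Icc)
  have iΦ' := iΦ
  have iΘ' := iΘ
  rw [IntegrableOn, Measure.volume_eq_prod, ← Measure.prod_restrict] at iΦ' iΘ'
  have hint := integral_nonneg (μ := volume.restrict (Icc (-2) (L + 2))) (Pi.le_def.2 hy)
  rw [integral_add iΦ'.integral_prod_left iΘ'.integral_prod_left,
    integral_integral_swap (by exact iΦ'), integral_integral_swap
      (f := fun y x => |uo x - uo y| * (cutoff L r x * ρ (y - x))) (by exact iΘ')] at hint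
  -- the terms at a fixed point
  have hYsub : ∀ x ∈ Icc 0 L, ∀ f : ℝ → ℝ,
      ∫ y in Icc (-2) (L + 2), ρ (y - x) * f y = ∫ y, ρ (y - x) * f y := by
    intro x hx f
    refine setIntegral_eq_integral_of_forall_compl_eq_zero fun y hy => ?_
    rw [hρ, bump_sub_eq_zero n, zero_mul]
    by_contra hle
    rw [not_lt, abs_le] at hle
    exact hy ⟨by linarith [hx.1], by linarith [hx.2]⟩
  have bΘ : ∀ x ∈ Icc 0 L, ∫ y in Icc (-2) (L + 2), |uo x - uo y| * (cutoff L r x * ρ (y - x))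
      ≤ oscMean uo n x := by
    intro x hx
    have e : ∫ y in Icc (-2) (L + 2), |uo x - uo y| * (cutoff L r x * ρ (y - x))
        = cutoff L r x * ∫ y in Icc (-2) (L + 2), ρ (y - x) * |uo y - uo x| := by
      rw [← integral_const_mul]
      refine integral_congr_ae (Eventually.of_forall fun y => ?_)
      simp only [abs_sub_comm (uo x)]
      ring
    rw [e, hYsub x hx]
    exact mul_le_of_le_one_left (oscMean_nonneg _ _ _) (cutoff_le_one _ _ _)
  -- The flux error is written with a spurious factor ε⁻¹ ε, so that every term carries the weight
  -- ε⁻¹ exp(-t/ε), whose mass on [0, T] is at most one.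
  have bΦ : ∀ z ∈ Icc 0 T ×ˢ Icc 0 L, ∫ y in Icc (-2) (L + 2),
      (|u z - uo y| * (-(ε⁻¹ * θ z.1) * (cutoff L r z.2 * ρ (y - z.2)))
        + kflux g (u z) (uo y) * (θ z.1 * ζ' y z.2))
      ≤ -(ε⁻¹ * θ z.1 * (cutoff L r z.2 * |u z - uo z.2|)) + ε⁻¹ * θ z.1 * oscMean uo n z.2
        + ε⁻¹ * θ z.1 * (K * (2 * R) * C₁ * (L + 4) * ε) := by
    intro z hz
    have mA : Measurable fun y => |u z - uo y| := measurable_abs_sub measurable_const h.meas_init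
    have mB : Measurable fun y => kflux g (u z) (uo y) :=
      (continuous_kflux hg.continuous).measurable.comp (measurable_const.prodMk h.meas_init)
    have j1 : IntegrableOn (fun y =>
        |u z - uo y| * (-(ε⁻¹ * θ z.1) * (cutoff L r z.2 * ρ (y - z.2)))) (Icc (-2) (L + 2)) :=
      integrableOn_bdd_mul_continuous mA (C := 2 * R) (fun q => by
        rw [abs_abs]; exact abs_sub_le_two_mul (huR _) (hoR _)) (by fun_prop) hY
    have j2 : IntegrableOn (fun y => kflux g (u z) (uo y) * (θ z.1 * ζ' y z.2))
        (Icc (-2) (L + 2)) :=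
      integrableOn_bdd_mul_continuous mB (fun q => hkf _ _) (by simp only [hζ']; fun_prop) hY
    rw [integral_add j1 j2]
    have hε' : 0 ≤ ε⁻¹ := inv_nonneg.2 hε.le
    have e1 : ∫ y in Icc (-2) (L + 2),
        |u z - uo y| * (-(ε⁻¹ * θ z.1) * (cutoff L r z.2 * ρ (y - z.2)))
        = -(ε⁻¹ * θ z.1 * (cutoff L r z.2 * ∫ y, ρ (y - z.2) * |u z - uo y|)) := by
      rw [← hYsub z.2 hz.2, ← integral_const_mul, ← integral_const_mul, ← integral_neg]
      exact integral_congr_ae (Eventually.of_forall fun y => by ring)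
    have e2 : |u z - uo z.2| - oscMean uo n z.2 ≤ ∫ y, ρ (y - z.2) * |u z - uo y| := by
      have e3 : |u z - uo z.2| = ∫ y, ρ (y - z.2) * |u z - uo z.2| := by
        rw [integral_mul_const, hρ, integral_bump_sub, one_mul]
      have i3 : Integrable fun y => ρ (y - z.2) * |u z - uo z.2| :=
        (integrable_bump_sub n z.2).mul_const _
      have i4 : Integrable fun y => ρ (y - z.2) * |uo y - uo z.2| :=
        integrable_oscMean_integrand h.meas_init hoR n z.2
      have i5 : Integrable fun y => ρ (y - z.2) * |u z - uo y| :=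
        integrable_bump_mul (C := 2 * R) mA (fun y => by
          rw [abs_abs]; exact abs_sub_le_two_mul (huR _) (hoR _)) n z.2
      rw [e3, oscMean, ← integral_sub i3 i4]
      refine integral_mono (i3.sub i4) i5 fun y => ?_
      have := mul_le_mul_of_nonneg_left (abs_sub_le (u z) (uo y) (uo z.2)) (hρ0 (y - z.2))
      simp only []
      linarith
    have e4 : ∫ y in Icc (-2) (L + 2), kflux g (u z) (uo y) * (θ z.1 * ζ' y z.2)
        ≤ θ z.1 * (K * (2 * R) * C₁ * (L + 4)) := by
      have hvol : volume.real (Icc (-2) (L + 2)) = L + 4 := by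
        rw [Measure.real, Real.volume_Icc, ENNReal.toReal_ofReal (by linarith)]; ring
      have := norm_setIntegral_le_of_norm_le_const (μ := volume) (s := Icc (-2) (L + 2))
        (f := fun y => kflux g (u z) (uo y) * (θ z.1 * ζ' y z.2))
        (C := K * (2 * R) * (θ z.1 * C₁)) (by simp) (fun y hy => by
          rw [norm_mul, norm_mul, Real.norm_eq_abs, Real.norm_eq_abs, abs_of_nonneg (hθ0 _)]
          exact mul_le_mul (hkf _ _) (mul_le_mul_of_nonneg_left (hC₁ (y, z.2) ⟨hy, hz.2⟩) (hθ0 _))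
            (mul_nonneg (hθ0 _) (norm_nonneg _)) (by positivity))
      rw [hvol] at this
      refine (le_abs_self _).trans (this.trans (le_of_eq (by ring)))
    have e5 : ε⁻¹ * θ z.1 * (K * (2 * R) * C₁ * (L + 4) * ε)
        = θ z.1 * (K * (2 * R) * C₁ * (L + 4)) := by field_simp
    rw [e1, e5]
    have a0 : 0 ≤ ε⁻¹ * θ z.1 := mul_nonneg hε' (hθ0 _)
    have a1 := mul_le_mul_of_nonneg_left e2 (hψ0 z.2)
    have a2 := mul_le_of_le_one_left (oscMean_nonneg uo n z.2) (cutoff_le_one L r z.2)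
    have a3 : cutoff L r z.2 * |u z - uo z.2| - oscMean uo n z.2
        ≤ cutoff L r z.2 * ∫ y, ρ (y - z.2) * |u z - uo y| := by
      rw [mul_sub] at a1; linarith
    have a4 := mul_le_mul_of_nonneg_left a3 a0
    rw [mul_sub] at a4
    linarith
  -- conclusion
  have mD : Measurable fun z : ℝ × ℝ => |u z - uo z.2| :=
    measurable_abs_sub h.meas (h.meas_init.comp measurable_snd)
  have k1 : IntegrableOn (fun z : ℝ × ℝ => ε⁻¹ * θ z.1 * (cutoff L r z.2 * |u z - uo z.2|))
      (Icc 0 T ×ˢ Icc 0 L) := by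
    have := integrableOn_bdd_mul_continuous (μ := volume) mD (C := 2 * R) (fun q => by
      rw [abs_abs]; exact abs_sub_le_two_mul (huR _) (hoR _))
      (c := fun z : ℝ × ℝ => ε⁻¹ * θ z.1 * cutoff L r z.2) (by fun_prop) hQ
    exact this.congr (Eventually.of_forall fun z => by ring)
  have k2 : IntegrableOn (fun z : ℝ × ℝ => ε⁻¹ * θ z.1 * oscMean uo n z.2)
      (Icc 0 T ×ˢ Icc 0 L) := by
    have := integrableOn_bdd_mul_continuous (μ := volume)
      ((measurable_oscMean h.meas_init n).comp (measurable_snd (α := ℝ)))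
      (fun z => oscMean_le hoR n z.2) (c := fun z : ℝ × ℝ => ε⁻¹ * θ z.1) (by fun_prop) hQ
    exact this.congr (Eventually.of_forall fun z => by simp only [Function.comp]; ring)
  have k3 : IntegrableOn (fun z : ℝ × ℝ => ε⁻¹ * θ z.1 * (K * (2 * R) * C₁ * (L + 4) * ε))
      (Icc 0 T ×ˢ Icc 0 L) := (Continuous.continuousOn (by fun_prop)).integrableOn_compact hQ
  have b1 := setIntegral_mono_on (μ := volume) (by exact iΦ'.integral_prod_right) ((k1.neg.add k2).add k3)
    (measurableSet_Icc.prod measurableSet_Icc) bΦ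
  have b2 := setIntegral_mono_on (μ := volume) iΘ'.integral_prod_right
    (integrableOn_oscMean h.meas_init hoR n L) measurableSet_Icc bΘ
  have e6 : ∫ z in Icc 0 T ×ˢ Icc 0 L, (-(ε⁻¹ * θ z.1 * (cutoff L r z.2 * |u z - uo z.2|))
        + ε⁻¹ * θ z.1 * oscMean uo n z.2 + ε⁻¹ * θ z.1 * (K * (2 * R) * C₁ * (L + 4) * ε))
      = -(∫ z in Icc 0 T ×ˢ Icc 0 L, ε⁻¹ * θ z.1 * (cutoff L r z.2 * |u z - uo z.2|))
        + (∫ z in Icc 0 T ×ˢ Icc 0 L, ε⁻¹ * θ z.1 * oscMean uo n z.2)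
        + ∫ z in Icc 0 T ×ˢ Icc 0 L, ε⁻¹ * θ z.1 * (K * (2 * R) * C₁ * (L + 4) * ε) := by
    rw [← integral_neg]
    exact (integral_add (k1.neg.add k2) k3).trans (congrArg (· + _) (integral_add k1.neg k2))
  have hexp := integral_exp_decay_le hT.le ε
  have e7 : ∫ z in Icc 0 T ×ˢ Icc 0 L, ε⁻¹ * θ z.1 * oscMean uo n z.2
      ≤ ∫ x in Icc 0 L, oscMean uo n x := by
    have := setIntegral_prod_mul (μ := volume) (ν := volume) (fun t => ε⁻¹ * θ t)
      (oscMean uo n) (Icc 0 T) (Icc 0 L)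
    rw [← Measure.volume_eq_prod] at this
    rw [this]
    exact mul_le_of_le_one_left (integral_nonneg fun x => oscMean_nonneg _ _ _) hexp
  have e8 : ∫ z in Icc 0 T ×ˢ Icc 0 L, ε⁻¹ * θ z.1 * (K * (2 * R) * C₁ * (L + 4) * ε)
      ≤ K * (2 * R) * C₁ * (L + 4) * L * ε := by
    have := setIntegral_prod_mul (μ := volume) (ν := volume) (fun t => ε⁻¹ * θ t)
      (fun _ => K * (2 * R) * C₁ * (L + 4) * ε) (Icc 0 T) (Icc 0 L)
    rw [← Measure.volume_eq_prod] at this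
    rw [this, setIntegral_const, Real.volume_real_Icc_of_le hL.le, smul_eq_mul]
    refine (mul_le_of_le_one_left (by positivity) hexp).trans (le_of_eq (by ring))
  replace b1 := b1.trans_eq e6
  linarith

/-- The cut-off differs from 1 only on two end strips of width 2r, where the integrand is at most
2R. -/
theorem l1dist_le_cutoff {u' : ℝ × ℝ → ℝ} (hu : Measurable u) (hu' : Measurable u')
    (hR : ∀ z, |u z| ≤ R) (hR' : ∀ z, |u' z| ≤ R) {r : ℝ} (hr : 0 < r) (hrL : 3 * r ≤ L) (t : ℝ) :
    l1dist L u u' t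
      ≤ (∫ x in Icc 0 L, cutoff L r x * |u (t, x) - u' (t, x)|) + 8 * R * r := by
  have hR0 : 0 ≤ R := (abs_nonneg _).trans (hR 0)
  have i0 := integrableOn_abs_sub L hu hu' hR hR' t
  have i1 : IntegrableOn (fun x => cutoff L r x * |u (t, x) - u' (t, x)|) (Icc 0 L) :=
    i0.bdd_mul (c := 1) (contDiff_cutoff L r).continuous.aestronglyMeasurable
      (Eventually.of_forall fun x => by
        rw [Real.norm_eq_abs, abs_of_nonneg (cutoff_nonneg hr hrL x)]
        exact cutoff_le_one _ _ _)
  have hind : ∀ a b : ℝ, a ≤ b → IntegrableOn ((Icc a b).indicator fun _ => 2 * R) (Icc 0 L) ∧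
      ∫ x in Icc 0 L, (Icc a b).indicator (fun _ => 2 * R) x ≤ (b - a) * (2 * R) := by
    intro a b hab
    have hi : Integrable ((Icc a b).indicator fun _ : ℝ => 2 * R) :=
      (integrable_indicator_iff measurableSet_Icc).2 (integrable_const _)
    refine ⟨hi.integrableOn, ?_⟩
    refine (setIntegral_le_integral hi (Eventually.of_forall fun x =>
      indicator_nonneg (fun _ _ => by positivity) x)).trans_eq ?_
    rw [integral_indicator measurableSet_Icc, setIntegral_const, Real.volume_real_Icc_of_le hab,
      smul_eq_mul]
  obtain ⟨j1, k1⟩ := hind 0 (2 * r) (by linarith)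
  obtain ⟨j2, k2⟩ := hind (L - 2 * r) L (by linarith)
  have hm : l1dist L u u' t ≤ ∫ x in Icc 0 L, (cutoff L r x * |u (t, x) - u' (t, x)|
      + ((Icc 0 (2 * r)).indicator (fun _ => 2 * R) x
        + (Icc (L - 2 * r) L).indicator (fun _ => 2 * R) x)) := by
    refine setIntegral_mono_on i0 (i1.add (j1.add j2)) measurableSet_Icc fun x hx => ?_
    have n1 : 0 ≤ (Icc 0 (2 * r)).indicator (fun _ => 2 * R) x :=
      indicator_nonneg (fun _ _ => by positivity) x
    have n2 : 0 ≤ (Icc (L - 2 * r) L).indicator (fun _ => 2 * R) x :=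
      indicator_nonneg (fun _ _ => by positivity) x
    have n3 : 0 ≤ cutoff L r x * |u (t, x) - u' (t, x)| :=
      mul_nonneg (cutoff_nonneg hr hrL x) (abs_nonneg _)
    have n4 : |u (t, x) - u' (t, x)| ≤ 2 * R := abs_sub_le_two_mul (hR _) (hR' _)
    by_cases h1 : x ∈ Icc 0 (2 * r)
    · rw [indicator_of_mem h1]; linarith
    by_cases h2 : x ∈ Icc (L - 2 * r) L
    · rw [indicator_of_mem h2]; linarith
    · have a1 : 2 * r ≤ x := by by_contra hc; exact h1 ⟨hx.1, by linarith⟩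
      have a2 : x ≤ L - 2 * r := by by_contra hc; exact h2 ⟨by linarith, hx.2⟩
      rw [cutoff_eq_one hr ⟨a1, a2⟩]; linarith
  have e1 := integral_add i1 (j1.add j2)
  have e2 := integral_add j1 j2
  simp only [Pi.add_apply] at e1 e2
  rw [e1, e2] at hm
  linarith

/-- A solution takes its initial value in the mean. -/
theorem AutSol.tendsto_initial (h : AutSol T L M α β g uo uT b0 bL u) (hT : 0 < T) (hL : 0 < L)
    (hg : LipschitzWith K g) (hR : ∀ s ∈ Icc α β, |s| ≤ R) :
    Tendsto (fun ε => ε⁻¹ * ∫ s in Ioo 0 ε, l1dist L u (fun z => uo z.2) s) (𝓝[>] 0) (𝓝 0) := by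
  have huR : ∀ z, |u z| ≤ R := fun z => hR _ (h.range z)
  have hoR : ∀ x, |uo x| ≤ R := fun x => hR _ (h.range_init x)
  have hR0 : 0 ≤ R := (abs_nonneg _).trans (hoR 0)
  have mo : Measurable fun z : ℝ × ℝ => uo z.2 := h.meas_init.comp measurable_snd
  -- On (0, ε) the factor e · exp(-t/ε) is at least 1, so the plain mean is controlled by the
  -- exponentially weighted one.
  have hbound : ∀ r, 0 < r → 3 * r ≤ L → ∀ n, ∃ C, ∀ ε, 0 < ε → ε ≤ T →
      ε⁻¹ * ∫ s in Ioo 0 ε, l1dist L u (fun z => uo z.2) s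
        ≤ Real.exp 1 * (2 * (∫ x in Icc 0 L, oscMean uo n x) + C * ε) + 8 * R * r := by
    intro r hr hrL n
    obtain ⟨C, hC⟩ := h.initial_estimate hT hL hg hR n hr hrL
    refine ⟨C, fun ε hε hεT => ?_⟩
    have hψ := (contDiff_cutoff L r).continuous
    have hψ0 := cutoff_nonneg hr hrL
    set m : ℝ → ℝ := fun t => ∫ x in Icc 0 L, cutoff L r x * |u (t, x) - uo x| with hm
    have hm0 : ∀ t, 0 ≤ m t := fun t =>
      integral_nonneg fun x => mul_nonneg (hψ0 x) (abs_nonneg _)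
    have mA := measurable_abs_sub h.meas mo
    have iQ : IntegrableOn (fun z : ℝ × ℝ => ε⁻¹ * Real.exp (-(ε⁻¹ * z.1))
        * (cutoff L r z.2 * |u z - uo z.2|)) (Icc 0 T ×ˢ Icc 0 L) := by
      have := integrableOn_bdd_mul_continuous (μ := volume) mA (C := 2 * R) (fun q => by
        rw [abs_abs]; exact abs_sub_le_two_mul (huR _) (hoR _))
        (c := fun z : ℝ × ℝ => ε⁻¹ * Real.exp (-(ε⁻¹ * z.1)) * cutoff L r z.2) (by fun_prop)
        ((isCompact_Icc (a := (0 : ℝ)) (b := T)).prod (isCompact_Icc (a := (0 : ℝ)) (b := L)))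
      exact this.congr (Eventually.of_forall fun z => by ring)
    have iQ' := iQ
    rw [IntegrableOn, Measure.volume_eq_prod, ← Measure.prod_restrict] at iQ'
    have em : ∀ t, ∫ x in Icc 0 L, ε⁻¹ * Real.exp (-(ε⁻¹ * t))
        * (cutoff L r x * |u (t, x) - uo x|) = ε⁻¹ * Real.exp (-(ε⁻¹ * t)) * m t := fun t =>
      integral_const_mul _ _
    have iE : IntegrableOn (fun t => ε⁻¹ * Real.exp (-(ε⁻¹ * t)) * m t) (Icc 0 T) := by
      refine iQ'.integral_prod_left.congr (Eventually.of_forall em)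
    have eQ : ∫ z in Icc 0 T ×ˢ Icc 0 L, ε⁻¹ * Real.exp (-(ε⁻¹ * z.1))
        * (cutoff L r z.2 * |u z - uo z.2|)
        = ∫ t in Icc 0 T, ε⁻¹ * Real.exp (-(ε⁻¹ * t)) * m t := by
      rw [Measure.volume_eq_prod, setIntegral_prod _ (by exact iQ)]
      exact integral_congr_ae (Eventually.of_forall em)
    have hCε := hC ε hε
    rw [eQ] at hCε
    have hsub : Ioo 0 ε ⊆ Icc 0 T := fun t ht => ⟨ht.1.le, ht.2.le.trans hεT⟩
    have hE0 : ∀ t, 0 ≤ ε⁻¹ * Real.exp (-(ε⁻¹ * t)) * m t := fun t =>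
      mul_nonneg (by positivity) (hm0 t)
    have h1 : ∫ t in Ioo 0 ε, ε⁻¹ * Real.exp (-(ε⁻¹ * t)) * m t
        ≤ ∫ t in Icc 0 T, ε⁻¹ * Real.exp (-(ε⁻¹ * t)) * m t :=
      setIntegral_mono_set iE (Eventually.of_forall hE0) hsub.eventuallyLE
    have h2 : ∫ s in Ioo 0 ε, ε⁻¹ * l1dist L u (fun z => uo z.2) s
        ≤ ∫ t in Ioo 0 ε, (Real.exp 1 * (ε⁻¹ * Real.exp (-(ε⁻¹ * t)) * m t)
          + ε⁻¹ * (8 * R * r)) := by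
      refine setIntegral_mono_on ?_ (((iE.mono_set hsub).const_mul _).add
        (integrableOn_const (by simp))) measurableSet_Ioo fun t ht => ?_
      · refine Integrable.const_mul ?_ _
        exact ((locallyIntegrable_of_abs_le (measurable_l1dist L h.meas mo)
          (l1dist_le hL.le huR fun z => hoR z.2)).integrableOn_isCompact
            (isCompact_Icc (a := 0) (b := T))).mono_set hsub
      · have k1 := l1dist_le_cutoff h.meas mo huR (fun z => hoR z.2) hr hrL t
        have k2 : 1 ≤ Real.exp 1 * Real.exp (-(ε⁻¹ * t)) := by
          rw [← Real.exp_add]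
          refine Real.one_le_exp ?_
          have : ε⁻¹ * t ≤ ε⁻¹ * ε := mul_le_mul_of_nonneg_left ht.2.le (by positivity)
          rw [inv_mul_cancel₀ hε.ne'] at this
          linarith
        have k3 := mul_le_mul_of_nonneg_right k2 (hm0 t)
        have k4 := mul_le_mul_of_nonneg_left (k1.trans (by
          have : m t ≤ Real.exp 1 * Real.exp (-(ε⁻¹ * t)) * m t := by linarith
          exact add_le_add_left this _)) (inv_nonneg.2 hε.le)
        refine k4.trans (le_of_eq ?_)
        ring
    rw [integral_const_mul, integral_add ((iE.mono_set hsub).const_mul _)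
      (integrableOn_const (by simp)), integral_const_mul, setIntegral_const,
      Real.volume_real_Ioo_of_le hε.le, smul_eq_mul, sub_zero, mul_inv_cancel_left₀ hε.ne'] at h2
    have := mul_le_mul_of_nonneg_left (h1.trans hCε) (Real.exp_pos 1).le
    linarith
  rw [Metric.tendsto_nhds]
  intro η hη
  -- The order of the choices matters: r makes the end strips small, n makes the oscillation small,
  -- and only then is ε taken small against C, which depends on r and n. The shares of η are 1/2,
  -- 1/4 and 1/4.
  obtain ⟨r, hr, hrL, hrη⟩ : ∃ r, 0 < r ∧ 3 * r ≤ L ∧ 8 * R * r < η / 2 := by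
    refine ⟨min (L / 3) (η / (32 * (R + 1))), by positivity, ?_, ?_⟩
    · linarith [min_le_left (L / 3) (η / (32 * (R + 1)))]
    · have h1 := min_le_right (L / 3) (η / (32 * (R + 1)))
      have h2 : 8 * R * min (L / 3) (η / (32 * (R + 1))) ≤ 8 * (R + 1) * (η / (32 * (R + 1))) :=
        mul_le_mul (by linarith) h1 (by positivity) (by positivity)
      have h3 : 8 * (R + 1) * (η / (32 * (R + 1))) = η / 4 := by field_simp; norm_num
      linarith
  have hn : ∀ᶠ n in atTop, Real.exp 1 * (2 * ∫ x in Icc 0 L, oscMean uo n x) < η / 4 := by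
    have := ((tendsto_integral_oscMean h.meas_init hoR L).const_mul 2).const_mul (Real.exp 1)
    simp only [mul_zero] at this
    exact this.eventually_lt_const (by positivity)
  obtain ⟨n, hn⟩ := hn.exists
  obtain ⟨C, hC⟩ := hbound r hr hrL n
  have hε : ∀ᶠ ε in 𝓝[>] (0 : ℝ), Real.exp 1 * (C * ε) < η / 4 := by
    have : Tendsto (fun ε : ℝ => Real.exp 1 * (C * ε)) (𝓝[>] 0) (𝓝 (Real.exp 1 * (C * 0))) :=
      (Continuous.tendsto (by fun_prop) 0).mono_left nhdsWithin_le_nhds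
    simp only [mul_zero] at this
    exact this.eventually_lt_const (by positivity)
  filter_upwards [hε, self_mem_nhdsWithin, Ioo_mem_nhdsGT hT] with ε h1 h2 h3
  have h4 := hC ε h2 h3.2.le
  have h5 : 0 ≤ ε⁻¹ * ∫ s in Ioo 0 ε, l1dist L u (fun z => uo z.2) s :=
    mul_nonneg (inv_nonneg.2 (le_of_lt h2)) (integral_nonneg fun s => l1dist_nonneg _ _ _ _)
  rw [Real.dist_eq, sub_zero, abs_of_nonneg h5]
  linarith

end

end SegmentIBVP

end

noncomputable section

namespace SegmentIBVP

/-! ### The final value -/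

section

variable {T L M α β R : ℝ} {g uo uT b0 bL : ℝ → ℝ} {u : ℝ × ℝ → ℝ} {p q : ℝ → ℝ} {K : NNReal}

/-- The time factor rises from 0 to 1 on [T - r, T]. Its derivative averages the entropy over times
close to T, where continuity of F applies; the flux term is O(r), and the initial and boundary terms
vanish. -/
theorem EntIneq.final_le (h : EntIneq T L M (fun _ => 1) uo uT b0 bL u p q) (hT : 0 < T)
    (hL : 0 < L) (hum : Measurable u) (hur : ∀ z, u z ∈ Icc α β) (hp : Continuous p)
    (hq : Continuous q) {ψ : ℝ → ℝ} (hψ : ContDiff ℝ 1 ψ) (hψ0 : ∀ x, 0 ≤ ψ x) (h0 : ψ 0 = 0)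
    (h1 : ψ L = 0) {F : ℝ → ℝ} (hF : ContinuousWithinAt F (Icc 0 T) T)
    (hpF : ∀ᵐ t : ℝ, t ∈ Ioo 0 T → ∫ x in Icc 0 L, p (u (t, x)) * ψ x = F t) :
    ∫ x in Icc 0 L, p (uT x) * ψ x ≤ F T := by
  obtain ⟨Cq, hCq0, hCq⟩ := exists_abs_le_of_continuous hq α β
  have cψ := hψ.continuous
  have cψ' : Continuous (deriv ψ) := hψ.continuous_deriv (by simp)
  obtain ⟨Cψ, hCψ0, hCψ⟩ := exists_abs_le_of_continuous cψ' 0 L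
  have hQ : IsCompact (Icc (0 : ℝ) T ×ˢ Icc (0 : ℝ) L) := isCompact_Icc.prod isCompact_Icc
  have crk := continuous_rampKernel
  refine le_of_forall_pos_le_add fun η hη => ?_
  have hnear : ∀ᶠ t in 𝓝[Icc 0 T] T, F t < F T + η := hF.eventually_lt_const (by linarith)
  obtain ⟨δ, hδ, hball⟩ := Metric.mem_nhdsWithin_iff.1 hnear
  have hlim : Tendsto (fun r : ℝ => F T + η + r * (L * (Cq * Cψ))) (𝓝[>] 0)
      (𝓝 (F T + η + 0 * (L * (Cq * Cψ)))) :=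
    (Continuous.tendsto (by fun_prop) 0).mono_left nhdsWithin_le_nhds
  rw [zero_mul, add_zero] at hlim
  refine ge_of_tendsto hlim ?_
  filter_upwards [Ioo_mem_nhdsGT hδ, Ioo_mem_nhdsGT hT] with r hr hrT
  have hr0 : 0 < r := hr.1
  set θ : ℝ → ℝ := fun t => Real.smoothTransition (r⁻¹ * (t - (T - r))) with hθ
  set θ' : ℝ → ℝ := fun t => r⁻¹ * rampKernel (r⁻¹ * (t - (T - r))) with hθ'
  have hθd : ∀ t, HasDerivAt θ (θ' t) t := by
    intro t
    have h1 : HasDerivAt (fun x : ℝ => r⁻¹ * (x - (T - r))) (r⁻¹ * 1) t :=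
      ((hasDerivAt_id t).sub_const _).const_mul r⁻¹
    exact ((hasDerivAt_smoothTransition _).comp t h1).congr_deriv (by simp only [hθ']; ring)
  have hθ1 : ContDiff ℝ 1 θ := by
    have hR : ContDiff ℝ 1 Real.smoothTransition := Real.smoothTransition.contDiff (n := 1)
    exact hR.comp (by fun_prop)
  have cθ := hθ1.continuous
  have cθ' : Continuous θ' := by simp only [hθ']; fun_prop
  have hθ0 : ∀ t, 0 ≤ θ t := fun t => Real.smoothTransition.nonneg _
  have hθle : ∀ t, θ t ≤ 1 := fun t => Real.smoothTransition.le_one _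
  have hθ'0 : ∀ t, 0 ≤ θ' t := fun t => mul_nonneg (inv_nonneg.2 hr0.le) (rampKernel_nonneg _)
  have hθz : ∀ t, t ≤ T - r → θ t = 0 := fun t ht =>
    Real.smoothTransition.zero_of_nonpos
      (mul_nonpos_of_nonneg_of_nonpos (inv_nonneg.2 hr0.le) (by linarith))
  have hθ'z : ∀ t, t ≤ T - r → θ' t = 0 := fun t ht => by
    simp only [hθ']
    rw [rampKernel_of_nonpos
      (mul_nonpos_of_nonneg_of_nonpos (inv_nonneg.2 hr0.le) (by linarith)), mul_zero]
  have hθT : θ T = 1 := by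
    simp only [hθ]
    rw [sub_sub_cancel, inv_mul_cancel₀ hr0.ne', Real.smoothTransition.one]
  have key := h.tensor hT.le hL.le hθ1 hψ hθd
    (fun x => (hψ.differentiable (by simp) x).hasDerivAt) hθ0 hψ0
  rw [hθT, hθz 0 (by linarith [hrT.2]), h0, h1] at key
  simp only [mul_zero, add_zero, integral_zero, zero_mul, one_mul] at key
  have i1 : IntegrableOn (fun z : ℝ × ℝ => p (u z) * (θ' z.1 * ψ z.2)) (Icc 0 T ×ˢ Icc 0 L) :=
    integrableOn_comp_mul hp hum hur (by fun_prop) hQ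
  have i2 : IntegrableOn (fun z : ℝ × ℝ => q (u z) * (θ z.1 * deriv ψ z.2))
      (Icc 0 T ×ˢ Icc 0 L) := integrableOn_comp_mul hq hum hur (by fun_prop) hQ
  rw [integral_add i1 i2] at key
  have b2 : ∫ z in Icc 0 T ×ˢ Icc 0 L, q (u z) * (θ z.1 * deriv ψ z.2)
      ≤ r * (L * (Cq * Cψ)) := by
    have e : ∫ z in Icc 0 T ×ˢ Icc 0 L, q (u z) * (θ z.1 * deriv ψ z.2)
        = ∫ z in Icc (T - r) T ×ˢ Icc 0 L, q (u z) * (θ z.1 * deriv ψ z.2) := by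
      refine setIntegral_eq_of_subset_of_forall_sdiff_eq_zero
        (measurableSet_Icc.prod measurableSet_Icc)
        (prod_mono (Icc_subset_Icc (by linarith [hrT.2]) le_rfl) le_rfl) fun z hz => ?_
      rw [hθz, zero_mul, mul_zero]
      by_contra hlt
      exact hz.2 ⟨⟨by linarith, hz.1.1.2⟩, hz.1.2⟩
    have hvol : volume.real (Icc (T - r) T ×ˢ Icc (0 : ℝ) L) = r * L := by
      rw [Measure.volume_eq_prod, measureReal_prod_prod, Real.volume_real_Icc_of_le (by linarith),
        Real.volume_real_Icc_of_le hL.le]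
      ring
    have hcp : IsCompact (Icc (T - r) T ×ˢ Icc (0 : ℝ) L) := isCompact_Icc.prod isCompact_Icc
    have := norm_setIntegral_le_of_norm_le_const (μ := volume)
      (f := fun z => q (u z) * (θ z.1 * deriv ψ z.2))
      (C := Cq * Cψ) hcp.measure_lt_top (fun z hz => by
        rw [norm_mul, norm_mul, Real.norm_eq_abs (θ z.1), abs_of_nonneg (hθ0 _)]
        refine mul_le_mul (hCq _ (hur z)) ?_ (by positivity [hθ0 z.1]) hCq0
        exact (mul_le_of_le_one_left (norm_nonneg _) (hθle _)).trans (hCψ _ hz.2))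
    rw [hvol] at this
    rw [e]
    exact (le_abs_self _).trans (this.trans (le_of_eq (by ring)))
  have b1 : ∫ z in Icc 0 T ×ˢ Icc 0 L, p (u z) * (θ' z.1 * ψ z.2) ≤ F T + η := by
    have i1' := i1
    rw [IntegrableOn, Measure.volume_eq_prod, ← Measure.prod_restrict] at i1'
    have hem : ∀ t, ∫ x in Icc 0 L, p (u (t, x)) * (θ' t * ψ x)
        = θ' t * ∫ x in Icc 0 L, p (u (t, x)) * ψ x := fun t => by
      rw [← integral_const_mul]
      exact integral_congr_ae (Eventually.of_forall fun x => by ring)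
    have e1 : ∫ z in Icc 0 T ×ˢ Icc 0 L, p (u z) * (θ' z.1 * ψ z.2)
        = ∫ t in Icc 0 T, θ' t * ∫ x in Icc 0 L, p (u (t, x)) * ψ x := by
      rw [Measure.volume_eq_prod, setIntegral_prod _ (by exact i1)]
      exact integral_congr_ae (Eventually.of_forall hem)
    have iE : IntegrableOn (fun t => θ' t * ∫ x in Icc 0 L, p (u (t, x)) * ψ x) (Icc 0 T) :=
      i1'.integral_prod_left.congr (Eventually.of_forall hem)
    have iθ : IntegrableOn (fun t => θ' t * (F T + η)) (Icc 0 T) :=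
      (Continuous.continuousOn (by fun_prop)).integrableOn_compact isCompact_Icc
    have e2 : ∫ t in Icc 0 T, θ' t * (F T + η) = F T + η := by
      rw [integral_mul_const, integral_Icc_eq_integral_Ioc,
        ← intervalIntegral.integral_of_le hT.le,
        intervalIntegral.integral_eq_sub_of_hasDerivAt (fun t _ => hθd t)
          (cθ'.intervalIntegrable _ _), hθT, hθz 0 (by linarith [hrT.2])]
      ring
    rw [e1, ← e2]
    refine setIntegral_mono_on_ae iE iθ measurableSet_Icc ?_
    have hne0 : ∀ᵐ t : ℝ, t ≠ 0 := by simp [ae_iff]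
    have hneT : ∀ᵐ t : ℝ, t ≠ T := by simp [ae_iff]
    filter_upwards [hpF, hne0, hneT] with t ht h0' hT' htI
    have htI' : t ∈ Ioo 0 T := ⟨lt_of_le_of_ne htI.1 (Ne.symm h0'), lt_of_le_of_ne htI.2 hT'⟩
    rw [ht htI']
    by_cases hc : t ≤ T - r
    · rw [hθ'z t hc, zero_mul, zero_mul]
    · refine mul_le_mul_of_nonneg_left (le_of_lt (hball ⟨?_, htI⟩)) (hθ'0 _)
      rw [Metric.mem_ball, Real.dist_eq, abs_lt]
      constructor <;> linarith [hr.2, htI'.2]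
  linarith

theorem integrable_mul_of_continuous (f : L1Segment L) {ψ : ℝ → ℝ} (hψ : Continuous ψ) :
    IntegrableOn (fun x => f x * ψ x) (Icc 0 L) :=
  IntegrableOn.mul_continuousOn (L1.integrable_coeFn f) hψ.continuousOn isCompact_Icc

theorem continuousOn_integral_mul {U : ℝ → L1Segment L} {s : Set ℝ} (hU : ContinuousOn U s)
    {ψ : ℝ → ℝ} (hψ : Continuous ψ) :
    ContinuousOn (fun t => ∫ x in Icc 0 L, U t x * ψ x) s := by
  obtain ⟨C, hC0, hC⟩ := exists_abs_le_of_continuous hψ 0 L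
  have hlip : LipschitzWith C.toNNReal
      (fun f : L1Segment L => ∫ x in Icc 0 L, f x * ψ x) := by
    refine LipschitzWith.of_dist_le_mul fun f k => ?_
    rw [Real.coe_toNNReal C hC0, dist_eq_norm, dist_eq_norm,
      ← integral_sub (integrable_mul_of_continuous f hψ) (integrable_mul_of_continuous k hψ),
      L1.norm_eq_integral_norm, ← integral_const_mul]
    refine norm_integral_le_of_norm_le ((L1.integrable_coeFn (f - k)).norm.const_mul _) ?_
    filter_upwards [Lp.coeFn_sub f k, ae_restrict_mem measurableSet_Icc] with x hx hxI
    rw [hx, Pi.sub_apply, ← sub_mul, norm_mul, mul_comm]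
    exact mul_le_mul_of_nonneg_right (hC x hxI) (norm_nonneg _)
  exact hlip.continuous.comp_continuousOn hU

/-- At the levels α and β the semi-entropies are u - α and β - u on the whole range, hence affine.
The two inequalities for the final value are then opposite, and they give equality against every
test. -/
theorem AutSol.final_eq (h : AutSol T L M α β g uo uT b0 bL u) (hT : 0 < T) (hL : 0 < L)
    (hg : Continuous g) {U : ℝ → L1Segment L} (hU : ContinuousOn U (Icc 0 T))
    (hUu : ∀ᵐ t : ℝ, t ∈ Ioo 0 T →
      U t =ᵐ[volume.restrict (Icc (0 : ℝ) L)] fun x => u (t, x)) :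
    U T =ᵐ[volume.restrict (Icc (0 : ℝ) L)] uT := by
  have hαβ := (h.range 0).1.trans (h.range 0).2
  have hTI : T ∈ Icc 0 T := right_mem_Icc.2 hT.le
  have hsl : ∀ ψ : ℝ → ℝ, ∀ᵐ t : ℝ, t ∈ Ioo 0 T →
      ∫ x in Icc 0 L, u (t, x) * ψ x = ∫ x in Icc 0 L, U t x * ψ x := by
    intro ψ
    filter_upwards [hUu] with t ht htI
    refine integral_congr_ae ?_
    filter_upwards [ht htI] with x hx
    rw [hx]
  have iu : ∀ t, ∀ ψ : ℝ → ℝ, Continuous ψ → IntegrableOn (fun x => u (t, x) * ψ x) (Icc 0 L) :=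
    fun t ψ hψ => integrableOn_comp_mul continuous_id (h.meas.comp measurable_prodMk_left)
      (fun x => h.range (t, x)) hψ isCompact_Icc
  have iT : ∀ ψ : ℝ → ℝ, Continuous ψ → IntegrableOn (fun x => uT x * ψ x) (Icc 0 L) :=
    fun ψ hψ => integrableOn_comp_mul continuous_id h.meas_final h.range_final hψ isCompact_Icc
  have htest : ∀ ψ : ℝ → ℝ, ContDiff ℝ 1 ψ → (∀ x, 0 ≤ ψ x) → ψ 0 = 0 → ψ L = 0 →
      ∫ x in Icc 0 L, uT x * ψ x = ∫ x in Icc 0 L, U T x * ψ x := by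
    intro ψ hψ hψ0 h0 h1
    have cψ := hψ.continuous
    have hcont := continuousOn_integral_mul hU cψ
    have iψ : ∀ c : ℝ, IntegrableOn (fun x => c * ψ x) (Icc 0 L) := fun c =>
      (Continuous.continuousOn (by fun_prop)).integrableOn_compact isCompact_Icc
    apply le_antisymm
    · have key := (h.pos α (left_mem_Icc.2 hαβ)).final_le hT hL h.meas h.range (by fun_prop)
        (by fun_prop) hψ hψ0 h0 h1
        (F := fun t => (∫ x in Icc 0 L, U t x * ψ x) - ∫ x in Icc 0 L, α * ψ x)
        ((hcont T hTI).sub continuousWithinAt_const) (by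
          filter_upwards [hsl ψ] with t ht htI
          rw [← ht htI, ← integral_sub (iu t ψ cψ) (iψ α)]
          refine integral_congr_ae (Eventually.of_forall fun x => ?_)
          simp only [max_eq_left (sub_nonneg.2 (h.range (t, x)).1)]
          ring)
      have e : ∫ x in Icc 0 L, max (uT x - α) 0 * ψ x
          = (∫ x in Icc 0 L, uT x * ψ x) - ∫ x in Icc 0 L, α * ψ x := by
        rw [← integral_sub (iT ψ cψ) (iψ α)]
        refine integral_congr_ae (Eventually.of_forall fun x => ?_)
        simp only [max_eq_left (sub_nonneg.2 (h.range_final x).1)]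
        ring
      rw [e] at key
      linarith
    · have key := (h.neg β (right_mem_Icc.2 hαβ)).final_le hT hL h.meas h.range (by fun_prop)
        (by fun_prop) hψ hψ0 h0 h1
        (F := fun t => (∫ x in Icc 0 L, β * ψ x) - ∫ x in Icc 0 L, U t x * ψ x)
        (continuousWithinAt_const.sub (hcont T hTI)) (by
          filter_upwards [hsl ψ] with t ht htI
          rw [← ht htI, ← integral_sub (iψ β) (iu t ψ cψ)]
          refine integral_congr_ae (Eventually.of_forall fun x => ?_)
          simp only [max_eq_left (sub_nonneg.2 (h.range (t, x)).2)]
          ring)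
      have e : ∫ x in Icc 0 L, max (β - uT x) 0 * ψ x
          = (∫ x in Icc 0 L, β * ψ x) - ∫ x in Icc 0 L, uT x * ψ x := by
        rw [← integral_sub (iψ β) (iT ψ cψ)]
        refine integral_congr_ae (Eventually.of_forall fun x => ?_)
        simp only [max_eq_left (sub_nonneg.2 (h.range_final x).2)]
        ring
      rw [e] at key
      linarith
  set d : ℝ → ℝ := (Icc 0 L).indicator fun x => U T x - uT x with hd
  have iUT : IntegrableOn (fun x => U T x - uT x) (Icc 0 L) := by
    refine (L1.integrable_coeFn (U T)).sub ?_
    exact (iT (fun _ => 1) continuous_const).congr (Eventually.of_forall fun x => mul_one _)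
  have id' : Integrable d := (integrable_indicator_iff measurableSet_Icc).2 iUT
  have hzero : ∀ ψ : ℝ → ℝ, ContDiff ℝ 1 ψ → (∀ x, 0 ≤ ψ x) → tsupport ψ ⊆ Ioo 0 L →
      ∫ x, ψ x * d x = 0 := by
    intro ψ hψ hψ0 hs
    have hz : ∀ x, x ∉ Ioo 0 L → ψ x = 0 := fun x hx =>
      image_eq_zero_of_notMem_tsupport fun hx' => hx (hs hx')
    have e : ∀ x, ψ x * d x = (Icc 0 L).indicator (fun x => U T x * ψ x - uT x * ψ x) x := by
      intro x
      simp only [hd, indicator]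
      split_ifs
      · ring
      · ring
    simp only [e]
    rw [integral_indicator measurableSet_Icc, integral_sub
      (integrable_mul_of_continuous _ hψ.continuous) (iT ψ hψ.continuous),
      htest ψ hψ hψ0 (hz 0 (by simp)) (hz L (by simp)), sub_self]
  have hge := ae_nonneg_of_forall_test id'.locallyIntegrable (a := 0) (b := L)
    fun ψ h1 _ h2 h3 => (hzero ψ h1 h2 h3).ge
  have hle := ae_nonneg_of_forall_test id'.neg.locallyIntegrable (a := 0) (b := L)
    fun ψ h1 _ h2 h3 => by
      have : ∫ x, ψ x * (-d) x = -∫ x, ψ x * d x := by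
        rw [← integral_neg]
        exact integral_congr_ae (Eventually.of_forall fun x => by simp)
      rw [this, hzero ψ h1 h2 h3, neg_zero]
  have hne0 : ∀ᵐ t : ℝ, t ≠ 0 := by simp [ae_iff]
  have hneL : ∀ᵐ t : ℝ, t ≠ L := by simp [ae_iff]
  refine (ae_restrict_iff' measurableSet_Icc).2 ?_
  filter_upwards [hge, hle, hne0, hneL] with x h1 h2 h3 h4 hx
  have hx' : x ∈ Ioo 0 L := ⟨lt_of_le_of_ne hx.1 (Ne.symm h3), lt_of_le_of_ne hx.2 h4⟩
  have a1 := h1 hx'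
  have a2 := h2 hx'
  simp only [Pi.neg_apply, hd, indicator_of_mem hx] at a1 a2
  linarith

/-- An entropy solution of the autonomous problem has a continuous representative with the right
initial and final values. -/
theorem AutSol.exists_repr (h : AutSol T L M α β g uo uT b0 bL u) (hT : 0 < T) (hL : 0 < L)
    (hg : LipschitzWith K g) :
    ∃ U : ℝ → L1Segment L, ContinuousOn U (Icc 0 T) ∧
      (∀ᵐ t : ℝ, t ∈ Ioo 0 T → U t =ᵐ[volume.restrict (Icc (0 : ℝ) L)] fun x => u (t, x)) ∧
      U 0 =ᵐ[volume.restrict (Icc (0 : ℝ) L)] uo ∧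
      U T =ᵐ[volume.restrict (Icc (0 : ℝ) L)] uT := by
  obtain ⟨R, -, hR⟩ := exists_abs_le_of_continuous continuous_id α β
  have hint : ∀ {b : ℝ → ℝ}, Measurable b → (∀ t, |b t| ≤ R) → IntegrableOn b (Ioo 0 T) :=
    fun hb hbR => ((locallyIntegrable_of_abs_le hb hbR).integrableOn_isCompact
      isCompact_Icc).mono_set Ioo_subset_Icc_self
  obtain ⟨U, hU, hUu, hU0⟩ := (h.interiorSol hT hL hg hR).exists_continuousOn hT hL hg
    (hint h.meas_left fun t => hR _ (h.range_left t))
    (hint h.meas_right fun t => hR _ (h.range_right t))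
    h.meas_init (fun x => hR _ (h.range_init x)) (h.tendsto_initial hT hL hg hR)
  have hUu' : ∀ᵐ t : ℝ, t ∈ Ioo 0 T →
      U t =ᵐ[volume.restrict (Icc (0 : ℝ) L)] fun x => u (t, x) := by
    filter_upwards [hUu] with t ht htI
    rw [ht htI]
    exact Integrable.coeFn_toL1 _
  exact ⟨U, hU, hUu', hU0, h.final_eq hT hL hg.continuous hU hUu'⟩

end

end SegmentIBVP

end

noncomputable section

namespace SegmentIBVP

/-! ### Change of the time variable -/

/-- `V` is a primitive of `v ≥ c > 0`, and `W` is the inverse of `V`. -/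
structure TimeChange (c : ℝ) (v V W : ℝ → ℝ) : Prop where
  pos : 0 < c
  cont : Continuous v
  lower : ∀ t, c ≤ v t
  deriv : ∀ t, HasDerivAt V (v t) t
  zero : V 0 = 0
  left : ∀ t, W (V t) = t
  right : ∀ t, V (W t) = t

/-- The lower bound c makes V t - c t monotone, which forces V to be onto the real line. -/
theorem exists_timeChange {c : ℝ} {v : ℝ → ℝ} (hc : 0 < c) (hv : Continuous v)
    (hl : ∀ t, c ≤ v t) : ∃ V W, TimeChange c v V W := by
  set V : ℝ → ℝ := fun t => ∫ s in (0 : ℝ)..t, v s with hV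
  have hd : ∀ t, HasDerivAt V (v t) t := fun t => hv.integral_hasStrictDerivAt 0 t |>.hasDerivAt
  have hcont : Continuous V := continuous_iff_continuousAt.2 fun t => (hd t).continuousAt
  have hmono : StrictMono V :=
    strictMono_of_deriv_pos fun t => by rw [(hd t).deriv]; exact hc.trans_le (hl t)
  have h0 : V 0 = 0 := intervalIntegral.integral_same
  have hm : Monotone fun t => V t - c * t := by
    refine monotone_of_deriv_nonneg (f := fun t => V t - c * t)
      (fun t => ((hd t).differentiableAt).sub (by fun_prop)) fun t => ?_
    have h1 : HasDerivAt (fun t => V t - c * t) (v t - c * 1) t :=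
      (hd t).sub ((hasDerivAt_id t).const_mul c)
    rw [h1.deriv]
    linarith [hl t]
  have hsurj : Function.Surjective V := by
    refine hcont.surjective ?_ ?_
    · refine tendsto_atTop_mono' atTop ?_ (tendsto_id.const_mul_atTop hc)
      filter_upwards [eventually_ge_atTop 0] with t ht
      have := hm ht
      simp only [h0, mul_zero, sub_zero] at this
      simpa using this
    · refine tendsto_atBot_mono' atBot ?_ (tendsto_id.const_mul_atBot hc)
      filter_upwards [eventually_le_atBot 0] with t ht
      have := hm ht
      simp only [h0, mul_zero, sub_zero] at this
      simpa using this
  exact ⟨V, Function.surjInv hsurj, hc, hv, hl, hd, h0,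
    Function.leftInverse_surjInv ⟨hmono.injective, hsurj⟩, Function.surjInv_eq hsurj⟩

namespace TimeChange

variable {c : ℝ} {v V W : ℝ → ℝ}

theorem pos_v (h : TimeChange c v V W) (t : ℝ) : 0 < v t := h.pos.trans_le (h.lower t)

theorem strictMono (h : TimeChange c v V W) : StrictMono V :=
  strictMono_of_deriv_pos fun t => by rw [(h.deriv t).deriv]; exact h.pos_v t

theorem strictMono_inv (h : TimeChange c v V W) : StrictMono W := fun s t hst => by
  rw [← h.strictMono.lt_iff_lt, h.right, h.right]
  exact hst

theorem contDiff (h : TimeChange c v V W) : ContDiff ℝ 1 V := by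
  rw [contDiff_one_iff_deriv]
  refine ⟨fun t => (h.deriv t).differentiableAt, ?_⟩
  rw [show _root_.deriv V = v from funext fun t => (h.deriv t).deriv]
  exact h.cont

theorem continuous_inv (h : TimeChange c v V W) : Continuous W :=
  h.strictMono_inv.monotone.continuous_of_surjective fun t => ⟨V t, h.left t⟩

theorem inv_zero (h : TimeChange c v V W) : W 0 = 0 := by simpa only [h.zero] using h.left 0

/-- The homeomorphism given by a change of time. -/
def homeomorph (h : TimeChange c v V W) : ℝ ≃ₜ ℝ where
  toFun := V
  invFun := W
  left_inv := h.left
  right_inv := h.right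
  continuous_toFun := h.contDiff.continuous
  continuous_invFun := h.continuous_inv

theorem hasDerivAt_inv (h : TimeChange c v V W) (t : ℝ) : HasDerivAt W (v (W t))⁻¹ t :=
  HasDerivAt.of_local_left_inverse h.continuous_inv.continuousAt (h.deriv _) (h.pos_v _).ne'
    (Eventually.of_forall h.right)

theorem image_Icc (h : TimeChange c v V W) (T : ℝ) : V '' Icc 0 T = Icc 0 (V T) := by
  ext t
  constructor
  · rintro ⟨s, hs, rfl⟩
    rw [← h.zero]
    exact ⟨h.strictMono.monotone hs.1, h.strictMono.monotone hs.2⟩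
  · intro ht
    refine ⟨W t, ⟨?_, ?_⟩, h.right t⟩
    · rw [← h.inv_zero]; exact h.strictMono_inv.monotone ht.1
    · rw [← h.left T]; exact h.strictMono_inv.monotone ht.2

theorem ae_comp_inv (h : TimeChange c v V W) {P : ℝ → Prop} (hP : ∀ᵐ t : ℝ, P t) :
    ∀ᵐ t : ℝ, P (W t) := by
  rw [ae_iff] at hP ⊢
  have := addHaar_image_eq_zero_of_differentiableOn_of_addHaar_eq_zero (μ := volume) (f := V)
    (fun t _ => (h.deriv t).differentiableAt.differentiableWithinAt) hP
  refine measure_mono_null (fun t ht => ?_) this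
  exact ⟨W t, ht, h.right t⟩

theorem ae_comp (h : TimeChange c v V W) {P : ℝ → Prop} (hP : ∀ᵐ t : ℝ, P t) :
    ∀ᵐ t : ℝ, P (V t) := by
  rw [ae_iff] at hP ⊢
  have := addHaar_image_eq_zero_of_differentiableOn_of_addHaar_eq_zero (μ := volume) (f := W)
    (fun t _ => (h.hasDerivAt_inv t).differentiableAt.differentiableWithinAt) hP
  refine measure_mono_null (fun t ht => ?_) this
  exact ⟨V t, ht, h.left t⟩

theorem integral_comp (h : TimeChange c v V W) (T : ℝ) (f : ℝ → ℝ) :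
    ∫ t in Icc 0 (V T), f t = ∫ t in Icc 0 T, v t * f (V t) := by
  rw [← h.image_Icc, integral_image_eq_integral_abs_deriv_smul measurableSet_Icc
    (fun t _ => (h.deriv t).hasDerivWithinAt) h.strictMono.injective.injOn]
  refine integral_congr_ae (Eventually.of_forall fun t => ?_)
  simp only [abs_of_pos (h.pos_v t), smul_eq_mul]

end TimeChange

/-- The entropy inequality after a change of time that turns the flux into an autonomous one. -/
theorem EntIneq.timeChange {T L M α β c : ℝ} {v V W uo uT b0 bL : ℝ → ℝ} {u : ℝ × ℝ → ℝ}
    {p q : ℝ → ℝ} (h : EntIneq T L M v uo uT b0 bL u p q) (hV : TimeChange c v V W)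
    (hM : 0 ≤ M) (hum : Measurable u) (hur : ∀ z, u z ∈ Icc α β) (hb0 : Measurable b0)
    (hb0r : ∀ t, b0 t ∈ Icc α β) (hbL : Measurable bL) (hbLr : ∀ t, bL t ∈ Icc α β)
    (hp : Continuous p) (hq : Continuous q) (hp0 : ∀ s, 0 ≤ p s) :
    EntIneq (V T) L (M / c) (fun _ => 1) uo uT (fun t => b0 (W t)) (fun t => bL (W t))
      (fun z => u (W z.1, z.2)) p q := by
  intro φ hφ hφc hφ0
  have cV := hV.contDiff.continuous
  have cW := hV.continuous_inv
  have cv := hV.cont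
  have cφ := hφ.continuous
  set ψ : ℝ × ℝ → ℝ := fun z => φ (V z.1, z.2) with hψ
  have hψ1 : ContDiff ℝ 1 ψ := hφ.comp ((hV.contDiff.comp contDiff_fst).prodMk contDiff_snd)
  have hψc : HasCompactSupport ψ :=
    hφc.comp_homeomorph (hV.homeomorph.prodCongr (Homeomorph.refl ℝ))
  have hd : ∀ (z : ℝ × ℝ) (a b : ℝ),
      fderiv ℝ ψ z (a, b) = fderiv ℝ φ (V z.1, z.2) (v z.1 * a, b) := by
    intro z a b
    have h1 : HasFDerivAt φ (fderiv ℝ φ (V z.1, z.2)) (V z.1, z.2) :=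
      (hφ.differentiable (by simp) _).hasFDerivAt
    have h2 : HasFDerivAt (fun z : ℝ × ℝ => (V z.1, z.2)) _ z :=
      HasFDerivAt.prodMk ((hV.deriv z.1).hasFDerivAt.comp z (hasFDerivAt_fst (𝕜 := ℝ)))
        (hasFDerivAt_snd (𝕜 := ℝ))
    have h3 : HasFDerivAt (fun z : ℝ × ℝ => φ (V z.1, z.2)) _ z := h1.comp z h2
    rw [h3.fderiv]
    simp [mul_comm]
  have hd1 : ∀ z : ℝ × ℝ, fderiv ℝ ψ z (1, 0) = v z.1 * fderiv ℝ φ (V z.1, z.2) (1, 0) := by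
    intro z
    rw [hd, ← smul_eq_mul (v z.1) (fderiv ℝ φ (V z.1, z.2) (1, 0)), ← map_smul]
    simp
  have key := h ψ hψ1 hψc fun z => hφ0 _
  unfold entBalance at key ⊢
  simp only [hd1, fun z : ℝ × ℝ => hd z 0 1, mul_zero, one_mul] at key ⊢
  set G : ℝ × ℝ → ℝ := fun z => p (u (W z.1, z.2)) * fderiv ℝ φ z (1, 0)
    + q (u (W z.1, z.2)) * fderiv ℝ φ z (0, 1) with hG
  have hφ10 := continuous_fderiv_dir hφ (1, 0)
  have hφ01 := continuous_fderiv_dir hφ (0, 1)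
  have iG : IntegrableOn G (Icc 0 (V T) ×ˢ Icc 0 L) := by
    have hm : Measurable fun z : ℝ × ℝ => u (W z.1, z.2) :=
      hum.comp ((cW.measurable.comp measurable_fst).prodMk measurable_snd)
    exact (integrableOn_comp_mul hp hm (fun z => hur _) hφ10
      (isCompact_Icc.prod isCompact_Icc)).add (integrableOn_comp_mul hq hm (fun z => hur _) hφ01
      (isCompact_Icc.prod isCompact_Icc))
  have iG' : IntegrableOn (fun z : ℝ × ℝ => p (u z) * (v z.1 * fderiv ℝ φ (V z.1, z.2) (1, 0))
      + v z.1 * q (u z) * fderiv ℝ φ (V z.1, z.2) (0, 1)) (Icc 0 T ×ˢ Icc 0 L) := by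
    have hc1 : Continuous fun z : ℝ × ℝ => (V z.1, z.2) := by fun_prop
    have a1 := integrableOn_comp_mul (μ := volume) hp hum hur
      (c := fun z : ℝ × ℝ => v z.1 * fderiv ℝ φ (V z.1, z.2) (1, 0))
      ((cv.comp continuous_fst).mul (hφ10.comp hc1))
      ((isCompact_Icc (a := (0 : ℝ)) (b := T)).prod (isCompact_Icc (a := (0 : ℝ)) (b := L)))
    have a2 := integrableOn_comp_mul (μ := volume) hq hum hur
      (c := fun z : ℝ × ℝ => v z.1 * fderiv ℝ φ (V z.1, z.2) (0, 1))
      ((cv.comp continuous_fst).mul (hφ01.comp hc1))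
      ((isCompact_Icc (a := (0 : ℝ)) (b := T)).prod (isCompact_Icc (a := (0 : ℝ)) (b := L)))
    exact (a1.add a2).congr (Eventually.of_forall fun z => by simp only [Pi.add_apply]; ring)
  have eG : ∫ z in Icc 0 (V T) ×ˢ Icc 0 L, G z
      = ∫ z in Icc 0 T ×ˢ Icc 0 L, (p (u z) * (v z.1 * fderiv ℝ φ (V z.1, z.2) (1, 0))
      + v z.1 * q (u z) * fderiv ℝ φ (V z.1, z.2) (0, 1)) := by
    rw [Measure.volume_eq_prod, setIntegral_prod _ (by exact iG), setIntegral_prod _ (by exact iG'),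
      hV.integral_comp]
    refine integral_congr_ae (Eventually.of_forall fun t => ?_)
    simp only []
    rw [← integral_const_mul]
    refine integral_congr_ae (Eventually.of_forall fun x => ?_)
    simp only [hG, hV.left]
    ring
  rw [eG, hV.integral_comp]
  simp only [hψ, hV.zero] at key
  have hB : M * ∫ t in Icc 0 T, (p (b0 t) * φ (V t, 0) + p (bL t) * φ (V t, L))
      ≤ M / c * ∫ t in Icc 0 T, v t * (p (b0 (W (V t))) * φ (V t, 0)
        + p (bL (W (V t))) * φ (V t, L)) := by
    rw [← integral_const_mul, ← integral_const_mul]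
    have cψ : ∀ x, Continuous fun t => φ (V t, x) := fun x => by fun_prop
    have j : ∀ {b : ℝ → ℝ}, Measurable b → (∀ t, b t ∈ Icc α β) → ∀ x : ℝ,
        IntegrableOn (fun t => p (b t) * φ (V t, x)) (Icc 0 T) := fun hb hbr x =>
      integrableOn_comp_mul hp hb hbr (cψ x) isCompact_Icc
    have j' := (j hb0 hb0r 0).add (j hbL hbLr L)
    refine integral_mono (j'.const_mul M) ?_ fun t => ?_
    · simp only [hV.left]
      refine Integrable.const_mul ?_ _
      refine (IntegrableOn.continuousOn_mul (cv.continuousOn) j' isCompact_Icc).congr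
        (Eventually.of_forall fun t => ?_)
      simp
    · simp only [hV.left]
      have n0 : 0 ≤ p (b0 t) * φ (V t, 0) + p (bL t) * φ (V t, L) :=
        add_nonneg (mul_nonneg (hp0 _) (hφ0 _)) (mul_nonneg (hp0 _) (hφ0 _))
      have n1 : 1 ≤ v t / c := (one_le_div hV.pos).2 (hV.lower t)
      calc _ ≤ M * (v t / c * (p (b0 t) * φ (V t, 0) + p (bL t) * φ (V t, L))) :=
            mul_le_mul_of_nonneg_left (le_mul_of_one_le_left n0 n1) hM
        _ = _ := by ring
  linarith

end SegmentIBVP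

end

noncomputable section

namespace SegmentIBVP

/-! ### From entropy solutions to the autonomous problem -/

theorem MemL1BV.exists_ae_abs_le {w : ℝ → ℝ} {a b : ℝ} (h : MemL1BV w a b) (hab : a ≤ b) :
    ∃ C, ∀ᵐ x ∂volume.restrict (Icc a b), |w x| ≤ C := by
  obtain ⟨-, z, hwz, hz⟩ := h
  refine ⟨|z a| + (eVariationOn z (Icc a b)).toReal, ?_⟩
  filter_upwards [hwz, ae_restrict_mem measurableSet_Icc] with x hx hxI
  have h1 := hz.dist_le hxI (left_mem_Icc.2 hab)
  rw [Real.dist_eq] at h1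
  rw [hx]
  linarith [abs_sub_abs_le_abs_sub (z x) (z a)]

theorem ae_mem_essHull {m : ℕ} {u : Fin m → ℝ → ℝ} {I : Fin m → Set ℝ}
    (hb : ∀ l, ∃ C, ∀ᵐ x ∂volume.restrict (I l), |u l x| ≤ C) (l : Fin m) :
    ∀ᵐ x ∂volume.restrict (I l), u l x ∈ essHull u I := by
  obtain ⟨C, hC⟩ := hb l
  have h1 : IsBoundedUnder (· ≤ ·) (ae (volume.restrict (I l))) (u l) :=
    ⟨C, eventually_map.2 (hC.mono fun x hx => (abs_le.1 hx).2)⟩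
  have h2 : IsBoundedUnder (· ≥ ·) (ae (volume.restrict (I l))) (u l) :=
    ⟨-C, eventually_map.2 (hC.mono fun x hx => (abs_le.1 hx).1)⟩
  filter_upwards [ae_le_essSup h1, ae_essInf_le h2] with x hx1 hx2
  exact ⟨(ciInf_le (Set.finite_range _).bddBelow l).trans hx2,
    hx1.trans (le_ciSup (f := fun l => essSup (u l) (volume.restrict (I l)))
      (Set.finite_range _).bddAbove l)⟩

theorem dataHull_ae_mem {T L : ℝ} {uo : ℝ → ℝ} {ub : Fin 2 → ℝ → ℝ} (hT : 0 ≤ T) (hL : 0 ≤ L)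
    (huo : MemL1BV uo 0 L) (hub : ∀ i, MemL1BV (ub i) 0 T) :
    (∀ᵐ x ∂volume.restrict (Icc 0 L), uo x ∈ dataHull T L uo ub) ∧
      ∀ i, ∀ᵐ t ∂volume.restrict (Icc 0 T), ub i t ∈ dataHull T L uo ub := by
  have h := ae_mem_essHull (u := ![uo, ub 0, ub 1]) (I := ![Icc 0 L, Icc 0 T, Icc 0 T]) (by
    intro l
    fin_cases l
    · exact huo.exists_ae_abs_le hL
    · exact (hub 0).exists_ae_abs_le hT
    · exact (hub 1).exists_ae_abs_le hT)
  refine ⟨h 0, fun i => ?_⟩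
  fin_cases i
  · exact h 1
  · exact h 2

theorem dataHull_nonempty {T L : ℝ} {uo : ℝ → ℝ} {ub : Fin 2 → ℝ → ℝ} (hT : 0 ≤ T) (hL : 0 < L)
    (huo : MemL1BV uo 0 L) (hub : ∀ i, MemL1BV (ub i) 0 T) : (dataHull T L uo ub).Nonempty := by
  have : NeZero (volume.restrict (Icc 0 L)) := ⟨by
    rw [Ne, Measure.restrict_eq_zero, Real.volume_Icc]
    simpa using hL⟩
  obtain ⟨x, hx⟩ := (dataHull_ae_mem hT hL.le huo hub).1.exists
  exact ⟨_, hx⟩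

theorem EntIneq.congr {T L M : ℝ} {v v' uo uT b0 bL uo' uT' b0' bL' : ℝ → ℝ}
    {u u' : ℝ × ℝ → ℝ} {p q p' q' : ℝ → ℝ} (h : EntIneq T L M v uo uT b0 bL u p q)
    (hu : ∀ᵐ z ∂volume.restrict (Icc 0 T ×ˢ Icc 0 L), p (u z) = p' (u' z) ∧
      v z.1 * q (u z) = v' z.1 * q' (u' z))
    (huo : ∀ᵐ x ∂volume.restrict (Icc 0 L), p (uo x) = p' (uo' x))
    (huT : ∀ᵐ x ∂volume.restrict (Icc 0 L), p (uT x) = p' (uT' x))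
    (hb0 : ∀ᵐ t ∂volume.restrict (Icc 0 T), p (b0 t) = p' (b0' t))
    (hbL : ∀ᵐ t ∂volume.restrict (Icc 0 T), p (bL t) = p' (bL' t)) :
    EntIneq T L M v' uo' uT' b0' bL' u' p' q' := by
  intro φ hφ hφc hφ0
  refine (h φ hφ hφc hφ0).trans_eq ?_
  unfold entBalance
  congr 1
  · congr 1
    · congr 1
      · refine integral_congr_ae ?_
        filter_upwards [hu] with z hz
        rw [hz.1, hz.2]
      · refine integral_congr_ae ?_
        filter_upwards [huo] with x hx
        rw [hx]
    · refine integral_congr_ae ?_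
      filter_upwards [huT] with x hx
      rw [hx]
  · congr 1
    refine integral_congr_ae ?_
    filter_upwards [hb0, hbL] with t h1 h2
    rw [h1, h2]

/-- Passage from iterated to planar integrals in the entropy inequality. -/
theorem entIneq_of_entropyBalance {T L M : ℝ} {v g uo : ℝ → ℝ} {ub : Fin 2 → ℝ → ℝ}
    {u : ℝ → ℝ → ℝ} {part sgn p q : ℝ → ℝ} {k : ℝ} (hT : 0 ≤ T) (hL : 0 ≤ L)
    (hv : ContinuousOn v (Icc 0 T))
    (hu : MemLp (Function.uncurry u) ⊤ (volume.restrict (Icc (0 : ℝ) T ×ˢ Icc (0 : ℝ) L)))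
    (hp : Continuous p) (hq : Continuous q) (hpart : ∀ s, part (s - k) = p s)
    (hsgn : ∀ s, sgn (s - k) * (g s - g k) = q s)
    (h : ∀ φ : ℝ → ℝ → ℝ, ContDiff ℝ 1 (Function.uncurry φ) →
      HasCompactSupport (Function.uncurry φ) → (∀ t x, 0 ≤ φ t x) →
      0 ≤ entropyBalance T L M (fun t w => v t * g w) uo ub u part sgn k φ) :
    EntIneq T L M v uo (u T) (ub 0) (ub 1) (Function.uncurry u) p q := by
  intro φ hφ hφc hφ0
  have key := h (Function.curry φ) hφ hφc fun t x => hφ0 (t, x)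
  have hcp : IsCompact (Icc (0 : ℝ) T ×ˢ Icc (0 : ℝ) L) := isCompact_Icc.prod isCompact_Icc
  have d1 : ∀ t x, deriv (fun s => Function.curry φ s x) t = fderiv ℝ φ (t, x) (1, 0) := by
    intro t x
    have h1 : HasFDerivAt φ (fderiv ℝ φ (t, x)) (t, x) :=
      (hφ.differentiable (by simp) _).hasFDerivAt
    have h2 : HasDerivAt (fun s : ℝ => (s, x)) ((1 : ℝ), (0 : ℝ)) t :=
      (hasDerivAt_id t).prodMk (hasDerivAt_const t x)
    exact (h1.comp_hasDerivAt t h2).deriv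
  have d2 : ∀ t x, deriv (fun y => Function.curry φ t y) x = fderiv ℝ φ (t, x) (0, 1) := by
    intro t x
    have h1 : HasFDerivAt φ (fderiv ℝ φ (t, x)) (t, x) :=
      (hφ.differentiable (by simp) _).hasFDerivAt
    have h2 : HasDerivAt (fun s : ℝ => (t, s)) ((0 : ℝ), (1 : ℝ)) x :=
      (hasDerivAt_const x t).prodMk (hasDerivAt_id x)
    exact (h1.comp_hasDerivAt x h2).deriv
  have hsgn' : ∀ t s, sgn (s - k) * (v t * g s - v t * g k) = v t * q s := by
    intro t s
    rw [← hsgn s]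
    ring
  obtain ⟨R, hR⟩ : ∃ R, ∀ᵐ z ∂volume.restrict (Icc (0 : ℝ) T ×ˢ Icc (0 : ℝ) L),
      |Function.uncurry u z| ≤ R := ⟨_, ae_le_lpNorm_exponent_top hu⟩
  have hint : ∀ {r : ℝ → ℝ} {e : ℝ × ℝ → ℝ}, Continuous r →
      ContinuousOn e (Icc (0 : ℝ) T ×ˢ Icc (0 : ℝ) L) →
      IntegrableOn (fun z => r (Function.uncurry u z) * e z) (Icc 0 T ×ˢ Icc 0 L) := by
    intro r e hr he
    obtain ⟨C, -, hC⟩ := exists_abs_le_of_continuous hr (-R) R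
    refine Integrable.bdd_mul (c := C) (he.integrableOn_compact hcp)
      (hr.comp_aestronglyMeasurable hu.1) ?_
    filter_upwards [hR] with z hz
    exact hC _ (abs_le.1 hz)
  have cv : ContinuousOn (fun z : ℝ × ℝ => v z.1) (Icc (0 : ℝ) T ×ˢ Icc (0 : ℝ) L) :=
    hv.comp continuousOn_fst fun z hz => hz.1
  have iQ : IntegrableOn (fun z : ℝ × ℝ => p (Function.uncurry u z) * fderiv ℝ φ z (1, 0)
      + v z.1 * q (Function.uncurry u z) * fderiv ℝ φ z (0, 1)) (Icc 0 T ×ˢ Icc 0 L) := by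
    refine ((hint hp (continuous_fderiv_dir hφ (1, 0)).continuousOn).add
      (hint hq (cv.mul (continuous_fderiv_dir hφ (0, 1)).continuousOn))).congr
        (Eventually.of_forall fun z => ?_)
    simp only [Pi.add_apply, Pi.mul_apply]
    ring
  unfold entropyBalance at key
  simp only [d1, d2, hpart, hsgn', intervalIntegral.integral_of_le hT,
    intervalIntegral.integral_of_le hL, ← integral_Icc_eq_integral_Ioc] at key
  unfold entBalance
  rw [Measure.volume_eq_prod, setIntegral_prod _ (by exact iQ)]
  exact key

theorem sgnPos_mul (g : ℝ → ℝ) (s k : ℝ) : sgnPos (s - k) * (g s - g k) = g (max s k) - g k := by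
  unfold sgnPos
  split_ifs with h
  · rw [max_eq_left (by linarith), one_mul]
  · rw [max_eq_right (by linarith)]; ring

theorem sgnNeg_mul (g : ℝ → ℝ) (s k : ℝ) : sgnNeg (s - k) * (g s - g k) = g k - g (min s k) := by
  unfold sgnNeg
  split_ifs with h
  · rw [min_eq_left (by linarith)]; ring
  · rw [min_eq_right (by linarith)]; ring

/-- The projection of the real line onto `[α,β]`. -/
def clamp (α β s : ℝ) : ℝ := max α (min s β)

theorem continuous_clamp (α β : ℝ) : Continuous (clamp α β) := by unfold clamp; fun_prop

theorem clamp_mem {α β : ℝ} (h : α ≤ β) (s : ℝ) : clamp α β s ∈ Icc α β :=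
  ⟨le_max_left _ _, max_le h (min_le_right _ _)⟩

theorem clamp_eq {α β s : ℝ} (h : s ∈ Icc α β) : clamp α β s = s := by
  rw [clamp, min_eq_left h.2, max_eq_right h.1]

/-- A function with values in `[α,β]` a.e. has a measurable representative with all values
in `[α,β]`. -/
theorem exists_measurable_clamp {X : Type*} [MeasurableSpace X] {μ : Measure X} {α β : ℝ}
    (hαβ : α ≤ β) {w : X → ℝ} (hw : AEMeasurable w μ) (hr : ∀ᵐ x ∂μ, w x ∈ Icc α β) :
    ∃ w' : X → ℝ, Measurable w' ∧ (∀ x, w' x ∈ Icc α β) ∧ w =ᵐ[μ] w' := by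
  refine ⟨fun x => clamp α β (hw.mk w x), (continuous_clamp α β).measurable.comp
    hw.measurable_mk, fun x => clamp_mem hαβ _, ?_⟩
  filter_upwards [hw.ae_eq_mk, hr] with x h1 h2
  rw [← h1, clamp_eq h2]

theorem hasTrace_congr {f f' : ℝ → ℝ} {w δ : ℝ} (hδ : 0 < δ)
    (h : ∀ᵐ x : ℝ, x ∈ Ioo 0 δ → f x = f' x) (hf : HasTrace f w) : HasTrace f' w := by
  refine Tendsto.congr' ?_ hf
  filter_upwards [Ioo_mem_nhdsGT hδ] with r hr
  congr 1
  refine intervalIntegral.integral_congr_ae ?_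
  filter_upwards [h] with x hx hxr
  rw [uIoc_of_le hr.1.le] at hxr
  rw [hx ⟨hxr.1, hxr.2.trans_lt hr.2⟩]

end SegmentIBVP

end

noncomputable section

namespace SegmentIBVP

section

variable {T L c : ℝ} {v g uo : ℝ → ℝ} {ub : Fin 2 → ℝ → ℝ} {u : ℝ → ℝ → ℝ}

theorem HasLeftTrace.ae_hasTrace (h : HasLeftTrace T u) (hL : 0 < L) {w : ℝ × ℝ → ℝ}
    (hw : Function.uncurry u =ᵐ[volume.restrict (Icc (0 : ℝ) T ×ˢ Icc (0 : ℝ) L)] w) :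
    ∀ᵐ t : ℝ, t ∈ Icc 0 T → ∃ a, HasTrace (fun x => w (t, x)) a := by
  rw [Measure.volume_eq_prod, ← Measure.prod_restrict] at hw
  rw [← ae_restrict_iff' measurableSet_Icc]
  filter_upwards [h, Measure.ae_ae_of_ae_prod hw] with t ⟨a, ha⟩ ht
  refine ⟨a, hasTrace_congr (f := u t) hL ?_ ha⟩
  filter_upwards [(ae_restrict_iff' measurableSet_Icc).1 ht] with x hx hxI
  exact hx (Ioo_subset_Icc_self hxI)

theorem HasRightTrace.ae_hasTrace (h : HasRightTrace T L u) (hL : 0 < L) {w : ℝ × ℝ → ℝ}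
    (hw : Function.uncurry u =ᵐ[volume.restrict (Icc (0 : ℝ) T ×ˢ Icc (0 : ℝ) L)] w) :
    ∀ᵐ t : ℝ, t ∈ Icc 0 T → ∃ a, HasTrace (fun x => w (t, L - x)) a := by
  rw [Measure.volume_eq_prod, ← Measure.prod_restrict] at hw
  rw [← ae_restrict_iff' measurableSet_Icc]
  filter_upwards [h, Measure.ae_ae_of_ae_prod hw] with t ⟨a, ha⟩ ht
  refine ⟨a, hasTrace_congr (f := fun x => u t (L - x)) hL ?_ ?_⟩
  · have := (Measure.measurePreserving_sub_left (volume : Measure ℝ) L).quasiMeasurePreserving.ae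
      ((ae_restrict_iff' measurableSet_Icc).1 ht)
    filter_upwards [this] with x hx hxI
    exact hx ⟨by linarith [hxI.2], by linarith [hxI.1]⟩
  · refine ha.congr fun r => ?_
    rw [intervalIntegral.integral_comp_sub_left (fun x => |u t x - a|) L, sub_zero]

theorem IsSolution.entIneq (h : IsSolution T L (fun t w => v t * g w) uo ub u) (hT : 0 ≤ T)
    (hL : 0 ≤ L) (hv : ContinuousOn v (Icc 0 T)) (hg : Continuous g) :
    ∃ M, 0 ≤ M ∧ ∀ k ∈ dataHull T L uo ub,
      EntIneq T L M v uo (u T) (ub 0) (ub 1) (Function.uncurry u) (fun s => max (s - k) 0)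
        (fun s => g (max s k) - g k) ∧
      EntIneq T L M v uo (u T) (ub 0) (ub 1) (Function.uncurry u) (fun s => max (k - s) 0)
        (fun s => g k - g (min s k)) := by
  refine ⟨supNormOn (fun p : ℝ × ℝ => deriv (fun w => v p.1 * g w) p.2)
    (Icc 0 T ×ˢ dataHull T L uo ub), ENNReal.toReal_nonneg, fun k hk => ⟨?_, ?_⟩⟩
  · exact entIneq_of_entropyBalance hT hL hv h.memLp (by fun_prop) (by fun_prop) (fun s => rfl)
      (fun s => sgnPos_mul g s k) fun φ h1 h2 h3 => (h.entropy k hk φ h1 h2 h3).1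
  · exact entIneq_of_entropyBalance hT hL hv h.memLp (by fun_prop) (by fun_prop)
      (fun s => by rw [partNeg, neg_sub])
      (fun s => sgnNeg_mul g s k) fun φ h1 h2 h3 => (h.entropy k hk φ h1 h2 h3).2

theorem IsSolution.ae_mem_dataHull (h : IsSolution T L (fun t w => v t * g w) uo ub u)
    (hT : 0 ≤ T) (hL : 0 ≤ L) (hv : ContinuousOn v (Icc 0 T)) (hg : Continuous g)
    (huo : MemL1BV uo 0 L) (hub : ∀ i, MemL1BV (ub i) 0 T)
    (hne : (dataHull T L uo ub).Nonempty) :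
    (∀ᵐ z ∂volume.restrict (Icc 0 T ×ˢ Icc 0 L), Function.uncurry u z ∈ dataHull T L uo ub) ∧
      ∀ᵐ x ∂volume.restrict (Icc 0 L), u T x ∈ dataHull T L uo ub := by
  obtain ⟨M, -, hE⟩ := h.entIneq hT hL hv hg
  obtain ⟨ho, hb⟩ := dataHull_ae_mem hT hL huo hub
  obtain ⟨α, β, e⟩ : ∃ α β, dataHull T L uo ub = Icc α β := ⟨_, _, rfl⟩
  rw [e] at hne hE ho hb ⊢
  have hαβ : α ≤ β := nonempty_Icc.1 hne
  have hcp : IsCompact (Icc (0 : ℝ) T ×ˢ Icc (0 : ℝ) L) := isCompact_Icc.prod isCompact_Icc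
  have : IsFiniteMeasure (volume.restrict (Icc (0 : ℝ) T ×ˢ Icc (0 : ℝ) L)) :=
    ⟨by simpa using hcp.measure_lt_top⟩
  have iu : Integrable (Function.uncurry u) (volume.restrict (Icc (0 : ℝ) T ×ˢ Icc (0 : ℝ) L)) :=
    h.memLp.integrable le_top
  have iT : Integrable (u T) (volume.restrict (Icc 0 L)) := h.integrable_final
  obtain ⟨p1, p2⟩ := (hE β (right_mem_Icc.2 hαβ)).1.range hT hL (fun s => le_max_right _ _)
    ((iu.sub (integrable_const β)).pos_part) ((iT.sub (integrable_const β)).pos_part)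
    (ho.mono fun x hx => max_eq_right (by linarith [hx.2]))
    ((hb 0).mono fun x hx => max_eq_right (by linarith [hx.2]))
    ((hb 1).mono fun x hx => max_eq_right (by linarith [hx.2]))
  obtain ⟨n1, n2⟩ := (hE α (left_mem_Icc.2 hαβ)).2.range hT hL (fun s => le_max_right _ _)
    (((integrable_const α).sub iu).pos_part) (((integrable_const α).sub iT).pos_part)
    (ho.mono fun x hx => max_eq_right (by linarith [hx.1]))
    ((hb 0).mono fun x hx => max_eq_right (by linarith [hx.1]))
    ((hb 1).mono fun x hx => max_eq_right (by linarith [hx.1]))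
  constructor
  · filter_upwards [p1, n1] with z h1 h2
    exact ⟨by linarith [max_eq_right_iff.1 h2], by linarith [max_eq_right_iff.1 h1]⟩
  · filter_upwards [p2, n2] with z h1 h2
    exact ⟨by linarith [max_eq_right_iff.1 h2], by linarith [max_eq_right_iff.1 h1]⟩

/-- Measurable representatives of the data and of the solution, in the new time, form a solution of
the autonomous problem, whatever the flux outside of the range of the data. -/
theorem IsSolution.exists_autSol {v' V W : ℝ → ℝ} {α β : ℝ}
    (h : IsSolution T L (fun t w => v t * g w) uo ub u)
    (hT : 0 < T) (hL : 0 < L) (hV : TimeChange c v' V W) (hvv : ∀ t ∈ Icc 0 T, v' t = v t)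
    (hg : Continuous g) (huo : MemL1BV uo 0 L) (hub : ∀ i, MemL1BV (ub i) 0 T)
    (hul : HasLeftTrace T u) (hur : HasRightTrace T L u) (e : dataHull T L uo ub = Icc α β)
    {g' : ℝ → ℝ} (hgg : ∀ s ∈ Icc α β, g' s = g s) (hg' : Continuous g') :
    ∃ (M : ℝ) (wo wT w0 wL : ℝ → ℝ) (w : ℝ × ℝ → ℝ),
      AutSol (V T) L M α β g' wo wT (fun t => w0 (W t)) (fun t => wL (W t))
        (fun z => w (W z.1, z.2)) ∧
      Function.uncurry u =ᵐ[volume.restrict (Icc (0 : ℝ) T ×ˢ Icc (0 : ℝ) L)] w ∧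
      uo =ᵐ[volume.restrict (Icc 0 L)] wo ∧ u T =ᵐ[volume.restrict (Icc 0 L)] wT ∧
      ub 0 =ᵐ[volume.restrict (Icc 0 T)] w0 ∧ ub 1 =ᵐ[volume.restrict (Icc 0 T)] wL := by
  have hv : ContinuousOn v (Icc 0 T) := hV.cont.continuousOn.congr fun t ht => (hvv t ht).symm
  obtain ⟨ho, hb⟩ := dataHull_ae_mem hT.le hL.le huo hub
  have hne := dataHull_nonempty hT.le hL huo hub
  obtain ⟨hu, huT⟩ := h.ae_mem_dataHull hT.le hL.le hv hg huo hub hne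
  obtain ⟨M, hM, hE⟩ := h.entIneq hT.le hL.le hv hg
  rw [e] at hne hE ho hu huT hb
  have hαβ : α ≤ β := nonempty_Icc.1 hne
  obtain ⟨w, mw, rw', ew⟩ := exists_measurable_clamp hαβ h.memLp.1.aemeasurable hu
  obtain ⟨wo, mwo, rwo, ewo⟩ := exists_measurable_clamp hαβ huo.1.aemeasurable ho
  obtain ⟨wT, mwT, rwT, ewT⟩ := exists_measurable_clamp hαβ h.integrable_final.aemeasurable huT
  obtain ⟨w0, mw0, rw0, ew0⟩ := exists_measurable_clamp hαβ (hub 0).1.aemeasurable (hb 0)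
  obtain ⟨wL, mwL, rwL, ewL⟩ := exists_measurable_clamp hαβ (hub 1).1.aemeasurable (hb 1)
  have cW := hV.continuous_inv
  have hQ : ∀ᵐ z ∂volume.restrict (Icc (0 : ℝ) T ×ˢ Icc (0 : ℝ) L), z.1 ∈ Icc 0 T :=
    (ae_restrict_mem (measurableSet_Icc.prod measurableSet_Icc)).mono fun z hz => hz.1
  have hWI : ∀ t ∈ Ioo 0 (V T), W t ∈ Icc 0 T := fun t ht =>
    ⟨by rw [← hV.inv_zero]; exact hV.strictMono_inv.monotone ht.1.le,
      by rw [← hV.left T]; exact hV.strictMono_inv.monotone ht.2.le⟩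
  refine ⟨M / c, wo, wT, w0, wL, w, ?_, ew, ewo, ewT, ew0, ewL⟩
  refine ⟨mw.comp ((cW.measurable.comp measurable_fst).prodMk measurable_snd), mwo, mwT,
    mw0.comp cW.measurable, mwL.comp cW.measurable, fun z => rw' _, rwo, rwT, fun t => rw0 _,
    fun t => rwL _, fun k hk => ?_, fun k hk => ?_, ?_, ?_⟩
  · have key : EntIneq T L M v' wo wT w0 wL w (fun s => max (s - k) 0)
        (fun s => g' (max s k) - g' k) := by
      refine (hE k hk).1.congr ?_ (ewo.mono fun x hx => by rw [hx])
        (ewT.mono fun x hx => by rw [hx]) (ew0.mono fun x hx => by rw [hx])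
        (ewL.mono fun x hx => by rw [hx])
      filter_upwards [ew, hQ] with z hz hzQ
      rw [hz, hvv _ hzQ, hgg k hk, hgg (max (w z) k)
        ⟨(rw' z).1.trans (le_max_left _ _), max_le (rw' z).2 hk.2⟩]
      exact ⟨rfl, rfl⟩
    exact key.timeChange hV hM mw rw' mw0 rw0 mwL rwL (by fun_prop) (by fun_prop)
      fun s => le_max_right _ _
  · have key : EntIneq T L M v' wo wT w0 wL w (fun s => max (k - s) 0)
        (fun s => g' k - g' (min s k)) := by
      refine (hE k hk).2.congr ?_ (ewo.mono fun x hx => by rw [hx])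
        (ewT.mono fun x hx => by rw [hx]) (ew0.mono fun x hx => by rw [hx])
        (ewL.mono fun x hx => by rw [hx])
      filter_upwards [ew, hQ] with z hz hzQ
      rw [hz, hvv _ hzQ, hgg k hk, hgg (min (w z) k)
        ⟨le_min (rw' z).1 hk.1, (min_le_left _ _).trans (rw' z).2⟩]
      exact ⟨rfl, rfl⟩
    exact key.timeChange hV hM mw rw' mw0 rw0 mwL rwL (by fun_prop) (by fun_prop)
      fun s => le_max_right _ _
  · exact (hV.ae_comp_inv (hul.ae_hasTrace hL ew)).mono fun t ht htI => ht (hWI t htI)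
  · exact (hV.ae_comp_inv (hur.ae_hasTrace hL ew)).mono fun t ht htI => ht (hWI t htI)

end

end SegmentIBVP

end

noncomputable section

namespace SegmentIBVP

/-! ### The stability estimate -/

theorem le_of_ae_le_of_continuousOn {f : ℝ → ℝ} {a b C : ℝ} (hab : a < b)
    (hf : ContinuousOn f (Icc a b)) (h : ∀ᵐ t : ℝ, t ∈ Ioo a b → f t ≤ C) :
    ∀ t ∈ Icc a b, f t ≤ C := by
  intro t ht
  have hsub : Icc a b ⊆ closure (Ioo a b ∩ {t | t ∈ Ioo a b → f t ≤ C}) := by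
    rw [← closure_Ioo hab.ne]
    exact closure_minimal ((Measure.dense_of_ae h).open_subset_closure_inter isOpen_Ioo) isClosed_closure
  have := ((hf t ht).mono (inter_subset_left.trans Ioo_subset_Icc_self)).mem_closure (hsub ht)
    (t := Iic C) fun s hs => hs.2 hs.1
  rwa [closure_Iic] at this

theorem ae_abs_le_supNormOn {h : ℝ → ℝ} {a b : ℝ} (hh : ContinuousOn h (Icc a b)) :
    ∀ᵐ x ∂volume.restrict (Icc a b), |h x| ≤ supNormOn h (Icc a b) := by
  obtain ⟨C, hC⟩ := isCompact_Icc.exists_bound_of_continuousOn hh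
  have hm : MemLp h ⊤ (volume.restrict (Icc a b)) :=
    memLp_top_of_bound (hh.aestronglyMeasurable measurableSet_Icc) C
      ((ae_restrict_iff' measurableSet_Icc).2 (Eventually.of_forall hC))
  filter_upwards [ae_le_eLpNormEssSup (f := h) (μ := volume.restrict (Icc a b))] with x hx
  rw [← eLpNorm_exponent_top] at hx
  have := ENNReal.toReal_mono hm.eLpNorm_ne_top hx
  rwa [toReal_enorm, Real.norm_eq_abs] at this

theorem abs_sub_le_supNormOn_deriv {g : ℝ → ℝ} (hg : ContDiff ℝ 1 g) {a b x y : ℝ}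
    (hx : x ∈ Icc a b) (hy : y ∈ Icc a b) :
    |g x - g y| ≤ supNormOn (deriv g) (Icc a b) * |x - y| := by
  rcases eq_or_ne x y with rfl | hne
  · simp
  have hab : a < b := by
    refine lt_of_le_of_ne (hx.1.trans hx.2) fun hab => hne ?_
    subst hab
    exact (le_antisymm hx.2 hx.1).trans (le_antisymm hy.1 hy.2)
  have hc : Continuous (deriv g) := hg.continuous_deriv (by simp)
  have hb : ∀ s ∈ Icc a b, |deriv g s| ≤ supNormOn (deriv g) (Icc a b) := by
    refine le_of_ae_le_of_continuousOn hab hc.abs.continuousOn ?_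
    filter_upwards [(ae_restrict_iff' measurableSet_Icc).1
      (ae_abs_le_supNormOn (a := a) (b := b) hc.continuousOn)] with s hs hsI
    exact hs (Ioo_subset_Icc_self hsI)
  exact (convex_Icc a b).norm_image_sub_le_of_norm_deriv_le
    (fun s _ => hg.differentiable (by simp) s) hb hy hx

theorem exists_lipschitzWith_comp_clamp {g : ℝ → ℝ} (hg : ContDiff ℝ 1 g) {α β : ℝ} (h : α ≤ β) :
    ∃ K, LipschitzWith K fun s => g (clamp α β s) := by
  have hc : LipschitzWith 1 (clamp α β) := (LipschitzWith.id.min_const β).const_max α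
  have hd : 0 ≤ supNormOn (deriv g) (Icc α β) := ENNReal.toReal_nonneg
  refine ⟨(supNormOn (deriv g) (Icc α β)).toNNReal, LipschitzWith.of_dist_le_mul fun x y => ?_⟩
  rw [Real.coe_toNNReal _ hd]
  refine (abs_sub_le_supNormOn_deriv hg (clamp_mem h x) (clamp_mem h y)).trans
    (mul_le_mul_of_nonneg_left ?_ hd)
  simpa [Real.dist_eq] using hc.dist_le_mul x y

theorem norm_sub_eq_integral {L : ℝ} {f f' : L1Segment L} {p p' : ℝ → ℝ}
    (h : f =ᵐ[volume.restrict (Icc (0 : ℝ) L)] p) (h' : f' =ᵐ[volume.restrict (Icc (0 : ℝ) L)] p') :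
    ‖f - f'‖ = ∫ x in Icc 0 L, |p x - p' x| := by
  rw [L1.norm_eq_integral_norm]
  refine integral_congr_ae ?_
  filter_upwards [Lp.coeFn_sub f f', h, h'] with x h1 h2 h3
  rw [h1, Pi.sub_apply, h2, h3, Real.norm_eq_abs]

section

variable {T L M M' α β α' β' C : ℝ} {g uo uT b0 bL uo' uT' b0' bL' : ℝ → ℝ}
  {u u' : ℝ × ℝ → ℝ} {K : NNReal} {U U' : ℝ → L1Segment L}

/-- Stability of the solutions of the autonomous problem with respect to their data. -/
theorem AutSol.norm_sub_le (h : AutSol T L M α β g uo uT b0 bL u)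
    (h' : AutSol T L M' α' β' g uo' uT' b0' bL' u') (hL : 0 < L) (hg : LipschitzWith K g)
    (hU : ContinuousOn U (Icc 0 T))
    (hUu : ∀ᵐ t : ℝ, t ∈ Ioo 0 T → U t =ᵐ[volume.restrict (Icc (0 : ℝ) L)] fun x => u (t, x))
    (hU' : ContinuousOn U' (Icc 0 T))
    (hUu' : ∀ᵐ t : ℝ, t ∈ Ioo 0 T →
      U' t =ᵐ[volume.restrict (Icc (0 : ℝ) L)] fun x => u' (t, x))
    {S : ℝ} (hS : 0 < S) (hST : S ≤ T) (hC0 : 0 ≤ C)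
    (h0 : ∀ᵐ t : ℝ, t ∈ Ioo 0 S → ∀ x ∈ uIcc (b0 t) (b0' t), ∀ y ∈ uIcc (b0 t) (b0' t),
      |g x - g y| ≤ C * |x - y|)
    (h1 : ∀ᵐ t : ℝ, t ∈ Ioo 0 S → ∀ x ∈ uIcc (bL t) (bL' t), ∀ y ∈ uIcc (bL t) (bL' t),
      |g x - g y| ≤ C * |x - y|) :
    ‖U S - U' S‖ ≤ ‖U 0 - U' 0‖ + C * ∫ t in Ioo 0 S, (|b0 t - b0' t| + |bL t - bL' t|) := by
  obtain ⟨R₁, hR₁0, hR₁⟩ := exists_abs_le_of_continuous continuous_id α β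
  obtain ⟨R₂, hR₂0, hR₂⟩ := exists_abs_le_of_continuous continuous_id α' β'
  have hR : ∀ s ∈ Icc α β, |s| ≤ max R₁ R₂ := fun s hs => (hR₁ s hs).trans (le_max_left _ _)
  have hR' : ∀ s ∈ Icc α' β', |s| ≤ max R₁ R₂ := fun s hs => (hR₂ s hs).trans (le_max_right _ _)
  have hT : 0 < T := hS.trans_le hST
  have hdiff : ∀ {b b' : ℝ → ℝ}, Measurable b → Measurable b' → (∀ t, b t ∈ Icc α β) →
      (∀ t, b' t ∈ Icc α' β') → IntegrableOn (fun t => |b t - b' t|) (Ioo 0 S) := by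
    intro b b' hb hb' hr hr'
    refine ((locallyIntegrable_of_abs_le (R := 2 * max R₁ R₂) (measurable_abs_sub hb hb')
      fun t => ?_).integrableOn_isCompact isCompact_Icc).mono_set Ioo_subset_Icc_self
    rw [abs_abs]
    exact abs_sub_le_two_mul (hR _ (hr t)) (hR' _ (hr' t))
  have key := InteriorSol.comparison hL hg ((h.interiorSol hT hL hg hR).mono hST)
    ((h'.interiorSol hT hL hg hR').mono hST) hC0 h0 h1
    ((hdiff h.meas_left h'.meas_left h.range_left h'.range_left).add
      (hdiff h.meas_right h'.meas_right h.range_right h'.range_right))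
  set B := C * ∫ t in Ioo 0 S, (|b0 t - b0' t| + |bL t - bL' t|) with hB
  have hcont : ContinuousOn (fun t => ‖U t - U' t‖) (Icc 0 T) := (hU.sub hU').norm
  have hdist : ∀ᵐ t : ℝ, t ∈ Ioo 0 T → ‖U t - U' t‖ = l1dist L u u' t := by
    filter_upwards [hUu, hUu'] with t h1 h2 ht
    exact norm_sub_eq_integral (h1 ht) (h2 ht)
  have hs : ∀ᵐ s : ℝ, s ∈ Ioo 0 S → -‖U s - U' s‖ ≤ B - ‖U S - U' S‖ := by
    filter_upwards [key, hdist] with s hs1 hs2 hsI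
    have hst := le_of_ae_le_of_continuousOn hsI.2 (C := ‖U s - U' s‖ + B)
      (hcont.mono (Icc_subset_Icc hsI.1.le hST)) (by
        filter_upwards [hs1, hdist] with t ht1 ht2 htI
        rw [hs2 ⟨hsI.1, hsI.2.trans_le hST⟩,
          ht2 ⟨hsI.1.trans htI.1, htI.2.trans_le hST⟩]
        exact ht1 hsI.1 htI.1 htI.2) S (right_mem_Icc.2 hsI.2.le)
    linarith
  have := le_of_ae_le_of_continuousOn hS (hcont.mono (Icc_subset_Icc le_rfl hST)).neg hs 0
    (left_mem_Icc.2 hS.le)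
  simp only [Pi.neg_apply] at this
  linarith

end

theorem isTimeContinuousRepr_of_timeChange {T L c : ℝ} {v V W uo wo wT : ℝ → ℝ}
    {u : ℝ → ℝ → ℝ} {w : ℝ × ℝ → ℝ} {U : ℝ → L1Segment L} (hV : TimeChange c v V W)
    (hU : ContinuousOn U (Icc 0 (V T)))
    (hUu : ∀ᵐ t : ℝ, t ∈ Ioo 0 (V T) →
      U t =ᵐ[volume.restrict (Icc (0 : ℝ) L)] fun x => w (W t, x))
    (hU0 : U 0 =ᵐ[volume.restrict (Icc (0 : ℝ) L)] wo)
    (hUT : U (V T) =ᵐ[volume.restrict (Icc (0 : ℝ) L)] wT)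
    (ew : Function.uncurry u =ᵐ[volume.restrict (Icc (0 : ℝ) T ×ˢ Icc (0 : ℝ) L)] w)
    (ewo : uo =ᵐ[volume.restrict (Icc 0 L)] wo) (ewT : u T =ᵐ[volume.restrict (Icc 0 L)] wT) :
    IsTimeContinuousRepr T L uo u fun t => U (V t) where
  continuousOn := hU.comp hV.contDiff.continuous.continuousOn
    ((mapsTo_image V _).mono_right (hV.image_Icc T).subset)
  ae_eq := by
    rw [Measure.volume_eq_prod, ← Measure.prod_restrict] at ew
    have hne0 : ∀ᵐ t : ℝ, t ≠ 0 := by simp [ae_iff]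
    have hneT : ∀ᵐ t : ℝ, t ≠ T := by simp [ae_iff]
    filter_upwards [ae_restrict_of_ae (hV.ae_comp hUu), Measure.ae_ae_of_ae_prod ew,
      ae_restrict_of_ae hne0, ae_restrict_of_ae hneT, ae_restrict_mem measurableSet_Icc]
      with t h1 h2 h3 h4 ht
    have h5 := h1 ⟨by
      rw [← hV.zero]; exact hV.strictMono (lt_of_le_of_ne ht.1 (Ne.symm h3)),
      hV.strictMono (lt_of_le_of_ne ht.2 h4)⟩
    filter_upwards [h5, h2] with x hx1 hx2
    rw [hx1, hV.left]
    exact hx2.symm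
  initial := by
    simp only [hV.zero]
    exact hU0.trans ewo.symm
  final := hUT.trans ewT.symm

end SegmentIBVP

end

open SegmentIBVP in
theorem proposition3p2
    (T L : ℝ) (hT : 0 < T) (hL : 0 < L)
    (vmin : ℝ) (hvmin : 0 < vmin)
    (v : ℝ → ℝ) (hvlip : ∃ K, LipschitzOnWith K v (Set.Icc 0 T))
    (hv : ∀ t ∈ Set.Icc (0 : ℝ) T, vmin ≤ v t)
    (g : ℝ → ℝ) (hg : ContDiff ℝ 1 g)
    (uo uo' : ℝ → ℝ) (huo : MemL1BV uo 0 L) (huo' : MemL1BV uo' 0 L)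
    (ub ub' : Fin 2 → ℝ → ℝ) (hub : ∀ i, MemL1BV (ub i) 0 T) (hub' : ∀ i, MemL1BV (ub' i) 0 T)
    (u u' : ℝ → ℝ → ℝ)
    (hu : IsSolution T L (fun t w => v t * g w) uo ub u)
    (hu' : IsSolution T L (fun t w => v t * g w) uo' ub' u')
    (hul : HasLeftTrace T u) (hur : HasRightTrace T L u)
    (hul' : HasLeftTrace T u') (hur' : HasRightTrace T L u') :
    ∃ U U' : ℝ → L1Segment L,
      IsTimeContinuousRepr T L uo u U ∧ IsTimeContinuousRepr T L uo' u' U' ∧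
      ∀ t ∈ Set.Icc (0 : ℝ) T,
        ‖U t - U' t‖ ≤
          (∫ x in (0 : ℝ)..L, |uo x - uo' x|)
            + supNormOn v (Set.Icc 0 t)
              * supNormOn (deriv g)
                  (essHull ![ub 0, ub 1, ub' 0, ub' 1] (fun _ => Set.Icc 0 t))
              * ∑ i, ∫ s in (0 : ℝ)..t, |ub i s - ub' i s| := by
  obtain ⟨K, hK⟩ := hvlip
  obtain ⟨V, W, hV⟩ := exists_timeChange (v := fun t => v (clamp 0 T t)) hvmin
    (hK.continuousOn.comp_continuous (continuous_clamp 0 T) fun t => clamp_mem hT.le t)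
    (fun t => hv _ (clamp_mem hT.le t))
  have hvv : ∀ t ∈ Icc 0 T, v (clamp 0 T t) = v t := fun t ht => by rw [clamp_eq ht]
  have hVT : 0 < V T := by rw [← hV.zero]; exact hV.strictMono hT
  have hne := dataHull_nonempty hT.le hL huo hub
  obtain ⟨α, β, e⟩ : ∃ α β, dataHull T L uo ub = Icc α β := ⟨_, _, rfl⟩
  obtain ⟨α', β', e'⟩ : ∃ α β, dataHull T L uo' ub' = Icc α β := ⟨_, _, rfl⟩
  rw [e, nonempty_Icc] at hne
  have hA : Icc α β ⊆ Icc (min α α') (max β β') := Icc_subset_Icc (min_le_left _ _) (le_max_left _ _)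
  have hA' : Icc α' β' ⊆ Icc (min α α') (max β β') :=
    Icc_subset_Icc (min_le_right _ _) (le_max_right _ _)
  obtain ⟨Kg, hKg⟩ := exists_lipschitzWith_comp_clamp hg (α := min α α') (β := max β β')
    ((min_le_left _ _).trans (hne.trans (le_max_left _ _)))
  obtain ⟨M, wo, wT, w0, wL, w, hw, ew, ewo, ewT, ew0, ewL⟩ := hu.exists_autSol hT hL hV hvv
    hg.continuous huo hub hul hur e (g' := fun s => g (clamp (min α α') (max β β') s))
    (fun s hs => by rw [clamp_eq (hA hs)]) hKg.continuous
  obtain ⟨M', wo', wT', w0', wL', w', hw', ew', ewo', ewT', ew0', ewL'⟩ :=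
    hu'.exists_autSol hT hL hV hvv hg.continuous huo' hub' hul' hur' e'
      (g' := fun s => g (clamp (min α α') (max β β') s))
      (fun s hs => by rw [clamp_eq (hA' hs)]) hKg.continuous
  obtain ⟨U, hU, hUu, hU0, hUT⟩ := hw.exists_repr hVT hL hKg
  obtain ⟨U', hU', hUu', hU0', hUT'⟩ := hw'.exists_repr hVT hL hKg
  have hrep := isTimeContinuousRepr_of_timeChange hV hU hUu hU0 hUT ew ewo ewT
  have hrep' := isTimeContinuousRepr_of_timeChange hV hU' hUu' hU0' hUT' ew' ewo' ewT'
  refine ⟨fun t => U (V t), fun t => U' (V t), hrep, hrep', fun t ht => ?_⟩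
  have hinit : ‖U 0 - U' 0‖ = ∫ x in (0 : ℝ)..L, |uo x - uo' x| := by
    rw [norm_sub_eq_integral (hU0.trans ewo.symm) (hU0'.trans ewo'.symm),
      intervalIntegral.integral_of_le hL.le, integral_Icc_eq_integral_Ioc]
  rcases eq_or_lt_of_le ht.1 with rfl | ht0
  · simp only [hV.zero, hinit, intervalIntegral.integral_same, Finset.sum_const_zero, mul_zero,
      add_zero, le_refl]
  set H := essHull ![ub 0, ub 1, ub' 0, ub' 1] (fun _ => Icc 0 t) with hH
  have hC0 : 0 ≤ supNormOn (deriv g) H := ENNReal.toReal_nonneg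
  have hsub : Icc 0 t ⊆ Icc 0 T := Icc_subset_Icc le_rfl ht.2
  have hlip : ∀ x ∈ H, ∀ y ∈ H, |g x - g y| ≤ supNormOn (deriv g) H * |x - y| :=
    fun x hx y hy => abs_sub_le_supNormOn_deriv hg hx hy
  have hbd : ∀ {b : ℝ → ℝ}, MemL1BV b 0 T →
      ∃ C, ∀ᵐ x ∂volume.restrict (Icc 0 t), |b x| ≤ C := fun hb => by
    obtain ⟨C, hC⟩ := hb.exists_ae_abs_le hT.le
    exact ⟨C, ae_restrict_of_ae_restrict_of_subset hsub hC⟩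
  have hmem := ae_mem_essHull (u := ![ub 0, ub 1, ub' 0, ub' 1]) (I := fun _ => Icc 0 t) (by
    intro l
    fin_cases l
    · exact hbd (hub 0)
    · exact hbd (hub 1)
    · exact hbd (hub' 0)
    · exact hbd (hub' 1))
  have hbdry : ∀ {b b' p p' : ℝ → ℝ},
      (∀ᵐ s ∂volume.restrict (Icc 0 t), b s ∈ H) → (∀ᵐ s ∂volume.restrict (Icc 0 t), b' s ∈ H) →
      b =ᵐ[volume.restrict (Icc 0 T)] p → b' =ᵐ[volume.restrict (Icc 0 T)] p' →
      (∀ s, p (W s) ∈ Icc α β) → (∀ s, p' (W s) ∈ Icc α' β') →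
      ∀ᵐ s : ℝ, s ∈ Ioo 0 (V t) → ∀ x ∈ uIcc (p (W s)) (p' (W s)),
        ∀ y ∈ uIcc (p (W s)) (p' (W s)),
        |g (clamp (min α α') (max β β') x) - g (clamp (min α α') (max β β') y)|
          ≤ supNormOn (deriv g) H * |x - y| := by
    intro b b' p p' hb hb' hp hp' hr hr'
    have hall : ∀ᵐ s : ℝ, s ∈ Icc 0 t → p s ∈ H ∧ p' s ∈ H := by
      rw [← ae_restrict_iff' measurableSet_Icc]
      filter_upwards [hb, hb', ae_restrict_of_ae_restrict_of_subset hsub hp,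
        ae_restrict_of_ae_restrict_of_subset hsub hp'] with s h1 h2 h3 h4
      rw [← h3, ← h4]
      exact ⟨h1, h2⟩
    filter_upwards [hV.ae_comp_inv hall] with s hs hsI x hx y hy
    have hsW : W s ∈ Icc 0 t :=
      ⟨by rw [← hV.inv_zero]; exact hV.strictMono_inv.monotone hsI.1.le,
        by rw [← hV.left t]; exact hV.strictMono_inv.monotone hsI.2.le⟩
    have hcl : uIcc (p (W s)) (p' (W s)) ⊆ Icc (min α α') (max β β') :=
      uIcc_subset_Icc (hA (hr s)) (hA' (hr' s))
    have hhull : uIcc (p (W s)) (p' (W s)) ⊆ H := uIcc_subset_Icc (hs hsW).1 (hs hsW).2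
    rw [clamp_eq (hcl hx), clamp_eq (hcl hy)]
    exact hlip x (hhull hx) y (hhull hy)
  have key := hw.norm_sub_le hw' hL hKg hU hUu hU' hUu' (S := V t)
    (by rw [← hV.zero]; exact hV.strictMono ht0) (hV.strictMono.monotone ht.2) hC0
    (hbdry (hmem 0) (hmem 2) ew0 ew0' hw.range_left hw'.range_left)
    (hbdry (hmem 1) (hmem 3) ewL ewL' hw.range_right hw'.range_right)
  rw [hinit] at key
  refine key.trans ?_
  have hi : ∀ i, IntegrableOn (fun s => |ub i s - ub' i s|) (Icc 0 t) := fun i =>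
    Integrable.abs (((hub i).1.sub (hub' i).1).mono_set hsub)
  have hsum : ∑ i, ∫ s in (0 : ℝ)..t, |ub i s - ub' i s|
      = ∫ s in Icc 0 t, (|ub 0 s - ub' 0 s| + |ub 1 s - ub' 1 s|) := by
    rw [Fin.sum_univ_two, integral_add (hi 0) (hi 1), intervalIntegral.integral_of_le ht.1,
      intervalIntegral.integral_of_le ht.1, integral_Icc_eq_integral_Ioc,
      integral_Icc_eq_integral_Ioc]
  have hvt : ContinuousOn v (Icc 0 t) := hK.continuousOn.mono hsub
  have hint : ∫ s in Ioo 0 (V t), (|w0 (W s) - w0' (W s)| + |wL (W s) - wL' (W s)|)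
      ≤ supNormOn v (Icc 0 t) * ∫ s in Icc 0 t, (|ub 0 s - ub' 0 s| + |ub 1 s - ub' 1 s|) := by
    rw [← integral_Icc_eq_integral_Ioo, hV.integral_comp t fun s =>
      |w0 (W s) - w0' (W s)| + |wL (W s) - wL' (W s)|, ← integral_const_mul]
    have hcongr : ∫ s in Icc 0 t, v (clamp 0 T s) * (|w0 (W (V s)) - w0' (W (V s))|
          + |wL (W (V s)) - wL' (W (V s))|)
        = ∫ s in Icc 0 t, v s * (|ub 0 s - ub' 0 s| + |ub 1 s - ub' 1 s|) := by
      refine integral_congr_ae ?_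
      filter_upwards [ae_restrict_of_ae_restrict_of_subset hsub ew0,
        ae_restrict_of_ae_restrict_of_subset hsub ew0',
        ae_restrict_of_ae_restrict_of_subset hsub ewL,
        ae_restrict_of_ae_restrict_of_subset hsub ewL', ae_restrict_mem measurableSet_Icc]
        with s h1 h2 h3 h4 hs
      rw [hV.left, hvv s (hsub hs), h1, h2, h3, h4]
    rw [hcongr]
    refine integral_mono_ae (IntegrableOn.continuousOn_mul hvt ((hi 0).add (hi 1)) isCompact_Icc)
      (((hi 0).add (hi 1)).const_mul _) ?_
    filter_upwards [ae_abs_le_supNormOn hvt] with s hs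
    exact mul_le_mul_of_nonneg_right ((le_abs_self _).trans hs)
      (add_nonneg (abs_nonneg _) (abs_nonneg _))
  rw [hsum]
  have := mul_le_mul_of_nonneg_left hint hC0
  linarith
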